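/- Let $T>0$, $K\in\mathbb R$, let $r,q,\sigma:[0,T]\to\mathbb R$ be differentiable with $\sigma>0$, and let $w$ solve on $[0,T]$ the Riccati equation $$w' = 2(r-q)\frac{\sigma'}{\sigma}-\big[(r-q)^2+r'-q'\big]+w^2+2w\frac{\sigma'}{\sigma}.$$ Let $S_B:[0,T]\to(0,\infty)$ be continuous, continuously differentiable on $[0,T)$ with $S_B'$ integrable on $(0,T)$, and $S_B(T)=K$. Let $C(t,S)$ be a classical solution of the free boundary problem for the American call in the time-dependent Ornstein–Uhlenbeck (Bachelier) model $dS_t=[r(t)-q(t)]S_t\,dt+\sigma(t)\,dW_t$ with exercise boundary $S_B$: $C$ is continuous on $\{0\le t\le T,\ 0\le S\le S_B(t)\}$, $C_t$ and $C_{SS}$ exist and are continuous for $0<t<T$, $0<S<S_B(t)$, the delta $C_S$ exists and is continuous for $0\le t<T$, $0\le S\le S_B(t)$ (one-sided in $S$ at the two ends), and $$C_t+\tfrac12\sigma^2C_{SS}+(r-q)SC_S=rC\quad(0<t<T,\ 0<S<S_B(t)),$$ $$C(T,S)=(S-K)^+,\qquad C(t,0)=0,\qquad C(t,S_B(t))=S_B(t)-K,\qquad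 C_S(t,S_B(t))=1\ (t<T).$$ Put $$g(t)=e^{\int_T^t w\,ds},\qquad \tau(t)=\tfrac12\int_t^T\sigma^2(s)g(s)^2\,ds,\qquad a(t)=\frac{g'+g(r-q)}{g^3\sigma^2},$$ $$f(t,x)=\tfrac12\log\frac{g(t)}{g(T)}+\tfrac12\int_T^t(3r-q)\,ds-\tfrac12a(t)x^2 .$$ Then $\tau(\cdot)$ is a bijection $[0,T]\to[0,\tau(0)]$; let $t=t(\tau)$ be its inverse. Put $y(\tau)=S_B(t)\,g(t)$, $u(\tau,x)=C(t,x/g(t))\,e^{-f(t,x)}$ and, explicitly in terms of $y$ (with $t=t(\tau)$), $$f^+(\tau)=\Big[\frac{y(\tau)}{g(t)}-K\Big]e^{-f(t,y(\tau))},\qquad D(\tau)=\frac{e^{-f(t,y(\tau))}}{g(t)}\big[1+y(\tau)\,(y(\tau)-Kg(t))\,a(t)\big],$$ $$\Psi(\tau)=-\frac{f^+(\tau)}{y(\tau)}+D(\tau),\qquad \lambda(\tau,x)=-x\,\frac{d}{d\tau}\Big(\frac{f^+(\tau)}{y(\tau)}\Big).$$ Let $\theta_3(z,\omega)=1+2\sum_{n\ge1}\omega^{n^2}\cos(2nz)$,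 $\theta_3'=\partial_z\theta_3$, $\omega_2(s,\tau)=e^{-\pi^2(\tau-s)/y(\tau)^2}$, $\phi_\pm(x,z,\tau)=\frac{\pi(x\pm z)}{2y(\tau)}$, and $$B_0(x,\tau\,|\,\xi,s)=\sum_{n\in\mathbb Z}\frac1{2\sqrt{\pi(\tau-s)}}\Big[e^{-\frac{(2ny(\tau)+x-\xi)^2}{4(\tau-s)}}-e^{-\frac{(2ny(\tau)+x+\xi)^2}{4(\tau-s)}}\Big],$$ $$\upsilon_0^+(\tau\,|\,s,\xi)=\sum_{n\ne0}\frac{\xi-(2n+1)y(\tau)}{2\sqrt{\pi(\tau-s)^3}}\,e^{-\frac{(-\xi+(2n+1)y(\tau))^2}{4(\tau-s)}}.$$ The following hold. 1. (Reduction to the heat equation.) $u_\tau=u_{xx}$ for $0<\tau<\tau(0)$, $0<x<y(\tau)$; $u(0,x)=0$ on $[0,y(0)]$; $u(\tau,0)=0$ and $u(\tau,y(\tau))=f^+(\tau)$ on $[0,\tau(0)]$; $y(0)=K$ and $f^+(0)=0$; and $u_x(\tau,y(\tau))=D(\tau)$ for $0<\tau\le\tau(0)$ (one-sided derivative). 2.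 (Theta forms.) For $0\le s<\tau\le\tau(0)$, $\tau>0$ and all real $x,\xi$ the series converge and $$B_0=\frac1{2y(\tau)}\big[\theta_3(\phi_-(x,\xi,\tau),\omega_2(s,\tau))-\theta_3(\phi_+(x,\xi,\tau),\omega_2(s,\tau))\big],$$ $$\partial_xB_0=\frac{\pi}{4y(\tau)^2}\big[\theta_3'(\phi_-(x,\xi,\tau),\omega_2(s,\tau))-\theta_3'(\phi_+(x,\xi,\tau),\omega_2(s,\tau))\big],$$ $$\upsilon_0^+=\frac{\pi}{2y(\tau)^2}\theta_3'(\phi_-(y(\tau),\xi,\tau),\omega_2(s,\tau))+\frac{y(\tau)-\xi}{2\sqrt{\pi(\tau-s)^3}}e^{-\frac{(y(\tau)-\xi)^2}{4(\tau-s)}}.$$ 3. (Nonlinear Volterra equation for $y$.) For $0<\tau\le\tau(0)$ the integrals below converge and $$D(\tau)=\frac{f^+(\tau)}{y(\tau)}+\frac{\pi}{2y(\tau)^2}\int_0^\tau\Psi(s)\,\theta_3'\big(\phi_-(y(\tau),y(s),\tau),\omega_2(s,\tau)\big)ds+\int_0^\tau\!\!\int_0^{y(s)}\lambda(s,\xi)\,\partial_xB_0(y(\tau),\tau\,|\,\xi,s)\,d\xi\,ds;$$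 the left-hand side equals $\Psi(\tau)+f^+(\tau)/y(\tau)$. Equivalently, $$D(\tau)=-\int_0^\tau\Psi(s)\Big[\frac{y(\tau)-y(s)}{2\sqrt{\pi(\tau-s)^3}}e^{-\frac{(y(\tau)-y(s))^2}{4(\tau-s)}}-\upsilon_0^+(\tau\,|\,s,y(s))\Big]ds+\int_0^\tau\!\!\int_0^{y(s)}\lambda(s,\xi)\,\partial_xB_0(y(\tau),\tau\,|\,\xi,s)\,d\xi\,ds+\frac{f^+(\tau)}{y(\tau)}.$$ 4. (Price.) For $0<\tau\le\tau(0)$ and $0\le x\le y(\tau)$ the integrals below converge and $$u(\tau,x)=\int_0^\tau\Psi(s)B_0(x,\tau\,|\,y(s),s)\,ds+\int_0^\tau\!\!\int_0^{y(s)}\lambda(s,\xi)B_0(x,\tau\,|\,\xi,s)\,d\xi\,ds+\frac{x}{y(\tau)}f^+(\tau),$$ and hence $C(t,S)=e^{f(t,Sg(t))}\,u(\tau(t),Sg(t))$, with $u$ given by this formula, for $0\le t<T$, $0\le S\le S_B(t)$. -/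

import Mathlib

open Set Filter Topology MeasureTheory

noncomputable section

/-- Data of an American call in the time-dependent Ornstein-Uhlenbeck (Bachelier) model
`dS = (r - q) S dt + σ dW`: maturity `T`, strike `K`, the coefficients `r, q, σ`, the auxiliary
function `w` that defines the change of variables, and the exercise boundary `SB = S_B(t)`. -/
structure OUCall where
  T : ℝ
  K : ℝ
  r : ℝ → ℝ
  q : ℝ → ℝ
  σ : ℝ → ℝ
  w : ℝ → ℝ
  SB : ℝ → ℝ

namespace OUCall

variable (M : OUCall)

/-- Right-hand side of the Riccati equation for `w`; derivatives are taken on `[0, T]`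
(one-sided at the end points). -/
def riccatiRHS (t : ℝ) : ℝ :=
  2 * (M.r t - M.q t) * (derivWithin M.σ (Icc 0 M.T) t / M.σ t)
    - ((M.r t - M.q t) ^ 2 + derivWithin M.r (Icc 0 M.T) t - derivWithin M.q (Icc 0 M.T) t)
    + M.w t ^ 2
    + 2 * M.w t * (derivWithin M.σ (Icc 0 M.T) t / M.σ t)

/-- The option delta `∂C/∂S` on the closed holding region `0 ≤ S ≤ S_B(t)`
(one-sided at the two ends). -/
def delta (C : ℝ → ℝ → ℝ) (t S : ℝ) : ℝ :=
  derivWithin (C t) (Icc 0 (M.SB t)) S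

/-- `C` is a classical solution, in the holding region, of the free boundary problem for the
American call with exercise boundary `S_B`: the pricing equation, the terminal condition, the
condition at `S = 0`, value matching and smooth fit at `S = S_B(t)`. -/
structure IsPrice (C : ℝ → ℝ → ℝ) : Prop where
  continuousOn :
    ContinuousOn (fun p : ℝ × ℝ => C p.1 p.2)
      {p : ℝ × ℝ | p.1 ∈ Icc 0 M.T ∧ p.2 ∈ Icc 0 (M.SB p.1)}
  differentiable_time : ∀ t ∈ Ioo 0 M.T, ∀ S ∈ Ioo 0 (M.SB t),
    DifferentiableAt ℝ (fun t' => C t' S) t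
  continuousOn_time :
    ContinuousOn (fun p : ℝ × ℝ => deriv (fun t' => C t' p.2) p.1)
      {p : ℝ × ℝ | p.1 ∈ Ioo 0 M.T ∧ p.2 ∈ Ioo 0 (M.SB p.1)}
  differentiable_space : ∀ t ∈ Ico 0 M.T, DifferentiableOn ℝ (C t) (Icc 0 (M.SB t))
  continuousOn_delta :
    ContinuousOn (fun p : ℝ × ℝ => M.delta C p.1 p.2)
      {p : ℝ × ℝ | p.1 ∈ Ico 0 M.T ∧ p.2 ∈ Icc 0 (M.SB p.1)}
  differentiable_space_two : ∀ t ∈ Ioo 0 M.T, ∀ S ∈ Ioo 0 (M.SB t),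
    DifferentiableAt ℝ (deriv (C t)) S
  continuousOn_space_two :
    ContinuousOn (fun p : ℝ × ℝ => deriv (deriv (C p.1)) p.2)
      {p : ℝ × ℝ | p.1 ∈ Ioo 0 M.T ∧ p.2 ∈ Ioo 0 (M.SB p.1)}
  pde : ∀ t ∈ Ioo 0 M.T, ∀ S ∈ Ioo 0 (M.SB t),
    deriv (fun t' => C t' S) t + 1 / 2 * M.σ t ^ 2 * deriv (deriv (C t)) S
      + (M.r t - M.q t) * S * deriv (C t) S = M.r t * C t S
  terminal : ∀ S ∈ Icc 0 (M.SB M.T), C M.T S = max (S - M.K) 0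
  left_boundary : ∀ t ∈ Icc 0 M.T, C t 0 = 0
  value_matching : ∀ t ∈ Icc 0 M.T, C t (M.SB t) = M.SB t - M.K
  smooth_fit : ∀ t ∈ Ico 0 M.T, M.delta C t (M.SB t) = 1

/-! ### Change of variables -/

/-- `g(t) = exp (∫_T^t w(s) ds)`, so that `x = S g(t)`. -/
def g (t : ℝ) : ℝ := Real.exp (∫ s in M.T..t, M.w s)

/-- `τ(t) = 1/2 ∫_t^T σ(s)^2 g(s)^2 ds`. -/
def tau (t : ℝ) : ℝ := 1 / 2 * ∫ s in t..M.T, M.σ s ^ 2 * M.g s ^ 2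

/-- The inverse map `τ ↦ t(τ)` from `[0, τ(0)]` to `[0, T]`. -/
def tInv (τ : ℝ) : ℝ := Function.invFunOn M.tau (Icc 0 M.T) τ

/-- `a(t) = (g'(t) + g(t) (r(t) - q(t))) / (g(t)^3 σ(t)^2)`. -/
def a (t : ℝ) : ℝ :=
  (derivWithin M.g (Icc 0 M.T) t + M.g t * (M.r t - M.q t)) / (M.g t ^ 3 * M.σ t ^ 2)

/-- `f(t, x) = 1/2 log (g(t)/g(T)) + 1/2 ∫_T^t (3 r - q) ds
  - (g'(t) + g(t) (r(t) - q(t))) / (2 g(t)^3 σ(t)^2) x^2`. -/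
def f (t x : ℝ) : ℝ :=
  1 / 2 * Real.log (M.g t / M.g M.T) + 1 / 2 * (∫ s in M.T..t, (3 * M.r s - M.q s))
    - M.a t / 2 * x ^ 2

/-- The transformed exercise boundary `y(τ) = S_B(t(τ)) g(t(τ))`. -/
def y (τ : ℝ) : ℝ := M.SB (M.tInv τ) * M.g (M.tInv τ)

/-- The transformed price `u(τ, x) = C(t(τ), S) exp (-f(t(τ), x))`, `S = x / g(t(τ))`. -/
def u (C : ℝ → ℝ → ℝ) (τ x : ℝ) : ℝ :=
  C (M.tInv τ) (x / M.g (M.tInv τ)) * Real.exp (-M.f (M.tInv τ) x)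

/-! ### Boundary data, explicit in terms of `y` -/

/-- `f⁺(τ) = (y(τ)/g - K) exp (-f(t(τ), y(τ)))`, the boundary value of `u` at `x = y(τ)`. -/
def fPlus (τ : ℝ) : ℝ :=
  (M.y τ / M.g (M.tInv τ) - M.K) * Real.exp (-M.f (M.tInv τ) (M.y τ))

/-- `(exp (-f(t(τ), y(τ))) / g) (1 + y(τ) (y(τ) - K g) a(t(τ)))`, the boundary value of `∂u/∂x`
at `x = y(τ)`. -/
def gradU (τ : ℝ) : ℝ :=
  Real.exp (-M.f (M.tInv τ) (M.y τ)) / M.g (M.tInv τ)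
    * (1 + M.y τ * (M.y τ - M.K * M.g (M.tInv τ)) * M.a (M.tInv τ))

/-- `Ψ(τ, y(τ)) = -f⁺(τ)/y(τ) + ∂u/∂x(τ, y(τ))`, with both terms explicit. -/
def Psi (τ : ℝ) : ℝ := -(M.fPlus τ / M.y τ) + M.gradU τ

/-- The source term `λ(τ, x) = -x (d/dτ) (f⁺(τ)/y(τ))`. -/
def lam (τ x : ℝ) : ℝ := -x * deriv (fun s => M.fPlus s / M.y s) τ

end OUCall

/-! ### Jacobi theta function and kernels -/

/-- `θ₃(z, ω) = 1 + 2 ∑_{n ≥ 1} ω^{n^2} cos (2 n z)`. -/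
def theta3 (z ω : ℝ) : ℝ :=
  1 + 2 * ∑' n : ℕ, ω ^ ((n + 1) ^ 2) * Real.cos (2 * ((n : ℝ) + 1) * z)

/-- `θ₃'(z, ω)`, the derivative in the first argument. -/
def theta3' (z ω : ℝ) : ℝ := deriv (fun v => theta3 v ω) z

namespace OUCall

variable (M : OUCall)

/-- `ω₂(s, τ) = exp ((π √(s - τ) / y(τ))^2) = exp (-π^2 (τ - s) / y(τ)^2)`. -/
def omega2 (s τ : ℝ) : ℝ := Real.exp (-(Real.pi ^ 2 * (τ - s) / M.y τ ^ 2))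

/-- `φ₋(x, z, τ) = π (x - z) / (2 y(τ))`. -/
def phiMinus (x z τ : ℝ) : ℝ := Real.pi * (x - z) / (2 * M.y τ)

/-- `φ₊(x, z, τ) = π (x + z) / (2 y(τ))`. -/
def phiPlus (x z τ : ℝ) : ℝ := Real.pi * (x + z) / (2 * M.y τ)

/-- `Υ_n(x, τ | ξ, s)`. -/
def Upsilon (n : ℤ) (x τ ξ s : ℝ) : ℝ :=
  1 / (2 * Real.sqrt (Real.pi * (τ - s))) *
    (Real.exp (-((2 * n * M.y τ + x - ξ) ^ 2 / (4 * (τ - s))))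
      - Real.exp (-((2 * n * M.y τ + x + ξ) ^ 2 / (4 * (τ - s)))))

/-- `B₀(x, τ | ξ, s) = ∑_{n ∈ ℤ} Υ_n(x, τ | ξ, s)`. -/
def B0 (x τ ξ s : ℝ) : ℝ := ∑' n : ℤ, M.Upsilon n x τ ξ s

/-- The theta form of `B₀`. -/
def B0Theta (x τ ξ s : ℝ) : ℝ :=
  1 / (2 * M.y τ) * (theta3 (M.phiMinus x ξ τ) (M.omega2 s τ)
    - theta3 (M.phiPlus x ξ τ) (M.omega2 s τ))

/-- The theta form of `∂B₀/∂x`. -/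
def B1 (x τ ξ s : ℝ) : ℝ :=
  Real.pi / (4 * M.y τ ^ 2) * (theta3' (M.phiMinus x ξ τ) (M.omega2 s τ)
    - theta3' (M.phiPlus x ξ τ) (M.omega2 s τ))

/-- The `n`-th summand of `υ₀⁺(τ | s, ξ)`. -/
def upsilonTerm (n : ℤ) (τ s ξ : ℝ) : ℝ :=
  (ξ - (2 * n + 1) * M.y τ) / (2 * Real.sqrt (Real.pi * (τ - s) ^ 3))
    * Real.exp (-((-ξ + (2 * n + 1) * M.y τ) ^ 2 / (4 * (τ - s))))

/-- `υ₀⁺(τ | s, ξ)`, the sum over all integers `n ≠ 0`. -/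
def upsilonPlus (τ s ξ : ℝ) : ℝ := ∑' n : {n : ℤ // n ≠ 0}, M.upsilonTerm n τ s ξ

/-- `(y(τ) - ξ) / (2 √(π (τ - s)^3)) · exp (-(y(τ) - ξ)^2 / (4 (τ - s)))`. -/
def gaussKernel (τ s ξ : ℝ) : ℝ :=
  (M.y τ - ξ) / (2 * Real.sqrt (Real.pi * (τ - s) ^ 3))
    * Real.exp (-((M.y τ - ξ) ^ 2 / (4 * (τ - s))))

/-- The semi-analytic representation
`∫_0^τ Ψ(s, y(s)) B₀(x, τ | y(s), s) ds + ∫_0^τ ∫_0^{y(s)} λ(s, ξ) B₀(x, τ | ξ, s) dξ ds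
  + x f⁺(τ)/y(τ)`. -/
def uRep (τ x : ℝ) : ℝ :=
  (∫ s in (0 : ℝ)..τ, M.Psi s * M.B0 x τ (M.y s) s)
    + (∫ s in (0 : ℝ)..τ, ∫ ξ in (0 : ℝ)..M.y s, M.lam s ξ * M.B0 x τ ξ s)
    + x / M.y τ * M.fPlus τ

end OUCall

end

noncomputable section

/-! ### Theta series -/

/-! The Riccati equation says exactly that `a' = -a² g² σ²` (`hasDerivWithinAt_a`). With this the
substitution removes the drift and the discounting, and `u` solves the heat equation below the curve
`y` (`isHeatBelow`). Put `h = f⁺/y` and `v = u - x h`. Then `v` vanishes at `s = 0`, at `x = 0` and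
at `x = y(s)`, and it satisfies `v_s = v_xx - x h'`. Fix the final time `τ` and test `v` against
`exp (k² s) sin (k x)` with `k = nπ/y(τ)`. This mode solves the backward heat equation, so Green's
identity on the curved region `0 < s < τ`, `0 < x < y(s)` (`IsHeatBelow.green`) expresses the `n`-th
sine coefficient of `v(τ, ·)` on `[0, y(τ)]` by the boundary flux `D - h = Ψ` and the source `-x h'`
alone. The mode need not vanish on the curve at earlier times: `v` does, and that leaves only the
flux. The coefficients are `O(|n|⁻³)`. In the flux part, `sin (k y(s))` equals `sin (k (y(s) -
y(τ)))` up to sign, hence is at most `|k| Λ (τ - s)`, and the heat factor integrates this to order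
`|k|⁻³`. In the source part, integration by parts in `x` gives `|k|⁻¹` and the heat factor gives
`k⁻²`. So the sine series converges to `v` on the closed interval (`hasSum_sine_series`) and may be
differentiated termwise up to its right end, where the derivative is `D - h`
(`hasSum_sineCoeff_deriv`). The equation for `y` thus comes without jump relations for heat
potentials. Since the cubic bounds already hold for the time integrals of the absolute values of the
terms, sum and integrals may be exchanged (`kernel_representation`). The summed modes are the sine
series of `B₀` and of `∂B₀/∂x`; Poisson summation (`hasSum_gaussian_images`,
`hasSum_gaussian_deriv_images`) identifies them with the image series and the theta functions. -/

theorem summable_abs_pow_mul_exp_neg_sq {c : ℝ} (hc : 0 < c) (k : ℕ) :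
    Summable fun n : ℤ => |(n : ℝ)| ^ k * Real.exp (-(c * n ^ 2)) := by
  have h := summable_pow_mul_jacobiTheta₂_term_bound 0 (div_pos hc Real.pi_pos) k
  refine h.congr fun n => ?_
  have : -Real.pi * (c / Real.pi * (n : ℝ) ^ 2 - 2 * 0 * |(n : ℝ)|) = -(c * n ^ 2) := by
    field_simp; ring
  simp only [Int.cast_abs, this]

/-- The terms at `n` and `-n` agree, so the factor 2 unfolds the half series into a series over `ℤ`,
the form shared by Poisson summation and the sine series. -/
theorem theta3_hasSum {c : ℝ} (hc : 0 < c) (z : ℝ) :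
    HasSum (fun n : ℤ => Real.exp (-(c * n ^ 2)) * Real.cos (2 * n * z))
      (theta3 z (Real.exp (-c))) := by
  set F : ℤ → ℝ := fun n => Real.exp (-(c * n ^ 2)) * Real.cos (2 * n * z) with hF
  have hsum : Summable F := by
    refine Summable.of_norm_bounded (summable_abs_pow_mul_exp_neg_sq hc 0) fun n => ?_
    simp only [hF, norm_mul, Real.norm_eq_abs, pow_zero, one_mul, Real.abs_exp]
    exact mul_le_of_le_one_right (Real.exp_pos _).le (Real.abs_cos_le_one _)
  have h1 : Summable fun n : ℕ => F (n + 1) :=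
    hsum.comp_injective (i := fun n : ℕ => (n : ℤ) + 1) fun a b h => by simpa using h
  have h2 : (fun n : ℕ => F (-((n : ℤ) + 1))) = fun n : ℕ => F (n + 1) := by
    funext n
    have : 2 * (((-((n : ℤ) + 1) : ℤ)) : ℝ) * z = -(2 * (((n : ℤ) + 1 : ℤ) : ℝ) * z) := by
      push_cast; ring
    simp only [hF, this, Real.cos_neg]
    push_cast
    ring_nf
  have h3 : (fun n : ℕ => F (n + 1)) = fun n : ℕ =>
      Real.exp (-c) ^ ((n + 1) ^ 2) * Real.cos (2 * ((n : ℝ) + 1) * z) := by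
    funext n
    simp only [hF, ← Real.exp_nat_mul]
    push_cast
    ring_nf
  have h4 := HasSum.of_add_one_of_neg_add_one (f := F) h1.hasSum (by rw [h2]; exact h1.hasSum)
  convert! h4 using 1
  rw [theta3, h3]
  simp [hF]
  ring

theorem theta3_hasDerivAt {c : ℝ} (hc : 0 < c) (z : ℝ) :
    HasDerivAt (fun v => theta3 v (Real.exp (-c)))
      (∑' n : ℤ, -(2 * n) * Real.exp (-(c * n ^ 2)) * Real.sin (2 * n * z)) z := by
  have h := hasDerivAt_tsum (𝕜 := ℝ) (F := ℝ)
    (g := fun (n : ℤ) v => Real.exp (-(c * n ^ 2)) * Real.cos (2 * n * v))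
    (g' := fun (n : ℤ) v => -(2 * n) * Real.exp (-(c * n ^ 2)) * Real.sin (2 * n * v))
    (y₀ := 0) ((summable_abs_pow_mul_exp_neg_sq hc 1).mul_left 2) (fun n v => ?_)
    (fun n v => ?_) (theta3_hasSum hc 0).summable z
  · refine h.congr_of_eventuallyEq (Eventually.of_forall fun v => ?_)
    exact (theta3_hasSum hc v).tsum_eq.symm
  · have := (((hasDerivAt_id v).const_mul (2 * (n : ℝ))).cos).const_mul (Real.exp (-(c * n ^ 2)))
    refine this.congr_deriv ?_
    simp
    ring
  · simp only [norm_mul, norm_neg, Real.norm_eq_abs, Real.abs_exp, pow_one, abs_two]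
    calc 2 * |(n : ℝ)| * Real.exp (-(c * n ^ 2)) * |Real.sin (2 * n * v)|
        ≤ 2 * |(n : ℝ)| * Real.exp (-(c * n ^ 2)) * 1 := by
          gcongr; exact Real.abs_sin_le_one _
      _ = _ := by ring

theorem theta3'_hasSum {c : ℝ} (hc : 0 < c) (z : ℝ) :
    HasSum (fun n : ℤ => -(2 * n) * Real.exp (-(c * n ^ 2)) * Real.sin (2 * n * z))
      (theta3' z (Real.exp (-c))) := by
  rw [theta3', (theta3_hasDerivAt hc z).deriv]
  refine Summable.hasSum (Summable.of_norm_bounded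
    ((summable_abs_pow_mul_exp_neg_sq hc 1).mul_left 2) fun n => ?_)
  simp only [norm_mul, norm_neg, Real.norm_eq_abs, Real.abs_exp, pow_one, abs_two]
  calc 2 * |(n : ℝ)| * Real.exp (-(c * n ^ 2)) * |Real.sin (2 * n * z)|
      ≤ 2 * |(n : ℝ)| * Real.exp (-(c * n ^ 2)) * 1 := by
        gcongr; exact Real.abs_sin_le_one _
    _ = _ := by ring

theorem theta3_hasDerivAt' {c : ℝ} (hc : 0 < c) (z : ℝ) :
    HasDerivAt (fun v => theta3 v (Real.exp (-c))) (theta3' z (Real.exp (-c))) z :=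
  (theta3_hasDerivAt hc z).differentiableAt.hasDerivAt

theorem hasSum_re_of_hasSum {F : ℤ → ℂ} {s : ℝ} (h : HasSum F (s : ℂ)) :
    HasSum (fun n => (F n).re) s := by
  simpa using Complex.hasSum_re h

/-- Poisson summation for the Gaussian: the image sum of the heat kernel. -/
theorem hasSum_gaussian_images {L t : ℝ} (hL : 0 < L) (ht : 0 < t) (z : ℝ) :
    HasSum (fun n : ℤ => 1 / (2 * Real.sqrt (Real.pi * t)) *
        Real.exp (-((2 * n * L + z) ^ 2 / (4 * t))))
      (1 / (2 * L) * theta3 (Real.pi * z / (2 * L)) (Real.exp (-(Real.pi ^ 2 * t / L ^ 2)))) := by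
  have hpi := Real.pi_pos
  -- This value turns `exp (-π (n + z/(2L))² x)` into the `n`-th image Gaussian; the functional
  -- equation passes to `1/x`, where the theta series lives.
  set x : ℝ := L ^ 2 / (Real.pi * t) with hx
  have hx0 : 0 < x := by positivity
  have hc : 0 < Real.pi ^ 2 * t / L ^ 2 := by positivity
  have h1 := HurwitzZeta.hasSum_int_evenKernel (z / (2 * L)) hx0
  have h2 := hasSum_re_of_hasSum
    (HurwitzZeta.hasSum_int_cosKernel (z / (2 * L)) (one_div_pos.2 hx0))
  have h3 := theta3_hasSum hc (Real.pi * z / (2 * L))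
  have h4 : HurwitzZeta.cosKernel ((z / (2 * L) : ℝ) : UnitAddCircle) (1 / x)
      = theta3 (Real.pi * z / (2 * L)) (Real.exp (-(Real.pi ^ 2 * t / L ^ 2))) := by
    refine h2.unique ?_
    convert! h3 using 2 with n
    have e1 : (2 * (Real.pi : ℂ) * Complex.I * ((z / (2 * L) : ℝ) : ℂ) * (n : ℂ))
        = ((2 * n * (Real.pi * z / (2 * L)) : ℝ) : ℂ) * Complex.I := by
      push_cast; ring
    rw [e1, Complex.re_mul_ofReal, Complex.exp_ofReal_mul_I_re, mul_comm]
    congr 2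
    rw [hx]
    field_simp
  rw [HurwitzZeta.evenKernel_functional_equation, h4, ← Real.sqrt_eq_rpow] at h1
  have hs : Real.sqrt x = L / Real.sqrt (Real.pi * t) := by
    rw [hx, Real.sqrt_div (sq_nonneg L), Real.sqrt_sq hL.le]
  have h5 := h1.mul_left (1 / (2 * Real.sqrt (Real.pi * t)))
  have hsp : 0 < Real.sqrt (Real.pi * t) := Real.sqrt_pos.2 (by positivity)
  convert! h5 using 1
  · funext n
    congr 2
    rw [hx]
    field_simp
    ring
  · rw [hs]
    field_simp

/-- Poisson summation for the derivative of the Gaussian. -/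
theorem hasSum_gaussian_deriv_images {L t : ℝ} (hL : 0 < L) (ht : 0 < t) (z : ℝ) :
    HasSum (fun n : ℤ => -(2 * n * L + z) / (2 * Real.sqrt (Real.pi * t ^ 3)) *
        Real.exp (-((2 * n * L + z) ^ 2 / (4 * t))))
      (Real.pi / (2 * L ^ 2) *
        theta3' (Real.pi * z / (2 * L)) (Real.exp (-(Real.pi ^ 2 * t / L ^ 2)))) := by
  have hpi := Real.pi_pos
  set x : ℝ := L ^ 2 / (Real.pi * t) with hx
  have hx0 : 0 < x := by positivity
  have hc : 0 < Real.pi ^ 2 * t / L ^ 2 := by positivity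
  have h1 := HurwitzZeta.hasSum_int_oddKernel (z / (2 * L)) hx0
  have h2 := hasSum_re_of_hasSum
    (HurwitzZeta.hasSum_int_sinKernel (z / (2 * L)) (one_div_pos.2 hx0))
  have h3 := theta3'_hasSum hc (Real.pi * z / (2 * L))
  -- The real part of a `sinKernel` term carries the weight `n`, a term of `θ₃'` the weight `-2n`.
  have h4 : HurwitzZeta.sinKernel ((z / (2 * L) : ℝ) : UnitAddCircle) (1 / x)
      = -(1 / 2) * theta3' (Real.pi * z / (2 * L)) (Real.exp (-(Real.pi ^ 2 * t / L ^ 2))) := by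
    refine h2.unique ?_
    convert! h3.mul_left (-(1 / 2)) using 2 with n
    have e1 : (2 * (Real.pi : ℂ) * Complex.I * ((z / (2 * L) : ℝ) : ℂ) * (n : ℂ))
        = ((2 * n * (Real.pi * z / (2 * L)) : ℝ) : ℂ) * Complex.I := by
      push_cast; ring
    have e2 : (-Real.pi * (n : ℝ) ^ 2 * (1 / x)) = -(Real.pi ^ 2 * t / L ^ 2 * n ^ 2) := by
      rw [hx]
      field_simp
    rw [e1, Complex.re_mul_ofReal, e2, Complex.exp_mul_I, ← Complex.ofReal_cos,
      ← Complex.ofReal_sin]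
    generalize Real.cos (2 * n * (Real.pi * z / (2 * L))) = p
    generalize Real.sin (2 * n * (Real.pi * z / (2 * L))) = q
    simp
    ring
  rw [HurwitzZeta.oddKernel_functional_equation, h4] at h1
  have hs : x ^ (3 / 2 : ℝ) = x * Real.sqrt x := by
    rw [Real.sqrt_eq_rpow, ← Real.rpow_one_add' hx0.le (by norm_num)]; norm_num
  have hs2 : Real.sqrt x = L / Real.sqrt (Real.pi * t) := by
    rw [hx, Real.sqrt_div (sq_nonneg L), Real.sqrt_sq hL.le]
  have hs3 : Real.sqrt (Real.pi * t ^ 3) = t * Real.sqrt (Real.pi * t) := by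
    rw [show Real.pi * t ^ 3 = t ^ 2 * (Real.pi * t) by ring, Real.sqrt_mul (sq_nonneg t),
      Real.sqrt_sq ht.le]
  have h5 := h1.mul_left (-(2 * L) / (2 * (t * Real.sqrt (Real.pi * t))))
  have hsp : 0 < Real.sqrt (Real.pi * t) := Real.sqrt_pos.2 (by positivity)
  have hsq : Real.sqrt (Real.pi * t) ^ 2 = Real.pi * t := Real.sq_sqrt (by positivity)
  rw [hs3]
  convert! h5 using 1
  · funext n
    have e : (-Real.pi * ((n : ℝ) + z / (2 * L)) ^ 2 * x)
        = -((2 * n * L + z) ^ 2 / (4 * t)) := by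
      rw [hx]
      field_simp
      ring
    rw [e]
    field_simp
  · rw [hs, hs2, hx]
    field_simp

/-! ### Image series, theta forms and sine series of the kernels -/

namespace OUCall

variable {M : OUCall} {τ s : ℝ}

theorem hasSum_Upsilon (hy : 0 < M.y τ) (hs : s < τ) (x ξ : ℝ) :
    HasSum (fun n : ℤ => M.Upsilon n x τ ξ s) (M.B0Theta x τ ξ s) := by
  have ht : 0 < τ - s := sub_pos.2 hs
  have h := (hasSum_gaussian_images hy ht (x - ξ)).sub (hasSum_gaussian_images hy ht (x + ξ))
  convert! h using 1
  · funext n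
    rw [Upsilon, mul_sub, add_sub_assoc, add_assoc]
  · rw [B0Theta, phiMinus, phiPlus, omega2]
    ring

theorem B0_eq_B0Theta (hy : 0 < M.y τ) (hs : s < τ) (x ξ : ℝ) :
    M.B0 x τ ξ s = M.B0Theta x τ ξ s :=
  (hasSum_Upsilon hy hs x ξ).tsum_eq

theorem hasDerivAt_B0 (hy : 0 < M.y τ) (hs : s < τ) (x ξ : ℝ) :
    HasDerivAt (fun x' => M.B0 x' τ ξ s) (M.B1 x τ ξ s) x := by
  have hc : 0 < Real.pi ^ 2 * (τ - s) / M.y τ ^ 2 := by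
    have := sub_pos.2 hs
    have := Real.pi_pos
    positivity
  have e : (fun x' => M.B0 x' τ ξ s) = fun x' => M.B0Theta x' τ ξ s :=
    funext fun x' => B0_eq_B0Theta hy hs x' ξ
  rw [e]
  have d1 : HasDerivAt (fun x' => M.phiMinus x' ξ τ) (Real.pi / (2 * M.y τ)) x := by
    simpa [phiMinus] using (((hasDerivAt_id x).sub_const ξ).const_mul Real.pi).div_const (2 * M.y τ)
  have d2 : HasDerivAt (fun x' => M.phiPlus x' ξ τ) (Real.pi / (2 * M.y τ)) x := by
    simpa [phiPlus] using (((hasDerivAt_id x).add_const ξ).const_mul Real.pi).div_const (2 * M.y τ)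
  have h1 := (theta3_hasDerivAt' hc (M.phiMinus x ξ τ)).comp x d1
  have h2 := (theta3_hasDerivAt' hc (M.phiPlus x ξ τ)).comp x d2
  refine ((h1.sub h2).const_mul (1 / (2 * M.y τ))).congr_deriv ?_
  rw [B1, omega2]
  field_simp
  ring

/-- Over all of `ℤ` these are the differentiated images at `z = y(τ) - ξ`. The excluded summand `n =
0` is minus the direct Gaussian, which is why the latter appears with a plus sign. -/
theorem hasSum_upsilonTerm (hy : 0 < M.y τ) (hs : s < τ) (ξ : ℝ) :
    HasSum (fun n : {n : ℤ // n ≠ 0} => M.upsilonTerm n τ s ξ)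
      (Real.pi / (2 * M.y τ ^ 2) * theta3' (M.phiMinus (M.y τ) ξ τ) (M.omega2 s τ)
        + M.gaussKernel τ s ξ) := by
  have h := hasSum_gaussian_deriv_images hy (sub_pos.2 hs) (M.y τ - ξ)
  have e : (fun n : ℤ => M.upsilonTerm n τ s ξ) = fun n : ℤ =>
      -(2 * n * M.y τ + (M.y τ - ξ)) / (2 * Real.sqrt (Real.pi * (τ - s) ^ 3)) *
        Real.exp (-((2 * n * M.y τ + (M.y τ - ξ)) ^ 2 / (4 * (τ - s)))) := by
    funext n
    rw [upsilonTerm]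
    congr 2 <;> ring
  rw [← e] at h
  have h0 : M.upsilonTerm 0 τ s ξ = -M.gaussKernel τ s ξ := by
    rw [upsilonTerm, gaussKernel]
    simp only [Int.cast_zero, mul_zero, zero_add, one_mul]
    rw [show -ξ + M.y τ = M.y τ - ξ by ring]
    ring
  have hs0 : HasSum ((fun n : ℤ => M.upsilonTerm n τ s ξ) ∘ ((↑) : ({0} : Set ℤ) → ℤ))
      (-M.gaussKernel τ s ξ) := by
    have := hasSum_unique ((fun n : ℤ => M.upsilonTerm n τ s ξ) ∘ ((↑) : ({0} : Set ℤ) → ℤ))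
    simpa [h0] using this
  have h3 := (hs0.hasSum_iff_compl (a₂ := Real.pi / (2 * M.y τ ^ 2) *
    theta3' (M.phiMinus (M.y τ) ξ τ) (M.omega2 s τ))).1 h
  rw [sub_neg_eq_add] at h3
  exact h3

/-- The Fourier series of the kernel `B₀`. -/
theorem hasSum_B0Theta (hy : 0 < M.y τ) (hs : s < τ) (x ξ : ℝ) :
    HasSum (fun n : ℤ => 1 / M.y τ * (Real.exp (-((n * Real.pi / M.y τ) ^ 2 * (τ - s))) *
        Real.sin (n * Real.pi / M.y τ * x) * Real.sin (n * Real.pi / M.y τ * ξ)))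
      (M.B0Theta x τ ξ s) := by
  have hc : 0 < Real.pi ^ 2 * (τ - s) / M.y τ ^ 2 := by
    have := sub_pos.2 hs
    have := Real.pi_pos
    positivity
  have h := ((theta3_hasSum hc (M.phiMinus x ξ τ)).sub
    (theta3_hasSum hc (M.phiPlus x ξ τ))).mul_left (1 / (2 * M.y τ))
  convert! h using 1
  funext n
  have e1 : 2 * n * M.phiMinus x ξ τ
      = n * Real.pi / M.y τ * x - n * Real.pi / M.y τ * ξ := by
    rw [phiMinus]; field_simp
  have e2 : 2 * n * M.phiPlus x ξ τ
      = n * Real.pi / M.y τ * x + n * Real.pi / M.y τ * ξ := by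
    rw [phiPlus]; field_simp
  have e3 : -(Real.pi ^ 2 * (τ - s) / M.y τ ^ 2 * (n : ℝ) ^ 2)
      = -((n * Real.pi / M.y τ) ^ 2 * (τ - s)) := by
    field_simp
  rw [e1, e2, e3, Real.cos_sub, Real.cos_add]
  field_simp
  ring

/-- The Fourier series of the kernel `∂B₀/∂x`. -/
theorem hasSum_B1 (hy : 0 < M.y τ) (hs : s < τ) (x ξ : ℝ) :
    HasSum (fun n : ℤ => 1 / M.y τ * (Real.exp (-((n * Real.pi / M.y τ) ^ 2 * (τ - s))) *
        (n * Real.pi / M.y τ * Real.cos (n * Real.pi / M.y τ * x)) *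
          Real.sin (n * Real.pi / M.y τ * ξ)))
      (M.B1 x τ ξ s) := by
  have hc : 0 < Real.pi ^ 2 * (τ - s) / M.y τ ^ 2 := by
    have := sub_pos.2 hs
    have := Real.pi_pos
    positivity
  have h := ((theta3'_hasSum hc (M.phiMinus x ξ τ)).sub
    (theta3'_hasSum hc (M.phiPlus x ξ τ))).mul_left (Real.pi / (4 * M.y τ ^ 2))
  convert! h using 1
  funext n
  have e1 : 2 * n * M.phiMinus x ξ τ
      = n * Real.pi / M.y τ * x - n * Real.pi / M.y τ * ξ := by
    rw [phiMinus]; field_simp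
  have e2 : 2 * n * M.phiPlus x ξ τ
      = n * Real.pi / M.y τ * x + n * Real.pi / M.y τ * ξ := by
    rw [phiPlus]; field_simp
  have e3 : -(Real.pi ^ 2 * (τ - s) / M.y τ ^ 2 * (n : ℝ) ^ 2)
      = -((n * Real.pi / M.y τ) ^ 2 * (τ - s)) := by
    field_simp
  rw [e1, e2, e3, Real.sin_sub, Real.sin_add]
  field_simp
  ring

/-- At `x = y(τ)` the two arguments are mirror images modulo the period, so the two values of `θ₃'`
are opposite and their difference is twice the first. -/
theorem theta3'_eq_B1 (hy : 0 < M.y τ) (hs : s < τ) (ξ : ℝ) :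
    Real.pi / (2 * M.y τ ^ 2) * theta3' (M.phiMinus (M.y τ) ξ τ) (M.omega2 s τ)
      = M.B1 (M.y τ) τ ξ s := by
  have hc : 0 < Real.pi ^ 2 * (τ - s) / M.y τ ^ 2 := by
    have := sub_pos.2 hs
    have := Real.pi_pos
    positivity
  refine ((theta3'_hasSum hc (M.phiMinus (M.y τ) ξ τ)).mul_left
    (Real.pi / (2 * M.y τ ^ 2))).unique ?_
  convert! hasSum_B1 hy hs (M.y τ) ξ using 1
  funext n
  have e1 : 2 * n * M.phiMinus (M.y τ) ξ τ
      = n * Real.pi - n * Real.pi / M.y τ * ξ := by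
    rw [phiMinus]; field_simp
  have e3 : -(Real.pi ^ 2 * (τ - s) / M.y τ ^ 2 * (n : ℝ) ^ 2)
      = -((n * Real.pi / M.y τ) ^ 2 * (τ - s)) := by
    field_simp
  rw [e1, e3, Real.sin_sub, Real.sin_int_mul_pi, div_mul_cancel₀ _ hy.ne']
  field_simp
  ring

end OUCall

/-! ### A divergence theorem on rectangles -/

/-- Clamping both coordinates to the rectangle gives the extension. With globally continuous fields,
integrals over varying subrectangles depend continuously on their limits without side conditions. -/
theorem exists_continuous_extension_rect {a b c d : ℝ} (hab : a ≤ b) (hcd : c ≤ d)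
    {F : ℝ → ℝ → ℝ} (hF : ContinuousOn (Function.uncurry F) (Icc a b ×ˢ Icc c d)) :
    ∃ G : ℝ → ℝ → ℝ, Continuous (Function.uncurry G) ∧
      ∀ s ∈ Icc a b, ∀ η ∈ Icc c d, G s η = F s η := by
  refine ⟨fun s η => F (projIcc a b hab s) (projIcc c d hcd η), ?_, fun s hs η hη => ?_⟩
  · refine hF.comp_continuous (f := fun p : ℝ × ℝ =>
      (((projIcc a b hab p.1 : Icc a b) : ℝ), ((projIcc c d hcd p.2 : Icc c d) : ℝ)))
      ?_ fun p => ⟨Subtype.coe_prop _, Subtype.coe_prop _⟩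
    exact (continuous_subtype_val.comp (continuous_projIcc.comp continuous_fst)).prodMk
      (continuous_subtype_val.comp (continuous_projIcc.comp continuous_snd))
  · simp only [projIcc_of_mem hab hs, projIcc_of_mem hcd hη]

theorem continuous_intervalIntegral_of_continuous {X : Type*} [TopologicalSpace X]
    {f : X → ℝ → ℝ} (hf : Continuous (Function.uncurry f)) {p q : X → ℝ}
    (hp : Continuous p) (hq : Continuous q) : Continuous fun x => ∫ t in p x..q x, f x t := by
  have h : (fun x => ∫ t in p x..q x, f x t)
      = fun x => (∫ t in (0 : ℝ)..q x, f x t) - ∫ t in (0 : ℝ)..p x, f x t := by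
    funext x
    have hc : Continuous (f x) := hf.comp (Continuous.prodMk_right x)
    rw [intervalIntegral.integral_interval_sub_left] <;> exact hc.intervalIntegrable _ _
  rw [h]
  exact (intervalIntegral.continuous_parametric_intervalIntegral_of_continuous hf hq).sub
    (intervalIntegral.continuous_parametric_intervalIntegral_of_continuous hf hp)

/-- The fundamental theorem of calculus turns opposite sides into iterated integrals of `Ws` and of
`Ws - Q`; by Fubini the `Ws` parts cancel. -/
theorem rectangle_divergence_of_subset {a b c d : ℝ} {W P Q Ws : ℝ → ℝ → ℝ} {U : Set (ℝ × ℝ)}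
    (hU : uIcc a b ×ˢ uIcc c d ⊆ U)
    (hQ : Continuous (Function.uncurry Q))
    (hWs : ContinuousOn (Function.uncurry Ws) U)
    (dW : ∀ s η, (s, η) ∈ U → HasDerivAt (fun s' => W s' η) (Ws s η) s)
    (dP : ∀ s η, (s, η) ∈ U → HasDerivAt (P s) (Ws s η - Q s η) η) :
    (∫ η in c..d, (W b η - W a η)) - (∫ s in a..b, (P s d - P s c))
      - (∫ s in a..b, ∫ η in c..d, Q s η) = 0 := by
  have hR : ContinuousOn (Function.uncurry Ws) (uIcc a b ×ˢ uIcc c d) := hWs.mono hU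
  have hs : ∀ η ∈ uIcc c d, ContinuousOn (fun s => Ws s η) (uIcc a b) := fun η hη =>
    hR.comp (f := fun s => (s, η)) (by fun_prop) fun s hs => ⟨hs, hη⟩
  have hη : ∀ s ∈ uIcc a b, ContinuousOn (Ws s) (uIcc c d) := fun s hs =>
    hR.comp (f := fun η => (s, η)) (by fun_prop) fun η hη => ⟨hs, hη⟩
  have h1 : ∫ η in c..d, (W b η - W a η) = ∫ η in c..d, ∫ s in a..b, Ws s η := by
    refine intervalIntegral.integral_congr fun η h => ?_
    exact (intervalIntegral.integral_eq_sub_of_hasDerivAt (fun s h' => dW s η (hU ⟨h', h⟩))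
      (hs η h).intervalIntegrable).symm
  have h2 : ∫ s in a..b, (P s d - P s c)
      = ∫ s in a..b, ((∫ η in c..d, Ws s η) - ∫ η in c..d, Q s η) := by
    refine intervalIntegral.integral_congr fun s h => ?_
    have hQs : Continuous (Q s) := hQ.comp (Continuous.prodMk_right s)
    have i1 := (hη s h).intervalIntegrable (μ := volume)
    have i2 := hQs.intervalIntegrable (μ := volume) c d
    rw [← intervalIntegral.integral_sub i1 i2]
    exact (intervalIntegral.integral_eq_sub_of_hasDerivAt (fun η h' => dP s η (hU ⟨h, h'⟩))
      (i1.sub i2)).symm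
  have hprod : IntegrableOn (Function.uncurry Ws) (uIoc a b ×ˢ uIoc c d) :=
    (hR.integrableOn_compact (isCompact_uIcc.prod isCompact_uIcc)).mono_set
      (prod_mono uIoc_subset_uIcc uIoc_subset_uIcc)
  have h3 := intervalIntegral_intervalIntegral_swap (F := Ws) hprod
  have hi : IntervalIntegrable (fun s => ∫ η in c..d, Ws s η) volume a b := by
    rw [intervalIntegrable_iff]
    simp_rw [intervalIntegral.intervalIntegral_eq_integral_uIoc]
    simp_rw [smul_eq_mul]
    refine Integrable.const_mul ?_ _
    rw [IntegrableOn, Measure.volume_eq_prod, ← Measure.prod_restrict] at hprod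
    exact hprod.integral_prod_left
  have hi2 : IntervalIntegrable (fun s => ∫ η in c..d, Q s η) volume a b :=
    (continuous_intervalIntegral_of_continuous hQ continuous_const
      continuous_const).intervalIntegrable _ _
  rw [h1, h2, intervalIntegral.integral_sub hi hi2, h3]
  ring

/-- Derivatives exist only in the open rectangle and `Ws` may blow up at its sides. Each side is
moved inward by `δ`; the resulting identity involves only `W`, `P`, `Q`, so it is continuous in `δ`
and survives `δ → 0`. -/
theorem rectangle_divergence_of_continuous {a b c d : ℝ} (hab : a < b) (hcd : c < d)
    {W P Q Ws : ℝ → ℝ → ℝ}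
    (hW : Continuous (Function.uncurry W)) (hP : Continuous (Function.uncurry P))
    (hQ : Continuous (Function.uncurry Q))
    (hWs : ContinuousOn (Function.uncurry Ws) (Ioo a b ×ˢ Ioo c d))
    (dW : ∀ s ∈ Ioo a b, ∀ η ∈ Ioo c d, HasDerivAt (fun s' => W s' η) (Ws s η) s)
    (dP : ∀ s ∈ Ioo a b, ∀ η ∈ Ioo c d, HasDerivAt (P s) (Ws s η - Q s η) η) :
    (∫ η in c..d, (W b η - W a η)) - (∫ s in a..b, (P s d - P s c))
      - (∫ s in a..b, ∫ η in c..d, Q s η) = 0 := by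
  set Φ : ℝ → ℝ := fun δ =>
    (∫ η in (c + δ)..(d - δ), (W (b - δ) η - W (a + δ) η))
      - (∫ s in (a + δ)..(b - δ), (P s (d - δ) - P s (c + δ)))
      - (∫ s in (a + δ)..(b - δ), ∫ η in (c + δ)..(d - δ), Q s η) with hΦ
  have hcont : Continuous Φ := by
    have e1 : Continuous (Function.uncurry fun δ η => W (b - δ) η - W (a + δ) η) :=
      (hW.comp (f := fun p : ℝ × ℝ => (b - p.1, p.2)) (by fun_prop)).sub
        (hW.comp (f := fun p : ℝ × ℝ => (a + p.1, p.2)) (by fun_prop))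
    have e2 : Continuous (Function.uncurry fun δ s => P s (d - δ) - P s (c + δ)) :=
      (hP.comp (f := fun p : ℝ × ℝ => (p.2, d - p.1)) (by fun_prop)).sub
        (hP.comp (f := fun p : ℝ × ℝ => (p.2, c + p.1)) (by fun_prop))
    have e3 : Continuous (Function.uncurry fun δ s => ∫ η in (c + δ)..(d - δ), Q s η) := by
      refine continuous_intervalIntegral_of_continuous (X := ℝ × ℝ)
        (f := fun p η => Q p.2 η) ?_ (p := fun p => c + p.1) (q := fun p => d - p.1)
        (by fun_prop) (by fun_prop)
      exact hQ.comp (f := fun p : (ℝ × ℝ) × ℝ => (p.1.2, p.2)) (by fun_prop)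
    exact ((continuous_intervalIntegral_of_continuous e1 (by fun_prop) (by fun_prop)).sub
      (continuous_intervalIntegral_of_continuous e2 (by fun_prop) (by fun_prop))).sub
      (continuous_intervalIntegral_of_continuous e3 (by fun_prop) (by fun_prop))
  have hzero : ∀ᶠ δ in 𝓝[>] (0 : ℝ), Φ δ = 0 := by
    have hm : 0 < min ((b - a) / 2) ((d - c) / 2) := lt_min (by linarith) (by linarith)
    filter_upwards [Ioo_mem_nhdsGT hm] with δ hδ
    have h1 := hδ.2.trans_le (min_le_left _ _)
    have h2 := hδ.2.trans_le (min_le_right _ _)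
    have h0 := hδ.1
    refine rectangle_divergence_of_subset (U := Ioo a b ×ˢ Ioo c d) ?_ hQ hWs
      (fun s η h => dW s h.1 η h.2) (fun s η h => dP s h.1 η h.2)
    rw [uIcc_of_le (by linarith), uIcc_of_le (by linarith)]
    exact prod_mono (Icc_subset_Ioo (by linarith) (by linarith))
      (Icc_subset_Ioo (by linarith) (by linarith))
  have hlim : Tendsto Φ (𝓝[>] 0) (𝓝 (Φ 0)) := (hcont.tendsto 0).mono_left nhdsWithin_le_nhds
  have h0 : Φ 0 = 0 :=
    tendsto_nhds_unique (hlim.congr' hzero) tendsto_const_nhds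
  simpa [hΦ] using h0

/-- Divergence theorem on a rectangle for fields that are continuous on the closed rectangle and
whose partial derivatives exist in the interior. -/
theorem rectangle_divergence {a b c d : ℝ} (hab : a < b) (hcd : c < d)
    {W P Q Ws : ℝ → ℝ → ℝ}
    (hW : ContinuousOn (Function.uncurry W) (Icc a b ×ˢ Icc c d))
    (hP : ContinuousOn (Function.uncurry P) (Icc a b ×ˢ Icc c d))
    (hQ : ContinuousOn (Function.uncurry Q) (Icc a b ×ˢ Icc c d))
    (hWs : ContinuousOn (Function.uncurry Ws) (Ioo a b ×ˢ Ioo c d))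
    (dW : ∀ s ∈ Ioo a b, ∀ η ∈ Ioo c d, HasDerivAt (fun s' => W s' η) (Ws s η) s)
    (dP : ∀ s ∈ Ioo a b, ∀ η ∈ Ioo c d, HasDerivAt (P s) (Ws s η - Q s η) η) :
    (∫ η in c..d, (W b η - W a η)) - (∫ s in a..b, (P s d - P s c))
      - (∫ s in a..b, ∫ η in c..d, Q s η) = 0 := by
  obtain ⟨W', hW', eW⟩ := exists_continuous_extension_rect hab.le hcd.le hW
  obtain ⟨P', hP', eP⟩ := exists_continuous_extension_rect hab.le hcd.le hP
  obtain ⟨Q', hQ', eQ⟩ := exists_continuous_extension_rect hab.le hcd.le hQ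
  have key := rectangle_divergence_of_continuous hab hcd hW' hP' hQ' hWs
    (fun s hs η hη => (dW s hs η hη).congr_of_eventuallyEq <| by
      filter_upwards [Ioo_mem_nhds hs.1 hs.2] with s' hs'
      exact eW s' (Ioo_subset_Icc_self hs') η (Ioo_subset_Icc_self hη))
    (fun s hs η hη => by
      rw [eQ s (Ioo_subset_Icc_self hs) η (Ioo_subset_Icc_self hη)]
      refine (dP s hs η hη).congr_of_eventuallyEq ?_
      filter_upwards [Ioo_mem_nhds hη.1 hη.2] with η' hη'
      exact eP s (Ioo_subset_Icc_self hs) η' (Ioo_subset_Icc_self hη'))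
  have ha := left_mem_Icc.2 hab.le
  have hb := right_mem_Icc.2 hab.le
  have hc := left_mem_Icc.2 hcd.le
  have hd := right_mem_Icc.2 hcd.le
  rw [← key]
  congr 1
  · congr 1
    · refine intervalIntegral.integral_congr fun η hη => ?_
      rw [uIcc_of_le hcd.le] at hη
      simp only [eW b hb η hη, eW a ha η hη]
    · refine intervalIntegral.integral_congr fun s hs => ?_
      rw [uIcc_of_le hab.le] at hs
      simp only [eP s hs d hd, eP s hs c hc]
  · refine intervalIntegral.integral_congr fun s hs => ?_
    rw [uIcc_of_le hab.le] at hs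
    refine intervalIntegral.integral_congr fun η hη => ?_
    rw [uIcc_of_le hcd.le] at hη
    exact (eQ s hs η hη).symm

/-! ### The heat equation below a moving boundary -/

/-- `u` solves the heat equation on `0 < x < y(s)`, `0 < s < θ`, vanishes at `s = 0` and `x = 0`,
and has boundary value `h(s) y(s)` and flux `D(s)` at `x = y(s)`. -/
structure IsHeatBelow (θ : ℝ) (y y' h h' D : ℝ → ℝ) (u ux uxx : ℝ → ℝ → ℝ) : Prop where
  y_cont : ContinuousOn y (Icc 0 θ)
  y_pos : ∀ s ∈ Icc 0 θ, 0 < y s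
  y'_cont : ContinuousOn y' (Ioc 0 θ)
  y_deriv : ∀ s ∈ Ioc 0 θ, HasDerivWithinAt y (y' s) (Icc 0 θ) s
  h_cont : ContinuousOn h (Icc 0 θ)
  h'_cont : ContinuousOn h' (Ioc 0 θ)
  h_deriv : ∀ s ∈ Ioc 0 θ, HasDerivWithinAt h (h' s) (Icc 0 θ) s
  -- Near `s = 0`, that is near maturity, `h'` is only integrable, because `S_B'` is.
  h'_int : IntegrableOn h' (Ioc 0 θ)
  D_cont : ContinuousOn D (Icc 0 θ)
  u_cont : ContinuousOn (fun p : ℝ × ℝ => u p.1 p.2)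
    {p : ℝ × ℝ | p.1 ∈ Icc 0 θ ∧ p.2 ∈ Icc 0 (y p.1)}
  ux_cont : ContinuousOn (fun p : ℝ × ℝ => ux p.1 p.2)
    {p : ℝ × ℝ | p.1 ∈ Ioc 0 θ ∧ p.2 ∈ Icc 0 (y p.1)}
  uxx_cont : ContinuousOn (fun p : ℝ × ℝ => uxx p.1 p.2)
    {p : ℝ × ℝ | p.1 ∈ Ioo 0 θ ∧ p.2 ∈ Ioo 0 (y p.1)}
  ux_deriv : ∀ s ∈ Ioc 0 θ, ∀ x ∈ Icc 0 (y s),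
    HasDerivWithinAt (u s) (ux s x) (Icc 0 (y s)) x
  uxx_deriv : ∀ s ∈ Ioo 0 θ, ∀ x ∈ Ioo 0 (y s), HasDerivAt (ux s) (uxx s x) x
  -- Constant curves give the heat equation; the curves `X = y · η` are those needed after rescaling
  -- to a rectangle.
  curve : ∀ s ∈ Ioo 0 θ, ∀ (X : ℝ → ℝ) (X' : ℝ), HasDerivAt X X' s → X s ∈ Ioo 0 (y s) →
    HasDerivAt (fun s' => u s' (X s')) (uxx s (X s) + ux s (X s) * X') s
  initial : ∀ x ∈ Icc 0 (y 0), u 0 x = 0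
  left : ∀ s ∈ Icc 0 θ, u s 0 = 0
  right : ∀ s ∈ Icc 0 θ, u s (y s) = h s * y s
  flux : ∀ s ∈ Ioc 0 θ, ux s (y s) = D s

namespace IsHeatBelow

variable {θ : ℝ} {y y' h h' D : ℝ → ℝ} {u ux uxx : ℝ → ℝ → ℝ}

theorem scale_mem (H : IsHeatBelow θ y y' h h' D u ux uxx) {s η : ℝ} (hs : s ∈ Icc 0 θ)
    (hη : η ∈ Icc (0 : ℝ) 1) : y s * η ∈ Icc 0 (y s) :=
  ⟨mul_nonneg (H.y_pos s hs).le hη.1, mul_le_of_le_one_right (H.y_pos s hs).le hη.2⟩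

theorem scale_mem_Ioo (H : IsHeatBelow θ y y' h h' D u ux uxx) {s η : ℝ} (hs : s ∈ Icc 0 θ)
    (hη : η ∈ Ioo (0 : ℝ) 1) : y s * η ∈ Ioo 0 (y s) :=
  ⟨mul_pos (H.y_pos s hs) hη.1, mul_lt_of_lt_one_right (H.y_pos s hs) hη.2⟩

theorem hasDerivAt_y (H : IsHeatBelow θ y y' h h' D u ux uxx) {s : ℝ} (hs : s ∈ Ioo 0 θ) :
    HasDerivAt y (y' s) s :=
  (H.y_deriv s ⟨hs.1, hs.2.le⟩).hasDerivAt (Icc_mem_nhds hs.1 hs.2)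

theorem hasDerivAt_h (H : IsHeatBelow θ y y' h h' D u ux uxx) {s : ℝ} (hs : s ∈ Ioo 0 θ) :
    HasDerivAt h (h' s) s :=
  (H.h_deriv s ⟨hs.1, hs.2.le⟩).hasDerivAt (Icc_mem_nhds hs.1 hs.2)

/-- The rescaled integrand `y v E` with `v = u - x h`, `E = exp (k² s) sin (k x)`, `x = y(s) η`. -/
def modeW (y h : ℝ → ℝ) (u : ℝ → ℝ → ℝ) (k s η : ℝ) : ℝ :=
  y s * ((u s (y s * η) - y s * η * h s) * (Real.exp (k ^ 2 * s) * Real.sin (k * (y s * η))))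

/-- The spatial flux that goes with `modeW`. -/
def modeP (y y' h : ℝ → ℝ) (u ux : ℝ → ℝ → ℝ) (k s η : ℝ) : ℝ :=
  y' s * η * ((u s (y s * η) - y s * η * h s) *
      (Real.exp (k ^ 2 * s) * Real.sin (k * (y s * η))))
    + (ux s (y s * η) - h s) * (Real.exp (k ^ 2 * s) * Real.sin (k * (y s * η)))
    - (u s (y s * η) - y s * η * h s) * (k * (Real.exp (k ^ 2 * s) * Real.cos (k * (y s * η))))

/-- The source that goes with `modeW`. -/
def modeQ (y h' : ℝ → ℝ) (k s η : ℝ) : ℝ :=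
  -(η * h' s * y s ^ 2 * (Real.exp (k ^ 2 * s) * Real.sin (k * (y s * η))))

theorem continuousOn_fst_comp {f : ℝ → ℝ} {A B : Set ℝ} (hf : ContinuousOn f A) :
    ContinuousOn (fun p : ℝ × ℝ => f p.1) (A ×ˢ B) :=
  hf.comp continuousOn_fst fun _ hp => hp.1

theorem continuousOn_u_scale (H : IsHeatBelow θ y y' h h' D u ux uxx) :
    ContinuousOn (fun p : ℝ × ℝ => u p.1 (y p.1 * p.2)) (Icc 0 θ ×ˢ Icc 0 1) :=
  H.u_cont.comp (f := fun p : ℝ × ℝ => (p.1, y p.1 * p.2))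
    (continuousOn_fst.prodMk ((continuousOn_fst_comp H.y_cont).mul continuousOn_snd))
    fun _ hp => ⟨hp.1, H.scale_mem hp.1 hp.2⟩

theorem continuousOn_ux_scale (H : IsHeatBelow θ y y' h h' D u ux uxx) :
    ContinuousOn (fun p : ℝ × ℝ => ux p.1 (y p.1 * p.2)) (Ioc 0 θ ×ˢ Icc 0 1) :=
  H.ux_cont.comp (f := fun p : ℝ × ℝ => (p.1, y p.1 * p.2))
    (continuousOn_fst.prodMk ((continuousOn_fst_comp (H.y_cont.mono Ioc_subset_Icc_self)).mul
      continuousOn_snd))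
    fun _ hp => ⟨hp.1, H.scale_mem (Ioc_subset_Icc_self hp.1) hp.2⟩

theorem continuousOn_uxx_scale (H : IsHeatBelow θ y y' h h' D u ux uxx) :
    ContinuousOn (fun p : ℝ × ℝ => uxx p.1 (y p.1 * p.2)) (Ioo 0 θ ×ˢ Ioo 0 1) :=
  H.uxx_cont.comp (f := fun p : ℝ × ℝ => (p.1, y p.1 * p.2))
    (continuousOn_fst.prodMk ((continuousOn_fst_comp (H.y_cont.mono Ioo_subset_Icc_self)).mul
      continuousOn_snd))
    fun _ hp => ⟨hp.1, H.scale_mem_Ioo (Ioo_subset_Icc_self hp.1) hp.2⟩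

theorem continuousOn_modeW (H : IsHeatBelow θ y y' h h' D u ux uxx) (k : ℝ) :
    ContinuousOn (Function.uncurry (modeW y h u k)) (Icc 0 θ ×ˢ Icc 0 1) := by
  have hu := H.continuousOn_u_scale
  have hy := continuousOn_fst_comp (B := Icc (0 : ℝ) 1) H.y_cont
  have hh := continuousOn_fst_comp (B := Icc (0 : ℝ) 1) H.h_cont
  suffices ∀ (S : Set (ℝ × ℝ)) (Y A U : ℝ × ℝ → ℝ), ContinuousOn Y S → ContinuousOn A S →
      ContinuousOn U S → ContinuousOn (fun p => Y p * ((U p - Y p * p.2 * A p) *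
        (Real.exp (k ^ 2 * p.1) * Real.sin (k * (Y p * p.2))))) S from this _ _ _ _ hy hh hu
  intros
  fun_prop

theorem continuousOn_modeP (H : IsHeatBelow θ y y' h h' D u ux uxx) (k : ℝ) :
    ContinuousOn (Function.uncurry (modeP y y' h u ux k)) (Ioc 0 θ ×ˢ Icc 0 1) := by
  have hsub : Ioc 0 θ ×ˢ Icc (0 : ℝ) 1 ⊆ Icc 0 θ ×ˢ Icc 0 1 :=
    prod_mono Ioc_subset_Icc_self le_rfl
  have hu := H.continuousOn_u_scale.mono hsub
  have hux := H.continuousOn_ux_scale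
  have hy := (continuousOn_fst_comp (B := Icc (0 : ℝ) 1) H.y_cont).mono hsub
  have hh := (continuousOn_fst_comp (B := Icc (0 : ℝ) 1) H.h_cont).mono hsub
  have hy' := continuousOn_fst_comp (B := Icc (0 : ℝ) 1) H.y'_cont
  suffices ∀ (S : Set (ℝ × ℝ)) (Y Y' A U V : ℝ × ℝ → ℝ), ContinuousOn Y S → ContinuousOn Y' S →
      ContinuousOn A S → ContinuousOn U S → ContinuousOn V S → ContinuousOn (fun p =>
        Y' p * p.2 * ((U p - Y p * p.2 * A p) *
          (Real.exp (k ^ 2 * p.1) * Real.sin (k * (Y p * p.2))))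
        + (V p - A p) * (Real.exp (k ^ 2 * p.1) * Real.sin (k * (Y p * p.2)))
        - (U p - Y p * p.2 * A p) *
          (k * (Real.exp (k ^ 2 * p.1) * Real.cos (k * (Y p * p.2))))) S from
    this _ _ _ _ _ _ hy hy' hh hu hux
  intros
  fun_prop

theorem continuousOn_modeQ (H : IsHeatBelow θ y y' h h' D u ux uxx) (k : ℝ) :
    ContinuousOn (Function.uncurry (modeQ y h' k)) (Ioc 0 θ ×ˢ Icc 0 1) := by
  have hy := (continuousOn_fst_comp (B := Icc (0 : ℝ) 1)
    (H.y_cont.mono Ioc_subset_Icc_self))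
  have hh' := continuousOn_fst_comp (B := Icc (0 : ℝ) 1) H.h'_cont
  suffices ∀ (S : Set (ℝ × ℝ)) (Y A : ℝ × ℝ → ℝ), ContinuousOn Y S → ContinuousOn A S →
      ContinuousOn (fun p => -(p.2 * A p * Y p ^ 2 *
        (Real.exp (k ^ 2 * p.1) * Real.sin (k * (Y p * p.2))))) S from this _ _ _ hy hh'
  intros
  fun_prop

/-- The time derivative of `modeW`. -/
def modeWs (y y' h h' : ℝ → ℝ) (u ux uxx : ℝ → ℝ → ℝ) (k s η : ℝ) : ℝ :=
  y' s * ((u s (y s * η) - y s * η * h s) * (Real.exp (k ^ 2 * s) * Real.sin (k * (y s * η))))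
    + y s * ((uxx s (y s * η) + ux s (y s * η) * (y' s * η)
          - (y' s * η * h s + y s * η * h' s)) *
            (Real.exp (k ^ 2 * s) * Real.sin (k * (y s * η)))
      + (u s (y s * η) - y s * η * h s) *
        (k ^ 2 * Real.exp (k ^ 2 * s) * Real.sin (k * (y s * η))
          + Real.exp (k ^ 2 * s) * (Real.cos (k * (y s * η)) * (k * (y' s * η)))))

theorem continuousOn_modeWs (H : IsHeatBelow θ y y' h h' D u ux uxx) (k : ℝ) :
    ContinuousOn (Function.uncurry (modeWs y y' h h' u ux uxx k)) (Ioo 0 θ ×ˢ Ioo 0 1) := by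
  have hsub : Ioo 0 θ ×ˢ Ioo (0 : ℝ) 1 ⊆ Icc 0 θ ×ˢ Icc 0 1 :=
    prod_mono Ioo_subset_Icc_self Ioo_subset_Icc_self
  have hsub' : Ioo 0 θ ×ˢ Ioo (0 : ℝ) 1 ⊆ Ioc 0 θ ×ˢ Icc 0 1 :=
    prod_mono Ioo_subset_Ioc_self Ioo_subset_Icc_self
  have hu := H.continuousOn_u_scale.mono hsub
  have hux := H.continuousOn_ux_scale.mono hsub'
  have huxx := H.continuousOn_uxx_scale
  have hy := (continuousOn_fst_comp (B := Icc (0 : ℝ) 1) H.y_cont).mono hsub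
  have hh := (continuousOn_fst_comp (B := Icc (0 : ℝ) 1) H.h_cont).mono hsub
  have hy' := (continuousOn_fst_comp (B := Icc (0 : ℝ) 1) H.y'_cont).mono hsub'
  have hh' := (continuousOn_fst_comp (B := Icc (0 : ℝ) 1) H.h'_cont).mono hsub'
  suffices ∀ (S : Set (ℝ × ℝ)) (Y Y' A A' U V Z : ℝ × ℝ → ℝ), ContinuousOn Y S →
      ContinuousOn Y' S → ContinuousOn A S → ContinuousOn A' S → ContinuousOn U S →
      ContinuousOn V S → ContinuousOn Z S → ContinuousOn (fun p =>
        Y' p * ((U p - Y p * p.2 * A p) * (Real.exp (k ^ 2 * p.1) * Real.sin (k * (Y p * p.2))))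
        + Y p * ((Z p + V p * (Y' p * p.2) - (Y' p * p.2 * A p + Y p * p.2 * A' p)) *
            (Real.exp (k ^ 2 * p.1) * Real.sin (k * (Y p * p.2)))
          + (U p - Y p * p.2 * A p) *
            (k ^ 2 * Real.exp (k ^ 2 * p.1) * Real.sin (k * (Y p * p.2))
              + Real.exp (k ^ 2 * p.1) *
                (Real.cos (k * (Y p * p.2)) * (k * (Y' p * p.2)))))) S from
    this _ _ _ _ _ _ _ _ hy hy' hh hh' hu hux huxx
  intros
  fun_prop

theorem hasDerivAt_modeW (H : IsHeatBelow θ y y' h h' D u ux uxx) (k : ℝ) {s η : ℝ}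
    (hs : s ∈ Ioo 0 θ) (hη : η ∈ Ioo (0 : ℝ) 1) :
    HasDerivAt (fun s' => modeW y h u k s' η) (modeWs y y' h h' u ux uxx k s η) s := by
  have hy := H.hasDerivAt_y hs
  have hh := H.hasDerivAt_h hs
  have hyη := hy.mul_const η
  have hu := H.curve s hs _ _ hyη (H.scale_mem_Ioo (Ioo_subset_Icc_self hs) hη)
  have he : HasDerivAt (fun s' => Real.exp (k ^ 2 * s')) (k ^ 2 * Real.exp (k ^ 2 * s)) s := by
    have := ((hasDerivAt_id s).const_mul (k ^ 2)).exp
    exact this.congr_deriv (by simp; ring)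
  have hsin := (hyη.const_mul k).sin
  exact hy.mul ((hu.sub (hyη.mul hh)).mul (he.mul hsin))

/-- Since `E_s = k² E = -E_xx`, one has `(v E)_s = (v_x E - v E_x)_x - x h' E`. Straightening `x =
y(s) η` multiplies by the Jacobian `y` and adds the convective flux `y' η v E`. -/
theorem hasDerivAt_modeP (H : IsHeatBelow θ y y' h h' D u ux uxx) (k : ℝ) {s η : ℝ}
    (hs : s ∈ Ioo 0 θ) (hη : η ∈ Ioo (0 : ℝ) 1) :
    HasDerivAt (modeP y y' h u ux k s)
      (modeWs y y' h h' u ux uxx k s η - modeQ y h' k s η) η := by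
  have hmem := H.scale_mem_Ioo (Ioo_subset_Icc_self hs) hη
  have hid : HasDerivAt (fun η' => y s * η') (y s) η := by
    simpa using (hasDerivAt_id η).const_mul (y s)
  have hu : HasDerivAt (fun η' => u s (y s * η')) (ux s (y s * η) * y s) η :=
    ((H.ux_deriv s (Ioo_subset_Ioc_self hs) _ (Ioo_subset_Icc_self hmem)).hasDerivAt
      (Icc_mem_nhds hmem.1 hmem.2)).comp η hid
  have hux : HasDerivAt (fun η' => ux s (y s * η')) (uxx s (y s * η) * y s) η :=
    (H.uxx_deriv s hs _ hmem).comp η hid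
  have hv := hu.sub (hid.mul_const (h s))
  have hsin := ((hid.const_mul k).sin).const_mul (Real.exp (k ^ 2 * s))
  have hcos := (((hid.const_mul k).cos).const_mul (Real.exp (k ^ 2 * s))).const_mul k
  have h1 := ((hasDerivAt_id η).const_mul (y' s)).mul (hv.mul hsin)
  have h2 := (hux.sub_const (h s)).mul hsin
  have h3 := hv.mul hcos
  refine ((h1.add h2).sub h3).congr_deriv ?_
  simp only [modeWs, modeQ, id_eq, Pi.mul_apply, Pi.sub_apply]
  ring

/-- On the curve `v = 0`, so the convective flux and `v E_x` drop out and only `v_x E` survives. -/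
theorem modeP_one (H : IsHeatBelow θ y y' h h' D u ux uxx) (k : ℝ) {s : ℝ}
    (hs : s ∈ Ioc 0 θ) : modeP y y' h u ux k s 1
      = (D s - h s) * (Real.exp (k ^ 2 * s) * Real.sin (k * y s)) := by
  simp only [modeP, mul_one, H.right s (Ioc_subset_Icc_self hs), H.flux s hs]
  ring

theorem modeP_zero (H : IsHeatBelow θ y y' h h' D u ux uxx) (k : ℝ) {s : ℝ}
    (hs : s ∈ Ioc 0 θ) : modeP y y' h u ux k s 0 = 0 := by
  simp [modeP, H.left s (Ioc_subset_Icc_self hs)]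

theorem integral_modeQ (k s : ℝ) : ∫ η in (0 : ℝ)..1, modeQ y h' k s η
    = -(h' s * (Real.exp (k ^ 2 * s) * ∫ x in (0 : ℝ)..y s, x * Real.sin (k * x))) := by
  have h1 := intervalIntegral.smul_integral_comp_mul_left (a := 0) (b := 1)
    (fun x => x * Real.sin (k * x)) (y s)
  rw [mul_zero, mul_one, smul_eq_mul] at h1
  rw [← h1, ← intervalIntegral.integral_const_mul, ← intervalIntegral.integral_const_mul,
    ← intervalIntegral.integral_const_mul, ← intervalIntegral.integral_neg]
  refine intervalIntegral.integral_congr fun η _ => ?_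
  simp only [modeQ]
  ring

theorem continuousOn_moment (H : IsHeatBelow θ y y' h h' D u ux uxx) (k : ℝ) :
    ContinuousOn (fun s => ∫ x in (0 : ℝ)..y s, x * Real.sin (k * x)) (Icc 0 θ) := by
  have hc : Continuous fun b : ℝ => ∫ x in (0 : ℝ)..b, x * Real.sin (k * x) :=
    intervalIntegral.continuous_primitive
      (fun a b => (by fun_prop : Continuous fun x => x * Real.sin (k * x)).intervalIntegrable a b) 0
  exact hc.comp_continuousOn H.y_cont

theorem intervalIntegrable_flux (H : IsHeatBelow θ y y' h h' D u ux uxx) (hθ : 0 < θ) (k : ℝ) :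
    IntervalIntegrable (fun s => (D s - h s) * (Real.exp (k ^ 2 * s) * Real.sin (k * y s)))
      volume 0 θ := by
  refine ContinuousOn.intervalIntegrable ?_
  rw [uIcc_of_le hθ.le]
  have := H.D_cont
  have := H.h_cont
  have := H.y_cont
  fun_prop

theorem intervalIntegrable_source (H : IsHeatBelow θ y y' h h' D u ux uxx) (hθ : 0 < θ) (k : ℝ) :
    IntervalIntegrable (fun s => h' s *
      (Real.exp (k ^ 2 * s) * ∫ x in (0 : ℝ)..y s, x * Real.sin (k * x))) volume 0 θ := by
  refine IntervalIntegrable.mul_continuousOn ?_ ?_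
  · exact (intervalIntegrable_iff_integrableOn_Ioc_of_le hθ.le).2 H.h'_int
  · rw [uIcc_of_le hθ.le]
    have := H.continuousOn_moment k
    fun_prop

/-- Green's identity against the mode `exp (k² s) sin (k x)`. -/
theorem green (H : IsHeatBelow θ y y' h h' D u ux uxx) {τ : ℝ} (hτ : τ ∈ Ioc 0 θ) (k : ℝ) :
    ∫ x in (0 : ℝ)..y τ, (u τ x - x * h τ) * (Real.exp (k ^ 2 * τ) * Real.sin (k * x))
      = (∫ s in (0 : ℝ)..τ, (D s - h s) * (Real.exp (k ^ 2 * s) * Real.sin (k * y s)))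
        - ∫ s in (0 : ℝ)..τ, h' s *
            (Real.exp (k ^ 2 * s) * ∫ x in (0 : ℝ)..y s, x * Real.sin (k * x)) := by
  have hθ : 0 < θ := hτ.1.trans_le hτ.2
  have hsubτ : uIcc 0 τ ⊆ uIcc 0 θ := by
    rw [uIcc_of_le hτ.1.le, uIcc_of_le hθ.le]; exact Icc_subset_Icc_right hτ.2
  have i1 := (H.intervalIntegrable_flux hθ k).mono_set hsubτ
  have i2 := (H.intervalIntegrable_source hθ k).mono_set hsubτ
  have hW := (H.continuousOn_modeW k).mono
    (prod_mono (Icc_subset_Icc_right hτ.2) (le_refl (Icc (0 : ℝ) 1)))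
  obtain ⟨G, hG, eG⟩ := exists_continuous_extension_rect hτ.1.le zero_le_one hW
  set J : ℝ → ℝ := fun s => ∫ η in (0 : ℝ)..1, G s η with hJ
  have hJc : Continuous J :=
    continuous_intervalIntegral_of_continuous hG continuous_const continuous_const
  have eJ : ∀ s ∈ Icc 0 τ, J s = ∫ η in (0 : ℝ)..1, modeW y h u k s η := fun s hs =>
    intervalIntegral.integral_congr fun η hη => eG s hs η (by rwa [uIcc_of_le zero_le_one] at hη)
  set F : ℝ → ℝ := fun s => (D s - h s) * (Real.exp (k ^ 2 * s) * Real.sin (k * y s))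
    - h' s * (Real.exp (k ^ 2 * s) * ∫ x in (0 : ℝ)..y s, x * Real.sin (k * x)) with hF
  have iF : IntervalIntegrable F volume 0 τ := i1.sub i2
  -- Continuity of `y'` and `h'` stops short of `s = 0`. The divergence theorem is used from `s₁ >
  -- 0` on, and `s₁ → 0` needs only continuity of `J` and integrability of `F`.
  have step : ∀ s₁ ∈ Ioo 0 τ, J τ - J s₁ = ∫ s in s₁..τ, F s := by
    intro s₁ hs₁
    have hsub : Icc s₁ τ ⊆ Ioc 0 θ := fun s hs => ⟨hs₁.1.trans_le hs.1, hs.2.trans hτ.2⟩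
    have hsub' : Ioo s₁ τ ⊆ Ioo 0 θ := Ioo_subset_Ioo hs₁.1.le hτ.2
    have hP := (H.continuousOn_modeP k).mono (prod_mono hsub (le_refl (Icc (0 : ℝ) 1)))
    have hQ := (H.continuousOn_modeQ k).mono (prod_mono hsub (le_refl (Icc (0 : ℝ) 1)))
    have key := rectangle_divergence hs₁.2 zero_lt_one
      (hW.mono (prod_mono (Icc_subset_Icc_left hs₁.1.le) le_rfl)) hP hQ
      ((H.continuousOn_modeWs k).mono (prod_mono hsub' le_rfl))
      (fun s hs η hη => H.hasDerivAt_modeW k (hsub' hs) hη)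
      (fun s hs η hη => H.hasDerivAt_modeP k (hsub' hs) hη)
    have hτm : τ ∈ Icc 0 τ := ⟨hτ.1.le, le_rfl⟩
    have hs₁m : s₁ ∈ Icc 0 τ := Ioo_subset_Icc_self hs₁
    have iG : ∀ s, IntervalIntegrable (G s) volume 0 1 := fun s =>
      (hG.comp (Continuous.prodMk_right s)).intervalIntegrable _ _
    have e1 : ∫ η in (0 : ℝ)..1, (modeW y h u k τ η - modeW y h u k s₁ η) = J τ - J s₁ := by
      rw [hJ, ← intervalIntegral.integral_sub (iG τ) (iG s₁)]
      refine intervalIntegral.integral_congr fun η hη => ?_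
      rw [uIcc_of_le zero_le_one] at hη
      simp only [eG τ hτm η hη, eG s₁ hs₁m η hη]
    have hsubi : uIcc s₁ τ ⊆ uIcc 0 τ := by
      rw [uIcc_of_le hs₁.2.le, uIcc_of_le hτ.1.le]; exact Icc_subset_Icc_left hs₁.1.le
    have e2 : ∫ s in s₁..τ, (modeP y y' h u ux k s 1 - modeP y y' h u ux k s 0)
        = ∫ s in s₁..τ, (D s - h s) * (Real.exp (k ^ 2 * s) * Real.sin (k * y s)) := by
      refine intervalIntegral.integral_congr fun s hs => ?_
      rw [uIcc_of_le hs₁.2.le] at hs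
      simp only [H.modeP_one k (hsub hs), H.modeP_zero k (hsub hs), sub_zero]
    rw [e1, e2] at key
    simp_rw [integral_modeQ] at key
    rw [intervalIntegral.integral_neg] at key
    rw [hF, intervalIntegral.integral_sub (i1.mono_set hsubi) (i2.mono_set hsubi)]
    linarith
  have hJ0 : J 0 = 0 := by
    rw [eJ 0 ⟨le_rfl, hτ.1.le⟩]
    have h0 : (0 : ℝ) ∈ Icc 0 θ := ⟨le_rfl, hθ.le⟩
    have hh0 : h 0 = 0 := by
      have h1 := H.right 0 h0
      rw [H.initial _ ⟨(H.y_pos 0 h0).le, le_rfl⟩] at h1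
      exact (mul_eq_zero.1 h1.symm).resolve_right (H.y_pos 0 h0).ne'
    refine (intervalIntegral.integral_congr (g := fun _ => (0 : ℝ)) fun η hη => ?_).trans (by simp)
    rw [uIcc_of_le zero_le_one] at hη
    simp [modeW, H.initial _ (H.scale_mem h0 hη), hh0]
  have lim1 : Tendsto (fun s₁ => J τ - J s₁) (𝓝[>] 0) (𝓝 (J τ - J 0)) :=
    tendsto_const_nhds.sub ((hJc.tendsto 0).mono_left nhdsWithin_le_nhds)
  have lim2 : Tendsto (fun s₁ => ∫ s in s₁..τ, F s) (𝓝[>] 0) (𝓝 (∫ s in (0 : ℝ)..τ, F s)) := by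
    have hc := intervalIntegral.continuousOn_primitive_interval_left (μ := volume) (a := 0) (b := τ)
      (f := F)
      (by rw [uIcc_of_le hτ.1.le, integrableOn_Icc_iff_integrableOn_Ioc]
          exact (intervalIntegrable_iff_integrableOn_Ioc_of_le hτ.1.le).1 iF)
    rw [uIcc_of_le hτ.1.le] at hc
    have := (hc 0 ⟨le_rfl, hτ.1.le⟩).tendsto
    refine this.mono_left (nhdsWithin_le_of_mem ?_)
    exact mem_of_superset (Ioo_mem_nhdsGT hτ.1) Ioo_subset_Icc_self
  have hlim := tendsto_nhds_unique (lim1.congr' (by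
    filter_upwards [Ioo_mem_nhdsGT hτ.1] with s₁ hs₁ using step s₁ hs₁)) lim2
  rw [hJ0, sub_zero, eJ τ ⟨hτ.1.le, le_rfl⟩, hF, intervalIntegral.integral_sub i1 i2] at hlim
  rw [← hlim]
  have h1 := intervalIntegral.smul_integral_comp_mul_left (a := 0) (b := 1)
    (fun x => (u τ x - x * h τ) * (Real.exp (k ^ 2 * τ) * Real.sin (k * x))) (y τ)
  rw [mul_zero, mul_one, smul_eq_mul] at h1
  rw [← h1, ← intervalIntegral.integral_const_mul]
  rfl

end IsHeatBelow

/-! ### Sine series and exchange of sums and integrals -/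

/-- The odd `2L`-periodic extension of `v` is continuous because `v` vanishes at both ends. Its
Fourier coefficients are `-i/L` times the sine integrals, and summable coefficients give pointwise
convergence. Summing over `ℤ` counts each mode twice, hence `1/L` instead of `2/L`. -/
theorem hasSum_sine_series {L : ℝ} (hL : 0 < L) {v : ℝ → ℝ} (hv : ContinuousOn v (Icc 0 L))
    (v0 : v 0 = 0) (vL : v L = 0)
    (hb : Summable fun n : ℤ => ∫ x in (0 : ℝ)..L, v x * Real.sin (n * Real.pi / L * x))
    {x : ℝ} (hx : x ∈ Icc 0 L) :
    HasSum (fun n : ℤ => 1 / L * ((∫ x in (0 : ℝ)..L, v x * Real.sin (n * Real.pi / L * x)) *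
      Real.sin (n * Real.pi / L * x))) (v x) := by
  -- The right end lies outside the fundamental domain `[-L, L)`; there every term and `v` vanish.
  rcases eq_or_lt_of_le hx.2 with rfl | hxL
  · have : ∀ n : ℤ, Real.sin (n * Real.pi / x * x) = 0 := fun n => by
      rw [div_mul_cancel₀ _ hL.ne', Real.sin_int_mul_pi]
    simp only [this, mul_zero, vL]
    exact hasSum_zero
  have : Fact (0 < 2 * L) := ⟨by linarith⟩
  set F : ℝ → ℂ := fun x => ((v (max x 0) - v (max (-x) 0) : ℝ) : ℂ) with hF
  have hFc : ContinuousOn F (Icc (-L) (-L + 2 * L)) := by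
    have e : -L + 2 * L = L := by ring
    rw [e]
    refine Complex.continuous_ofReal.comp_continuousOn (ContinuousOn.sub ?_ ?_)
    · exact hv.comp (f := fun x => max x 0) (by fun_prop) fun x hx =>
        ⟨le_max_right _ _, max_le hx.2 hL.le⟩
    · exact hv.comp (f := fun x => max (-x) 0) (by fun_prop) fun x hx =>
        ⟨le_max_right _ _, max_le (by linarith [hx.1]) hL.le⟩
  have hFe : F (-L) = F (-L + 2 * L) := by
    have e : -L + 2 * L = L := by ring
    simp [hF, e, hL.le, v0, vL]
  set f : C(AddCircle (2 * L), ℂ) := ⟨AddCircle.liftIco (2 * L) (-L) F,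
    AddCircle.liftIco_continuous hFe hFc⟩ with hf
  set b : ℤ → ℝ := fun n => ∫ x in (0 : ℝ)..L, v x * Real.sin (n * Real.pi / L * x) with hbdef
  have hcoef : ∀ n : ℤ, fourierCoeff f n = -Complex.I * ((1 / L * b n : ℝ) : ℂ) := by
    intro n
    change fourierCoeff (AddCircle.liftIco (2 * L) (-L) F) n = _
    rw [fourierCoeff_liftIco_eq, fourierCoeffOn_eq_integral]
    have e : -L + 2 * L = L := by ring
    have hfour : ∀ x : ℝ, (fourier (-n) (x : AddCircle (-L + 2 * L - -L)) : ℂ)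
        = ((Real.cos (n * Real.pi / L * x) : ℝ) : ℂ)
          - ((Real.sin (n * Real.pi / L * x) : ℝ) : ℂ) * Complex.I := by
      intro x
      rw [fourier_coe_apply]
      have hLc : (L : ℂ) ≠ 0 := by exact_mod_cast hL.ne'
      have : 2 * (Real.pi : ℂ) * Complex.I * ((-n : ℤ) : ℂ) * (x : ℂ) /
          ((-L + 2 * L - -L : ℝ) : ℂ) = ((-(n * Real.pi / L * x) : ℝ) : ℂ) * Complex.I := by
        push_cast
        have : (-L + 2 * L - -L : ℂ) = 2 * L := by ring
        rw [this]
        field_simp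
      rw [this, Complex.exp_mul_I, ← Complex.ofReal_cos, ← Complex.ofReal_sin, Real.cos_neg,
        Real.sin_neg]
      push_cast
      ring
    simp_rw [hfour]
    rw [e]
    set Φ : ℝ → ℂ := fun x => (((Real.cos (n * Real.pi / L * x) : ℝ) : ℂ)
          - ((Real.sin (n * Real.pi / L * x) : ℝ) : ℂ) * Complex.I) • F x with hΦ
    have hΦc : ContinuousOn Φ (Icc (-L) L) := by
      rw [e] at hFc
      have hg : Continuous fun x : ℝ => ((Real.cos (n * Real.pi / L * x) : ℝ) : ℂ)
          - ((Real.sin (n * Real.pi / L * x) : ℝ) : ℂ) * Complex.I := by fun_prop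
      exact hg.continuousOn.smul hFc
    have i1 : IntervalIntegrable Φ volume (-L) 0 := by
      refine ContinuousOn.intervalIntegrable (hΦc.mono ?_)
      rw [uIcc_of_le (by linarith)]; exact Icc_subset_Icc_right hL.le
    have i2 : IntervalIntegrable Φ volume 0 L := by
      refine ContinuousOn.intervalIntegrable (hΦc.mono ?_)
      rw [uIcc_of_le hL.le]; exact Icc_subset_Icc_left (by linarith)
    have i3 : IntervalIntegrable (fun x => Φ (-x)) volume 0 L := by
      refine ContinuousOn.intervalIntegrable (hΦc.comp (by fun_prop) fun x hx => ?_)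
      rw [uIcc_of_le hL.le] at hx
      exact ⟨by linarith [hx.2], by linarith [hx.1]⟩
    rw [← intervalIntegral.integral_add_adjacent_intervals i1 i2]
    have e1 : ∫ x in (-L)..0, Φ x = ∫ x in (0 : ℝ)..L, Φ (-x) := by
      rw [intervalIntegral.integral_comp_neg]; simp
    rw [e1, ← intervalIntegral.integral_add i3 i2]
    have e2 : ∫ x in (0 : ℝ)..L, (Φ (-x) + Φ x)
        = ∫ x in (0 : ℝ)..L, (-2 * Complex.I) *
            ((v x * Real.sin (n * Real.pi / L * x) : ℝ) : ℂ) := by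
      refine intervalIntegral.integral_congr fun x hx => ?_
      rw [uIcc_of_le hL.le] at hx
      simp only [hΦ, hF, neg_neg, mul_neg, Real.cos_neg, Real.sin_neg, max_eq_left hx.1,
        max_eq_right (neg_nonpos.2 hx.1), v0, smul_eq_mul]
      push_cast
      ring
    rw [e2, intervalIntegral.integral_const_mul, intervalIntegral.integral_ofReal]
    have hLc : (L : ℂ) ≠ 0 := by exact_mod_cast hL.ne'
    rw [Complex.real_smul]
    have e3 : ∫ x in (0 : ℝ)..L, v x * Real.sin (n * Real.pi / L * x) = b n := rfl
    rw [e3]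
    push_cast
    have : (L - -L : ℂ) = 2 * L := by ring
    rw [this]
    field_simp
  have hsum : Summable (fourierCoeff f) := by
    rw [show fourierCoeff f = fun n => -Complex.I * ((1 / L * b n : ℝ) : ℂ) from funext hcoef]
    exact ((Complex.hasSum_ofReal.2 (hb.mul_left (1 / L)).hasSum).summable).mul_left _
  have h := has_pointwise_sum_fourier_series_of_summable hsum (x : AddCircle (2 * L))
  have hfx : f (x : AddCircle (2 * L)) = ((v x : ℝ) : ℂ) := by
    change AddCircle.liftIco (2 * L) (-L) F x = _
    rw [AddCircle.liftIco_coe_apply ⟨by linarith [hx.1], by linarith⟩]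
    simp [hF, hx.1, v0]
  rw [hfx] at h
  convert! hasSum_re_of_hasSum h using 1
  funext n
  have hLc : (L : ℂ) ≠ 0 := by exact_mod_cast hL.ne'
  have : 2 * (Real.pi : ℂ) * Complex.I * (n : ℂ) * (x : ℂ) /
      ((2 * L : ℝ) : ℂ) = ((n * Real.pi / L * x : ℝ) : ℂ) * Complex.I := by
    push_cast
    field_simp
  rw [hcoef, fourier_coe_apply, this, Complex.exp_mul_I, ← Complex.ofReal_cos,
    ← Complex.ofReal_sin]
  generalize Real.cos (n * Real.pi / L * x) = p
  generalize Real.sin (n * Real.pi / L * x) = q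
  simp
  ring

/-- Termwise integration of a series, with integrability of the sum. -/
theorem intervalIntegrable_and_hasSum_integral {F : ℤ → ℝ → ℝ} {G : ℝ → ℝ} {a : ℤ → ℝ} {T : ℝ}
    (hT : 0 ≤ T) (hF : ∀ n, IntervalIntegrable (F n) volume 0 T)
    (ha : Summable a) (hFa : ∀ n, ∫ s in (0 : ℝ)..T, |F n s| ≤ a n)
    (hG : ∀ s ∈ Ioo 0 T, HasSum (fun n => F n s) (G s)) :
    IntervalIntegrable G volume 0 T ∧
      HasSum (fun n => ∫ s in (0 : ℝ)..T, F n s) (∫ s in (0 : ℝ)..T, G s) := by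
  have hF' : ∀ n, Integrable (F n) (volume.restrict (Ioo 0 T)) := fun n => by
    have := (intervalIntegrable_iff_integrableOn_Ioo_of_le hT).1 (hF n)
    exact this
  have e : ∀ f : ℝ → ℝ, ∫ s in (0 : ℝ)..T, f s = ∫ s in Ioo 0 T, f s := fun f => by
    rw [intervalIntegral.integral_of_le hT, integral_Ioc_eq_integral_Ioo]
  have hsum : Summable fun n => ∫ s in Ioo 0 T, ‖F n s‖ := by
    refine Summable.of_nonneg_of_le (fun n => integral_nonneg fun _ => norm_nonneg _)
      (fun n => ?_) ha
    have := hFa n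
    rwa [e] at this
  have hG' : ∀ᵐ s ∂volume.restrict (Ioo 0 T), HasSum (fun n => F n s) (G s) :=
    (ae_restrict_iff' measurableSet_Ioo).2 (Eventually.of_forall hG)
  have htsum : (fun s => ∑' n, F n s) =ᵐ[volume.restrict (Ioo 0 T)] G := by
    filter_upwards [hG'] with s hs using hs.tsum_eq
  have hmeas : AEStronglyMeasurable G (volume.restrict (Ioo 0 T)) := by
    refine aestronglyMeasurable_of_tendsto_ae atTop
      (f := fun (A : Finset ℤ) s => ∑ n ∈ A, F n s) (fun A => ?_) hG'
    exact Finset.aestronglyMeasurable_fun_sum A fun n _ => (hF' n).aestronglyMeasurable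
  refine ⟨?_, ?_⟩
  · rw [intervalIntegrable_iff_integrableOn_Ioo_of_le hT]
    refine ⟨hmeas, ?_⟩
    have hfin : ∑' n, ∫⁻ s in Ioo 0 T, ‖F n s‖ₑ ≠ ⊤ := by
      have : ∀ n, ∫⁻ s in Ioo 0 T, ‖F n s‖ₑ = ENNReal.ofReal (∫ s in Ioo 0 T, ‖F n s‖) :=
        fun n => (ofReal_integral_norm_eq_lintegral_enorm (hF' n)).symm
      simp_rw [this]
      exact hsum.tsum_ofReal_ne_top
    rw [← lintegral_tsum fun n => (hF' n).aestronglyMeasurable.enorm] at hfin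
    refine lt_of_le_of_lt (lintegral_mono_ae ?_) hfin.lt_top
    filter_upwards [hG'] with s hs
    rw [← hs.tsum_eq]
    exact enorm_tsum_le_tsum_enorm
  · simp_rw [e]
    rw [← integral_congr_ae htsum]
    exact hasSum_integral_of_summable_integral_norm hF' hsum

theorem integral_exp_decay_le {c τ : ℝ} (hc : 0 < c) :
    ∫ s in (0 : ℝ)..τ, Real.exp (-(c * (τ - s))) ≤ 1 / c := by
  have h : ∀ s ∈ uIcc 0 τ, HasDerivAt (fun s => Real.exp (-(c * (τ - s))) / c)
      (Real.exp (-(c * (τ - s)))) s := fun s _ => by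
    have := ((((hasDerivAt_id s).const_sub τ).const_mul c).neg.exp).div_const c
    refine this.congr_deriv ?_
    simp
    field_simp
  rw [intervalIntegral.integral_eq_sub_of_hasDerivAt h
    (Continuous.intervalIntegrable (by fun_prop) _ _)]
  have := Real.exp_pos (-(c * (τ - 0)))
  have : 0 < Real.exp (-(c * (τ - 0))) / c := by positivity
  simp only [sub_self, mul_zero, neg_zero, Real.exp_zero]
  linarith

/-- Half of the exponent absorbs the factor `σ`, by `x ≤ exp x`. -/
theorem mul_exp_neg_le {c σ : ℝ} (hc : 0 < c) :
    σ * Real.exp (-(c * σ)) ≤ 2 / c * Real.exp (-(c / 2 * σ)) := by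
  have h1 : Real.exp (-(c * σ)) = Real.exp (-(c / 2 * σ)) * Real.exp (-(c / 2 * σ)) := by
    rw [← Real.exp_add]; ring_nf
  have h2 : c / 2 * σ ≤ Real.exp (c / 2 * σ) := by
    linarith [Real.add_one_le_exp (c / 2 * σ)]
  have h3 : σ * Real.exp (-(c / 2 * σ)) ≤ 2 / c := by
    rw [Real.exp_neg, ← div_eq_mul_inv, div_le_div_iff₀ (Real.exp_pos _) hc]
    linarith
  rw [h1, ← mul_assoc]
  exact mul_le_mul_of_nonneg_right h3 (Real.exp_pos _).le

theorem integral_mul_exp_decay_le {c τ : ℝ} (hc : 0 < c) (hτ : 0 ≤ τ) :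
    ∫ s in (0 : ℝ)..τ, (τ - s) * Real.exp (-(c * (τ - s))) ≤ 4 / c ^ 2 := by
  calc ∫ s in (0 : ℝ)..τ, (τ - s) * Real.exp (-(c * (τ - s)))
      ≤ ∫ s in (0 : ℝ)..τ, 2 / c * Real.exp (-(c / 2 * (τ - s))) :=
        intervalIntegral.integral_mono_on hτ (Continuous.intervalIntegrable (by fun_prop) _ _)
          (Continuous.intervalIntegrable (by fun_prop) _ _) fun s _ => mul_exp_neg_le hc
    _ = 2 / c * ∫ s in (0 : ℝ)..τ, Real.exp (-(c / 2 * (τ - s))) :=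
        intervalIntegral.integral_const_mul _ _
    _ ≤ 2 / c * (1 / (c / 2)) := by gcongr; exact integral_exp_decay_le (half_pos hc)
    _ = 4 / c ^ 2 := by field_simp; norm_num

/-- Integration by parts gains `1/|k|`. The remainder `sin (kY)/k²` fits the same bound because
`|sin (kY)| ≤ |k| Y`. -/
theorem abs_integral_mul_sin_le {k Y : ℝ} (hk : k ≠ 0) (hY : 0 ≤ Y) :
    |∫ x in (0 : ℝ)..Y, x * Real.sin (k * x)| ≤ 2 * Y / |k| := by
  have h : ∀ x ∈ uIcc 0 Y, HasDerivAt
      (fun x => -(x * Real.cos (k * x)) / k + Real.sin (k * x) / k ^ 2)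
      (x * Real.sin (k * x)) x := fun x _ => by
    have hk' : HasDerivAt (fun x => k * x) k x := by simpa using (hasDerivAt_id x).const_mul k
    have := ((((hasDerivAt_id x).mul hk'.cos).neg).div_const k).add (hk'.sin.div_const (k ^ 2))
    refine this.congr_deriv ?_
    simp
    field_simp
    ring
  rw [intervalIntegral.integral_eq_sub_of_hasDerivAt h
    (Continuous.intervalIntegrable (by fun_prop) _ _)]
  simp only [mul_zero, Real.cos_zero, Real.sin_zero, zero_mul, neg_zero, zero_div, add_zero,
    sub_zero]
  have hk0 := abs_pos.2 hk
  have h1 : |-(Y * Real.cos (k * Y)) / k| ≤ Y / |k| := by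
    rw [abs_div, abs_neg, abs_mul, abs_of_nonneg hY]
    gcongr
    exact mul_le_of_le_one_right hY (Real.abs_cos_le_one _)
  have h2 : |Real.sin (k * Y) / k ^ 2| ≤ Y / |k| := by
    rw [abs_div, abs_pow, div_le_div_iff₀ (by positivity) hk0]
    have : |Real.sin (k * Y)| ≤ |k| * Y := by
      have := Real.abs_sin_le_abs (x := k * Y)
      rwa [abs_mul, abs_of_nonneg hY] at this
    nlinarith [mul_le_mul_of_nonneg_right this hk0.le]
  calc _ ≤ |-(Y * Real.cos (k * Y)) / k| + |Real.sin (k * Y) / k ^ 2| := abs_add_le _ _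
    _ ≤ Y / |k| + Y / |k| := add_le_add h1 h2
    _ = _ := by ring

theorem exists_abs_le_of_continuousOn_Icc {f : ℝ → ℝ} {a b : ℝ} (hf : ContinuousOn f (Icc a b)) :
    ∃ C, 0 ≤ C ∧ ∀ s ∈ Icc a b, |f s| ≤ C := by
  obtain ⟨C, hC⟩ := isCompact_Icc.exists_bound_of_continuousOn hf
  exact ⟨max C 0, le_max_right _ _, fun s hs => (hC s hs).trans (le_max_left _ _)⟩

/-! ### Cubic decay of the sine coefficients and the kernel representation -/

namespace IsHeatBelow

variable {θ : ℝ} {y y' h h' D : ℝ → ℝ} {u ux uxx : ℝ → ℝ → ℝ}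

/-- The estimate is anchored at `τ`, so a bound for `y'` near `0` is not needed: on `[τ/2, τ]` the
derivative is bounded, and on `[0, τ/2]` boundedness of `y` suffices since `τ - s ≥ τ/2`. -/
theorem exists_lipschitz (H : IsHeatBelow θ y y' h h' D u ux uxx) {τ : ℝ} (hτ : τ ∈ Ioc 0 θ) :
    ∃ Λ, 0 ≤ Λ ∧ ∀ s ∈ Icc 0 τ, |y s - y τ| ≤ Λ * (τ - s) := by
  have hτ0 := hτ.1
  have hsub : Icc (τ / 2) τ ⊆ Ioc 0 θ := fun s hs => ⟨by linarith [hs.1], hs.2.trans hτ.2⟩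
  obtain ⟨C, hC0, hC⟩ := exists_abs_le_of_continuousOn_Icc (H.y'_cont.mono hsub)
  obtain ⟨Y, hY0, hY⟩ := exists_abs_le_of_continuousOn_Icc
    (H.y_cont.mono (Icc_subset_Icc_right hτ.2))
  refine ⟨C + 4 * Y / τ, by positivity, fun s hs => ?_⟩
  have hτs : 0 ≤ τ - s := sub_nonneg.2 hs.2
  rcases le_total s (τ / 2) with hs2 | hs2
  · calc |y s - y τ| ≤ |y s| + |y τ| := abs_sub _ _
      _ ≤ Y + Y := add_le_add (hY s hs) (hY τ ⟨hτ0.le, le_rfl⟩)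
      _ = 4 * Y / τ * (τ / 2) := by field_simp; ring
      _ ≤ 4 * Y / τ * (τ - s) := by gcongr; linarith
      _ ≤ (C + 4 * Y / τ) * (τ - s) := by gcongr; linarith
  · have := Convex.norm_image_sub_le_of_norm_hasDerivWithin_le (f := y) (f' := y')
      (s := Icc (τ / 2) τ) (C := C) (x := s) (y := τ)
      (fun x hx => (H.y_deriv x (hsub hx)).mono ((hsub.trans Ioc_subset_Icc_self)))
      (fun x hx => hC x hx) (convex_Icc _ _) ⟨hs2, hs.2⟩ ⟨by linarith, le_rfl⟩
    rw [Real.norm_eq_abs, Real.norm_eq_abs, abs_of_nonneg hτs] at this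
    rw [abs_sub_comm]
    refine this.trans ?_
    have : 0 ≤ 4 * Y / τ := by positivity
    gcongr
    linarith

theorem intervalIntegrable_h' (H : IsHeatBelow θ y y' h h' D u ux uxx) {τ : ℝ}
    (hτ : τ ∈ Ioc 0 θ) : IntervalIntegrable h' volume 0 τ :=
  (intervalIntegrable_iff_integrableOn_Ioc_of_le hτ.1.le).2
    (H.h'_int.mono_set (Ioc_subset_Ioc_right hτ.2))

/-- Near `τ` the function `h'` is bounded and the exponential integrates to `1/c`. Before `τ/2` it
is only integrable, but there the exponential itself is at most `exp (-cτ/2) ≤ 2/(τ c)`. -/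
theorem exists_integral_h'_decay_le (H : IsHeatBelow θ y y' h h' D u ux uxx) {τ : ℝ}
    (hτ : τ ∈ Ioc 0 θ) :
    ∃ C, 0 ≤ C ∧ ∀ c > 0, ∫ s in (0 : ℝ)..τ, |h' s| * Real.exp (-(c * (τ - s))) ≤ C / c := by
  have hτ0 := hτ.1
  have hsub : Icc (τ / 2) τ ⊆ Ioc 0 θ := fun s hs => ⟨by linarith [hs.1], hs.2.trans hτ.2⟩
  obtain ⟨A, hA0, hA⟩ := exists_abs_le_of_continuousOn_Icc (H.h'_cont.mono hsub)
  have hi := (H.intervalIntegrable_h' hτ).abs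
  have hI0 : 0 ≤ ∫ s in (0 : ℝ)..τ, |h' s| :=
    intervalIntegral.integral_nonneg hτ0.le fun _ _ => abs_nonneg _
  refine ⟨A + 2 / τ * ∫ s in (0 : ℝ)..τ, |h' s|, by positivity, fun c hc => ?_⟩
  have ie : IntervalIntegrable (fun s => A * Real.exp (-(c * (τ - s)))) volume 0 τ :=
    Continuous.intervalIntegrable (by fun_prop) _ _
  have ih : IntervalIntegrable (fun s => 2 / τ / c * |h' s|) volume 0 τ := hi.const_mul _
  calc ∫ s in (0 : ℝ)..τ, |h' s| * Real.exp (-(c * (τ - s)))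
      ≤ ∫ s in (0 : ℝ)..τ, (A * Real.exp (-(c * (τ - s))) + 2 / τ / c * |h' s|) := by
        refine intervalIntegral.integral_mono_on hτ0.le
          (hi.mul_continuousOn (by fun_prop)) (ie.add ih) fun s hs => ?_
        have hn : 0 ≤ 2 / τ / c * |h' s| := by positivity
        have he := (Real.exp_pos (-(c * (τ - s)))).le
        rcases le_total s (τ / 2) with hs2 | hs2
        · have h1 : Real.exp (-(c * (τ - s))) ≤ 2 / τ / c := by
            have hx : 0 < c * τ / 2 := by positivity
            have h2 : -(c * (τ - s)) ≤ -(c * τ / 2) := by nlinarith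
            refine (Real.exp_le_exp.2 h2).trans ?_
            rw [Real.exp_neg, div_div, inv_le_comm₀ (Real.exp_pos _) (by positivity)]
            have h3 : (2 / (τ * c))⁻¹ = c * τ / 2 := by field_simp
            rw [h3]
            linarith [Real.add_one_le_exp (c * τ / 2)]
          have := mul_le_mul_of_nonneg_left h1 (abs_nonneg (h' s))
          have : 0 ≤ A * Real.exp (-(c * (τ - s))) := mul_nonneg hA0 he
          linarith
        · have := mul_le_mul_of_nonneg_right (hA s ⟨hs2, hs.2⟩) he
          linarith
    _ = A * (∫ s in (0 : ℝ)..τ, Real.exp (-(c * (τ - s))))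
          + 2 / τ / c * ∫ s in (0 : ℝ)..τ, |h' s| := by
        rw [intervalIntegral.integral_add ie ih, intervalIntegral.integral_const_mul,
          intervalIntegral.integral_const_mul]
    _ ≤ A * (1 / c) + 2 / τ / c * ∫ s in (0 : ℝ)..τ, |h' s| := by
        gcongr; exact integral_exp_decay_le hc
    _ = _ := by field_simp

/-- The wave number `n π / L`. -/
def wave (L : ℝ) (n : ℤ) : ℝ := n * Real.pi / L

/-- The contribution of the flux to the `n`-th sine coefficient. -/
def fluxTerm (y h D : ℝ → ℝ) (τ : ℝ) (n : ℤ) (s : ℝ) : ℝ :=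
  (D s - h s) * (Real.exp (-(wave (y τ) n ^ 2 * (τ - s))) * Real.sin (wave (y τ) n * y s))

/-- The contribution of the source to the `n`-th sine coefficient. -/
def sourceTerm (y h' : ℝ → ℝ) (τ : ℝ) (n : ℤ) (s : ℝ) : ℝ :=
  -(h' s) * (Real.exp (-(wave (y τ) n ^ 2 * (τ - s))) *
    ∫ x in (0 : ℝ)..y s, x * Real.sin (wave (y τ) n * x))

theorem abs_wave {L : ℝ} (hL : 0 < L) (n : ℤ) : |wave L n| = Real.pi / L * |(n : ℝ)| := by
  rw [wave, abs_div, abs_mul, abs_of_pos Real.pi_pos, abs_of_pos hL]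
  ring

theorem wave_ne_zero {L : ℝ} (hL : 0 < L) {n : ℤ} (hn : n ≠ 0) : wave L n ≠ 0 := by
  have : (n : ℝ) ≠ 0 := by exact_mod_cast hn
  have := Real.pi_pos
  rw [wave]
  positivity

theorem wave_zero (L : ℝ) : wave L 0 = 0 := by simp [wave]

variable {τ : ℝ}

theorem intervalIntegrable_fluxTerm (H : IsHeatBelow θ y y' h h' D u ux uxx) (hτ : τ ∈ Ioc 0 θ)
    (n : ℤ) : IntervalIntegrable (fluxTerm y h D τ n) volume 0 τ := by
  refine ContinuousOn.intervalIntegrable ?_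
  rw [uIcc_of_le hτ.1.le]
  have hsub : Icc 0 τ ⊆ Icc 0 θ := Icc_subset_Icc_right hτ.2
  have := H.D_cont.mono hsub
  have := H.h_cont.mono hsub
  have := H.y_cont.mono hsub
  unfold fluxTerm
  fun_prop

theorem intervalIntegrable_sourceTerm (H : IsHeatBelow θ y y' h h' D u ux uxx)
    (hτ : τ ∈ Ioc 0 θ) (n : ℤ) : IntervalIntegrable (sourceTerm y h' τ n) volume 0 τ := by
  refine (H.intervalIntegrable_h' hτ).neg.mul_continuousOn ?_
  rw [uIcc_of_le hτ.1.le]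
  have hsub : Icc 0 τ ⊆ Icc 0 θ := Icc_subset_Icc_right hτ.2
  have := (H.continuousOn_moment (wave (y τ) n)).mono hsub
  fun_prop

/-- Because `k y(τ) = nπ`, the sine along the curve is `O(|k| (τ - s))`. Integrating `(τ - s) exp
(-k² (τ - s))` gives `k⁻⁴`, in total `|k|⁻³`. -/
theorem exists_integral_fluxTerm_le (H : IsHeatBelow θ y y' h h' D u ux uxx)
    (hτ : τ ∈ Ioc 0 θ) :
    ∃ C, 0 ≤ C ∧ ∀ n, ∫ s in (0 : ℝ)..τ, |fluxTerm y h D τ n s| ≤ C / |(n : ℝ)| ^ 3 := by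
  have hτ0 := hτ.1
  have hsub : Icc 0 τ ⊆ Icc 0 θ := Icc_subset_Icc_right hτ.2
  have hL : 0 < y τ := H.y_pos τ (Ioc_subset_Icc_self hτ)
  have hpi := Real.pi_pos
  obtain ⟨Λ, hΛ0, hΛ⟩ := H.exists_lipschitz hτ
  obtain ⟨A, hA0, hA⟩ := exists_abs_le_of_continuousOn_Icc
    ((H.D_cont.sub H.h_cont).mono hsub)
  refine ⟨A * Λ * 4 / (Real.pi / y τ) ^ 3, by positivity, fun n => ?_⟩
  -- At `n = 0` the bound reads `C / 0 = 0`, which is correct since the mode is zero.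
  rcases eq_or_ne n 0 with rfl | hn
  · simp [fluxTerm, wave_zero]
  set k := wave (y τ) n with hk
  have hk0 : k ≠ 0 := wave_ne_zero hL hn
  have hk2 : 0 < k ^ 2 := by positivity
  have hka : 0 < |k| := abs_pos.2 hk0
  have hpt : ∀ s ∈ Icc 0 τ, |fluxTerm y h D τ n s|
      ≤ A * Λ * |k| * ((τ - s) * Real.exp (-(k ^ 2 * (τ - s)))) := by
    intro s hs
    have h1 : |Real.sin (k * y s)| ≤ |k| * (Λ * (τ - s)) := by
      have e1 : k * y s = k * (y s - y τ) + k * y τ := by ring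
      have e2 : k * y τ = n * Real.pi := by rw [hk, wave, div_mul_cancel₀ _ hL.ne']
      rw [e1, e2, Real.sin_add_int_mul_pi, abs_mul, abs_zpow, abs_neg, abs_one, one_zpow, one_mul]
      refine Real.abs_sin_le_abs.trans ?_
      rw [abs_mul]
      gcongr
      exact hΛ s hs
    rw [fluxTerm, abs_mul, abs_mul, Real.abs_exp, ← hk]
    have hτs : 0 ≤ τ - s := sub_nonneg.2 hs.2
    calc |D s - h s| * (Real.exp (-(k ^ 2 * (τ - s))) * |Real.sin (k * y s)|)
        ≤ A * (Real.exp (-(k ^ 2 * (τ - s))) * (|k| * (Λ * (τ - s)))) := by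
          gcongr
          exact hA s hs
      _ = _ := by ring
  calc ∫ s in (0 : ℝ)..τ, |fluxTerm y h D τ n s|
      ≤ ∫ s in (0 : ℝ)..τ, A * Λ * |k| * ((τ - s) * Real.exp (-(k ^ 2 * (τ - s)))) :=
        intervalIntegral.integral_mono_on hτ0.le (H.intervalIntegrable_fluxTerm hτ n).abs
          (Continuous.intervalIntegrable (by fun_prop) _ _) hpt
    _ = A * Λ * |k| * ∫ s in (0 : ℝ)..τ, (τ - s) * Real.exp (-(k ^ 2 * (τ - s))) :=
        intervalIntegral.integral_const_mul _ _
    _ ≤ A * Λ * |k| * (4 / (k ^ 2) ^ 2) := by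
        gcongr; exact integral_mul_exp_decay_le hk2 hτ0.le
    _ = A * Λ * 4 / |k| ^ 3 := by
        rw [← sq_abs k]; field_simp
    _ = _ := by rw [hk, abs_wave hL, mul_pow, div_div]

/-- The moment of `x` against the sine gives `|k|⁻¹`, and the time integral of `|h'|` against the
heat factor gives `k⁻²`. -/
theorem exists_integral_sourceTerm_le (H : IsHeatBelow θ y y' h h' D u ux uxx)
    (hτ : τ ∈ Ioc 0 θ) :
    ∃ C, 0 ≤ C ∧ ∀ n, ∫ s in (0 : ℝ)..τ, |sourceTerm y h' τ n s| ≤ C / |(n : ℝ)| ^ 3 := by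
  have hτ0 := hτ.1
  have hsub : Icc 0 τ ⊆ Icc 0 θ := Icc_subset_Icc_right hτ.2
  have hL : 0 < y τ := H.y_pos τ (Ioc_subset_Icc_self hτ)
  have hpi := Real.pi_pos
  obtain ⟨A, hA0, hA⟩ := H.exists_integral_h'_decay_le hτ
  obtain ⟨Y, hY0, hY⟩ := exists_abs_le_of_continuousOn_Icc (H.y_cont.mono hsub)
  refine ⟨2 * Y * A / (Real.pi / y τ) ^ 3, by positivity, fun n => ?_⟩
  rcases eq_or_ne n 0 with rfl | hn
  · simp [sourceTerm, wave_zero]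
  set k := wave (y τ) n with hk
  have hk0 : k ≠ 0 := wave_ne_zero hL hn
  have hk2 : 0 < k ^ 2 := by positivity
  have hka : 0 < |k| := abs_pos.2 hk0
  have hpt : ∀ s ∈ Icc 0 τ, |sourceTerm y h' τ n s|
      ≤ 2 * Y / |k| * (|h' s| * Real.exp (-(k ^ 2 * (τ - s)))) := by
    intro s hs
    have hys := (H.y_pos s (hsub hs)).le
    have h1 := abs_integral_mul_sin_le hk0 hys
    have h2 : 2 * y s / |k| ≤ 2 * Y / |k| := by
      gcongr
      exact (le_abs_self _).trans (hY s hs)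
    rw [sourceTerm, abs_mul, abs_neg, abs_mul, Real.abs_exp, ← hk]
    calc |h' s| * (Real.exp (-(k ^ 2 * (τ - s))) * |∫ x in (0 : ℝ)..y s, x * Real.sin (k * x)|)
        ≤ |h' s| * (Real.exp (-(k ^ 2 * (τ - s))) * (2 * Y / |k|)) := by
          gcongr
          exact h1.trans h2
      _ = _ := by ring
  calc ∫ s in (0 : ℝ)..τ, |sourceTerm y h' τ n s|
      ≤ ∫ s in (0 : ℝ)..τ, 2 * Y / |k| * (|h' s| * Real.exp (-(k ^ 2 * (τ - s)))) :=
        intervalIntegral.integral_mono_on hτ0.le (H.intervalIntegrable_sourceTerm hτ n).abs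
          (((H.intervalIntegrable_h' hτ).abs.mul_continuousOn (by fun_prop)).const_mul _) hpt
    _ = 2 * Y / |k| * ∫ s in (0 : ℝ)..τ, |h' s| * Real.exp (-(k ^ 2 * (τ - s))) :=
        intervalIntegral.integral_const_mul _ _
    _ ≤ 2 * Y / |k| * (A / k ^ 2) := by gcongr; exact hA _ hk2
    _ = 2 * Y * A / |k| ^ 3 := by
        rw [← sq_abs k]; field_simp
    _ = _ := by rw [hk, abs_wave hL, mul_pow, div_div]

/-- The sine coefficients of `v(τ, ·) = u(τ, ·) - x h(τ)` on `[0, y(τ)]`. -/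
def sineCoeff (y h : ℝ → ℝ) (u : ℝ → ℝ → ℝ) (τ : ℝ) (n : ℤ) : ℝ :=
  ∫ x in (0 : ℝ)..y τ, (u τ x - x * h τ) * Real.sin (n * Real.pi / y τ * x)

/-- This is `green` at the wave number frozen at the final time, multiplied by `exp (-k² τ)`. -/
theorem sineCoeff_eq (H : IsHeatBelow θ y y' h h' D u ux uxx) (hτ : τ ∈ Ioc 0 θ) (n : ℤ) :
    sineCoeff y h u τ n = (∫ s in (0 : ℝ)..τ, fluxTerm y h D τ n s)
      + ∫ s in (0 : ℝ)..τ, sourceTerm y h' τ n s := by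
  set k := wave (y τ) n with hk
  have hg := congrArg (fun z => Real.exp (-(k ^ 2 * τ)) * z) (H.green hτ k)
  have hexp : ∀ s, Real.exp (-(k ^ 2 * (τ - s))) = Real.exp (-(k ^ 2 * τ)) * Real.exp (k ^ 2 * s) :=
    fun s => by rw [← Real.exp_add]; ring_nf
  simp only [mul_sub, ← intervalIntegral.integral_const_mul] at hg
  have e1 : sineCoeff y h u τ n = ∫ x in (0 : ℝ)..y τ, Real.exp (-(k ^ 2 * τ)) *
      ((u τ x - x * h τ) * (Real.exp (k ^ 2 * τ) * Real.sin (k * x))) := by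
    refine intervalIntegral.integral_congr fun x _ => ?_
    have := hexp τ
    rw [sub_self, mul_zero, neg_zero, Real.exp_zero] at this
    change (u τ x - x * h τ) * Real.sin (k * x) = _
    linear_combination (u τ x - x * h τ) * Real.sin (k * x) * this
  rw [e1, hg, sub_eq_add_neg, ← intervalIntegral.integral_neg]
  congr 1
  · refine intervalIntegral.integral_congr fun s _ => ?_
    simp only [fluxTerm, ← hk, hexp]
    ring
  · refine intervalIntegral.integral_congr fun s _ => ?_
    simp only [sourceTerm, ← hk, hexp, intervalIntegral.integral_const_mul]
    ring

theorem exists_abs_sineCoeff_le (H : IsHeatBelow θ y y' h h' D u ux uxx) (hτ : τ ∈ Ioc 0 θ) :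
    ∃ C, 0 ≤ C ∧ ∀ n, |sineCoeff y h u τ n| ≤ C / |(n : ℝ)| ^ 3 := by
  obtain ⟨A, hA0, hA⟩ := H.exists_integral_fluxTerm_le hτ
  obtain ⟨B, hB0, hB⟩ := H.exists_integral_sourceTerm_le hτ
  refine ⟨A + B, by positivity, fun n => ?_⟩
  rw [H.sineCoeff_eq hτ, add_div]
  refine (abs_add_le _ _).trans (add_le_add ?_ ?_)
  · exact (intervalIntegral.abs_integral_le_integral_abs hτ.1.le).trans (hA n)
  · exact (intervalIntegral.abs_integral_le_integral_abs hτ.1.le).trans (hB n)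

theorem summable_div_sq (C : ℝ) : Summable fun n : ℤ => C / |(n : ℝ)| ^ 2 := by
  have := (Real.summable_one_div_int_pow.2 (by norm_num : 1 < 2)).mul_left C
  refine this.congr fun n => ?_
  rw [sq_abs]
  ring

/-- Cubic decay pays for a weight of order `|n|` and stays summable. At `n = 0` the weight is forced
to vanish, in agreement with division by zero. -/
theorem mul_div_cube_le {C C' : ℝ} (n : ℤ) (hC : 0 ≤ C) {a b : ℝ} (ha : a ≤ C' * |(n : ℝ)|)
    (ha0 : 0 ≤ a) (hb : b ≤ C / |(n : ℝ)| ^ 3) : a * b ≤ C' * C / |(n : ℝ)| ^ 2 := by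
  rcases eq_or_ne n 0 with rfl | hn
  · have : a = 0 := le_antisymm (by simpa using ha) ha0
    simp [this]
  · have hn' : 0 < |(n : ℝ)| := abs_pos.2 (by exact_mod_cast hn)
    calc a * b ≤ a * (C / |(n : ℝ)| ^ 3) := by gcongr
      _ ≤ (C' * |(n : ℝ)|) * (C / |(n : ℝ)| ^ 3) := by gcongr
      _ = _ := by field_simp

/-- Representation of the sine series with weights `κ n` by the corresponding kernel. -/
theorem kernel_representation (H : IsHeatBelow θ y y' h h' D u ux uxx) (hτ : τ ∈ Ioc 0 θ)
    {κ : ℤ → ℝ} {C₀ : ℝ} (hκ : ∀ n, |κ n| ≤ C₀ * |(n : ℝ)|) {Kr : ℝ → ℝ → ℝ}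
    (hKr : ∀ s ∈ Ioo 0 τ, ∀ ξ, HasSum (fun n : ℤ => 1 / y τ *
      (Real.exp (-(wave (y τ) n ^ 2 * (τ - s))) * κ n * Real.sin (wave (y τ) n * ξ))) (Kr ξ s))
    {lam : ℝ → ℝ → ℝ} (hlam : ∀ s ∈ Ioo 0 τ, ∀ ξ, lam s ξ = -ξ * h' s) :
    IntervalIntegrable (fun s => (D s - h s) * Kr (y s) s) volume 0 τ ∧
    (∀ s ∈ Ioo 0 τ, IntervalIntegrable (fun ξ => lam s ξ * Kr ξ s) volume 0 (y s)) ∧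
    IntervalIntegrable (fun s => ∫ ξ in (0 : ℝ)..y s, lam s ξ * Kr ξ s) volume 0 τ ∧
    HasSum (fun n : ℤ => 1 / y τ * (κ n * sineCoeff y h u τ n))
      ((∫ s in (0 : ℝ)..τ, (D s - h s) * Kr (y s) s)
        + ∫ s in (0 : ℝ)..τ, ∫ ξ in (0 : ℝ)..y s, lam s ξ * Kr ξ s) := by
  have hτ0 := hτ.1
  have hL : 0 < y τ := H.y_pos τ (Ioc_subset_Icc_self hτ)
  have hpi := Real.pi_pos
  obtain ⟨A, hA0, hA⟩ := H.exists_integral_fluxTerm_le hτ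
  obtain ⟨B, hB0, hB⟩ := H.exists_integral_sourceTerm_le hτ
  have hκ' : ∀ n, |1 / y τ * κ n| ≤ 1 / y τ * C₀ * |(n : ℝ)| := fun n => by
    rw [abs_mul, abs_of_pos (one_div_pos.2 hL), mul_assoc]
    gcongr
    exact hκ n
  -- One bound of order `|n|⁻²` serves both for the value (`κ` a sine) and for the gradient (`κ` a
  -- wave number times a cosine).
  have hint : ∀ (F : ℤ → ℝ → ℝ) (C : ℝ), 0 ≤ C →
      (∀ n, ∫ s in (0 : ℝ)..τ, |F n s| ≤ C / |(n : ℝ)| ^ 3) → ∀ n,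
      ∫ s in (0 : ℝ)..τ, |1 / y τ * κ n * F n s| ≤ 1 / y τ * C₀ * C / |(n : ℝ)| ^ 2 := by
    intro F C hC hF n
    simp_rw [abs_mul (1 / y τ * κ n)]
    rw [intervalIntegral.integral_const_mul]
    exact mul_div_cube_le n hC (hκ' n) (abs_nonneg _) (hF n)
  obtain ⟨f1, f2⟩ := intervalIntegrable_and_hasSum_integral hτ0.le
    (F := fun n s => 1 / y τ * κ n * fluxTerm y h D τ n s)
    (G := fun s => (D s - h s) * Kr (y s) s)
    (fun n => (H.intervalIntegrable_fluxTerm hτ n).const_mul _)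
    (summable_div_sq _) (hint _ A hA0 hA) (fun s hs => by
      convert! (hKr s hs (y s)).mul_left (D s - h s) using 2 with n
      rw [fluxTerm]; ring)
  -- For fixed `s < τ` the Gaussian factor in `n` allows the exchange in `ξ`. That domination
  -- degenerates as `s → τ`, so the exchange in `s` relies on the cubic bound instead.
  have inner : ∀ s ∈ Ioo 0 τ, IntervalIntegrable (fun ξ => lam s ξ * Kr ξ s) volume 0 (y s) ∧
      HasSum (fun n => 1 / y τ * κ n * sourceTerm y h' τ n s)
        (∫ ξ in (0 : ℝ)..y s, lam s ξ * Kr ξ s) := by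
    intro s hs
    have hys : 0 < y s := H.y_pos s ⟨hs.1.le, hs.2.le.trans hτ.2⟩
    have hc : 0 < (Real.pi / y τ) ^ 2 * (τ - s) := by
      have := sub_pos.2 hs.2
      positivity
    obtain ⟨g1, g2⟩ := intervalIntegrable_and_hasSum_integral hys.le
      (F := fun n ξ => 1 / y τ * κ n * (-(h' s) * (Real.exp (-(wave (y τ) n ^ 2 * (τ - s))) *
        (ξ * Real.sin (wave (y τ) n * ξ)))))
      (G := fun ξ => lam s ξ * Kr ξ s)
      (a := fun n => 1 / y τ * C₀ * |h' s| * y s * y s *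
        (|(n : ℝ)| ^ 1 * Real.exp (-((Real.pi / y τ) ^ 2 * (τ - s) * n ^ 2))))
      (fun n => Continuous.intervalIntegrable (by fun_prop) _ _)
      ((summable_abs_pow_mul_exp_neg_sq hc 1).mul_left _)
      (fun n => by
        have hw : wave (y τ) n ^ 2 * (τ - s) = (Real.pi / y τ) ^ 2 * (τ - s) * n ^ 2 := by
          rw [wave]; ring
        have : ∀ ξ ∈ Icc 0 (y s), |1 / y τ * κ n * (-(h' s) *
            (Real.exp (-(wave (y τ) n ^ 2 * (τ - s))) * (ξ * Real.sin (wave (y τ) n * ξ))))|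
            ≤ 1 / y τ * C₀ * |(n : ℝ)| * (|h' s| * (Real.exp
              (-((Real.pi / y τ) ^ 2 * (τ - s) * n ^ 2)) * (y s * 1))) := by
          intro ξ hξ
          rw [abs_mul, abs_mul (-(h' s)), abs_neg, abs_mul (Real.exp _), Real.abs_exp, abs_mul ξ,
            abs_of_nonneg hξ.1, hw]
          have hξ0 := hξ.1
          gcongr
          · exact (abs_nonneg _).trans (hκ' n)
          · exact hκ' n
          · exact hξ.2
          · exact Real.abs_sin_le_one _
        refine (intervalIntegral.integral_mono_on hys.le
          (Continuous.intervalIntegrable (by fun_prop) _ _)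
          (Continuous.intervalIntegrable continuous_const _ _) this).trans (le_of_eq ?_)
        rw [intervalIntegral.integral_const, smul_eq_mul]
        ring)
      (fun ξ _ => by
        convert! (hKr s hs ξ).mul_left (lam s ξ) using 2 with n
        rw [hlam s hs]; ring)
    refine ⟨g1, ?_⟩
    convert! g2 using 2 with n
    rw [sourceTerm, intervalIntegral.integral_const_mul, intervalIntegral.integral_const_mul,
      intervalIntegral.integral_const_mul]
  obtain ⟨k1, k2⟩ := intervalIntegrable_and_hasSum_integral hτ0.le
    (F := fun n s => 1 / y τ * κ n * sourceTerm y h' τ n s)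
    (G := fun s => ∫ ξ in (0 : ℝ)..y s, lam s ξ * Kr ξ s)
    (fun n => (H.intervalIntegrable_sourceTerm hτ n).const_mul _)
    (summable_div_sq _) (hint _ B hB0 hB) (fun s hs => (inner s hs).2)
  refine ⟨f1, fun s hs => (inner s hs).1, k1, ?_⟩
  convert! f2.add k2 using 2 with n
  rw [intervalIntegral.integral_const_mul, intervalIntegral.integral_const_mul,
    H.sineCoeff_eq hτ]
  ring

theorem continuousOn_u (H : IsHeatBelow θ y y' h h' D u ux uxx) {s : ℝ} (hs : s ∈ Icc 0 θ) :
    ContinuousOn (u s) (Icc 0 (y s)) :=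
  H.u_cont.comp (f := fun x => (s, x)) (by fun_prop) fun _ hx => ⟨hs, hx⟩

theorem abs_wave_mul_sineCoeff_le {C : ℝ} (hL : 0 < y τ) (hC0 : 0 ≤ C)
    (hC : ∀ n, |sineCoeff y h u τ n| ≤ C / |(n : ℝ)| ^ 3) (n : ℤ) :
    |wave (y τ) n| * |sineCoeff y h u τ n| ≤ Real.pi / y τ * C / |(n : ℝ)| ^ 2 :=
  mul_div_cube_le n hC0 (abs_wave hL n).le (abs_nonneg _) (hC n)

theorem summable_sineCoeff (H : IsHeatBelow θ y y' h h' D u ux uxx) (hτ : τ ∈ Ioc 0 θ) :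
    Summable (sineCoeff y h u τ) := by
  obtain ⟨C, hC0, hC⟩ := H.exists_abs_sineCoeff_le hτ
  refine Summable.of_norm_bounded (summable_div_sq C) fun n => (hC n).trans ?_
  rcases eq_or_ne n 0 with rfl | hn
  · simp
  · have hn' : 1 ≤ |(n : ℝ)| := by exact_mod_cast Int.one_le_abs hn
    gcongr
    · norm_num

theorem hasSum_sineCoeff (H : IsHeatBelow θ y y' h h' D u ux uxx) (hτ : τ ∈ Ioc 0 θ) {x : ℝ}
    (hx : x ∈ Icc 0 (y τ)) :
    HasSum (fun n : ℤ => 1 / y τ * (Real.sin (wave (y τ) n * x) * sineCoeff y h u τ n))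
      (u τ x - x * h τ) := by
  have hτ' := Ioc_subset_Icc_self hτ
  have hL : 0 < y τ := H.y_pos τ hτ'
  have := hasSum_sine_series hL (v := fun x => u τ x - x * h τ)
    ((H.continuousOn_u hτ').sub (by fun_prop)) (by simp [H.left τ hτ'])
    (by simp only [H.right τ hτ']; ring) (H.summable_sineCoeff hτ) hx
  convert! this using 2 with n
  rw [mul_comm (Real.sin _)]
  rfl

/-- The series is differentiable on all of `ℝ` but represents `v` only on `[0, y(τ)]`. At the end
point its derivative and the one-sided derivative of `v` agree by uniqueness of derivatives within
the interval. -/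
theorem hasSum_sineCoeff_deriv (H : IsHeatBelow θ y y' h h' D u ux uxx) (hτ : τ ∈ Ioc 0 θ) :
    HasSum (fun n : ℤ => 1 / y τ *
      (wave (y τ) n * Real.cos (wave (y τ) n * y τ) * sineCoeff y h u τ n)) (D τ - h τ) := by
  have hτ' := Ioc_subset_Icc_self hτ
  have hL : 0 < y τ := H.y_pos τ hτ'
  obtain ⟨C, hC0, hC⟩ := H.exists_abs_sineCoeff_le hτ
  have hb : ∀ (n : ℤ) (x : ℝ), ‖1 / y τ *
      (wave (y τ) n * Real.cos (wave (y τ) n * x) * sineCoeff y h u τ n)‖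
      ≤ 1 / y τ * (Real.pi / y τ * C) / |(n : ℝ)| ^ 2 := by
    intro n x
    rw [Real.norm_eq_abs, abs_mul, abs_of_pos (one_div_pos.2 hL), abs_mul, abs_mul, mul_div_assoc]
    gcongr
    refine le_trans ?_ (abs_wave_mul_sineCoeff_le hL hC0 hC n)
    gcongr
    exact mul_le_of_le_one_right (abs_nonneg _) (Real.abs_cos_le_one _)
  have hd := hasDerivAt_tsum (𝕜 := ℝ) (F := ℝ)
    (g := fun (n : ℤ) x => 1 / y τ * (Real.sin (wave (y τ) n * x) * sineCoeff y h u τ n))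
    (g' := fun (n : ℤ) x => 1 / y τ *
      (wave (y τ) n * Real.cos (wave (y τ) n * x) * sineCoeff y h u τ n))
    -- Every summand vanishes at `0`, so the required convergence at one point is trivial.
    (y₀ := 0) (summable_div_sq (1 / y τ * (Real.pi / y τ * C))) (fun n x => by
      have hk : HasDerivAt (fun x => wave (y τ) n * x) (wave (y τ) n) x := by
        simpa using (hasDerivAt_id x).const_mul (wave (y τ) n)
      exact ((hk.sin.mul_const (sineCoeff y h u τ n)).const_mul (1 / y τ)).congr_deriv (by ring))
    hb (by simp [summable_zero]) (y τ)
  have hmem : y τ ∈ Icc 0 (y τ) := ⟨hL.le, le_rfl⟩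
  have hd2 : HasDerivWithinAt (fun x => u τ x - x * h τ) (D τ - h τ) (Icc 0 (y τ)) (y τ) := by
    have h1 := H.ux_deriv τ hτ (y τ) hmem
    rw [H.flux τ hτ] at h1
    have h2 : HasDerivWithinAt (fun x => x * h τ) (h τ) (Icc 0 (y τ)) (y τ) := by
      simpa using ((hasDerivAt_id (y τ)).mul_const (h τ)).hasDerivWithinAt
    exact h1.sub h2
  have hd3 := hd2.congr (fun x hx => (H.hasSum_sineCoeff hτ hx).tsum_eq)
    (H.hasSum_sineCoeff hτ hmem).tsum_eq
  have huniq := (uniqueDiffOn_Icc hL (y τ) hmem).eq_deriv _ hd.hasDerivWithinAt hd3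
  rw [← huniq]
  exact (Summable.of_norm_bounded (summable_div_sq _) fun n => hb n (y τ)).hasSum

end IsHeatBelow

/-! ### Time-dependent coefficients and the change of variables -/

theorem hasDerivWithinAt_primitive {f : ℝ → ℝ} {a b c t : ℝ} (hf : ContinuousOn f (Icc a b))
    (hc : c ∈ Icc a b) (ht : t ∈ Icc a b) :
    HasDerivWithinAt (fun t => ∫ s in c..t, f s) (f t) (Icc a b) t := by
  have : Fact (t ∈ Icc a b) := ⟨ht⟩
  refine intervalIntegral.integral_hasDerivWithinAt_right ?_
    (hf.stronglyMeasurableAtFilter_nhdsWithin measurableSet_Icc t) (hf t ht)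
  exact (hf.mono (uIcc_subset_Icc hc ht)).intervalIntegrable

namespace OUCall

/-- Standing assumptions on the coefficients and the exercise boundary. -/
structure IsRegular (M : OUCall) : Prop where
  hT : 0 < M.T
  hr : DifferentiableOn ℝ M.r (Icc 0 M.T)
  hq : DifferentiableOn ℝ M.q (Icc 0 M.T)
  hσ : DifferentiableOn ℝ M.σ (Icc 0 M.T)
  hσ_pos : ∀ t ∈ Icc 0 M.T, 0 < M.σ t
  hw : ∀ t ∈ Icc 0 M.T, HasDerivWithinAt M.w (M.riccatiRHS t) (Icc 0 M.T) t
  hSB_pos : ∀ t ∈ Icc 0 M.T, 0 < M.SB t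
  hSB_cont : ContinuousOn M.SB (Icc 0 M.T)
  hSB_diff : ContDiffOn ℝ 1 M.SB (Ico 0 M.T)
  hSB_int : IntegrableOn (deriv M.SB) (Ioo 0 M.T)
  hSB_T : M.SB M.T = M.K

namespace IsRegular

variable {M : OUCall}

theorem zero_mem (R : M.IsRegular) : (0 : ℝ) ∈ Icc 0 M.T := ⟨le_rfl, R.hT.le⟩

theorem T_mem (R : M.IsRegular) : M.T ∈ Icc 0 M.T := ⟨R.hT.le, le_rfl⟩

theorem continuousOn_w (R : M.IsRegular) : ContinuousOn M.w (Icc 0 M.T) :=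
  fun t ht => (R.hw t ht).continuousWithinAt

theorem g_pos (M : OUCall) (t : ℝ) : 0 < M.g t := Real.exp_pos _

theorem hasDerivWithinAt_g (R : M.IsRegular) {t : ℝ} (ht : t ∈ Icc 0 M.T) :
    HasDerivWithinAt M.g (M.g t * M.w t) (Icc 0 M.T) t :=
  (hasDerivWithinAt_primitive R.continuousOn_w R.T_mem ht).exp

theorem continuousOn_g (R : M.IsRegular) : ContinuousOn M.g (Icc 0 M.T) :=
  fun _ ht => (R.hasDerivWithinAt_g ht).continuousWithinAt

theorem derivWithin_g (R : M.IsRegular) {t : ℝ} (ht : t ∈ Icc 0 M.T) :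
    derivWithin M.g (Icc 0 M.T) t = M.g t * M.w t :=
  (R.hasDerivWithinAt_g ht).derivWithin (uniqueDiffOn_Icc R.hT t ht)

/-! #### The change of time -/

/-- The derivative of `tau`. -/
def dtau (M : OUCall) (t : ℝ) : ℝ := -(1 / 2 * (M.σ t ^ 2 * M.g t ^ 2))

theorem dtau_neg (R : M.IsRegular) {t : ℝ} (ht : t ∈ Icc 0 M.T) : dtau M t < 0 := by
  have := R.hσ_pos t ht
  have := g_pos M t
  rw [dtau, neg_lt_zero]
  positivity

theorem continuousOn_dtau (R : M.IsRegular) : ContinuousOn (dtau M) (Icc 0 M.T) := by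
  have := R.hσ.continuousOn
  have := R.continuousOn_g
  unfold dtau
  fun_prop

theorem hasDerivWithinAt_tau (R : M.IsRegular) {t : ℝ} (ht : t ∈ Icc 0 M.T) :
    HasDerivWithinAt M.tau (dtau M t) (Icc 0 M.T) t := by
  have hc : ContinuousOn (fun s => M.σ s ^ 2 * M.g s ^ 2) (Icc 0 M.T) := by
    have := R.hσ.continuousOn
    have := R.continuousOn_g
    fun_prop
  have h := (hasDerivWithinAt_primitive hc R.T_mem ht).const_mul (-(1 / 2))
  have e : M.tau = fun t => -(1 / 2) * ∫ s in M.T..t, M.σ s ^ 2 * M.g s ^ 2 := by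
    funext t
    rw [tau, intervalIntegral.integral_symm]
    ring
  rw [e]
  exact h.congr_deriv (by rw [dtau]; ring)

theorem continuousOn_tau (R : M.IsRegular) : ContinuousOn M.tau (Icc 0 M.T) :=
  fun _ ht => (R.hasDerivWithinAt_tau ht).continuousWithinAt

theorem strictAntiOn_tau (R : M.IsRegular) : StrictAntiOn M.tau (Icc 0 M.T) := by
  refine strictAntiOn_of_deriv_neg (convex_Icc _ _) R.continuousOn_tau fun t ht => ?_
  rw [interior_Icc] at ht
  have ht' := Ioo_subset_Icc_self ht
  rw [((R.hasDerivWithinAt_tau ht').hasDerivAt (Icc_mem_nhds ht.1 ht.2)).deriv]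
  exact R.dtau_neg ht'

theorem tau_T (M : OUCall) : M.tau M.T = 0 := by simp [tau]

theorem bijOn_tau (R : M.IsRegular) : BijOn M.tau (Icc 0 M.T) (Icc 0 (M.tau 0)) := by
  refine ⟨fun t ht => ⟨?_, ?_⟩, R.strictAntiOn_tau.injOn, ?_⟩
  · rw [← tau_T M]
    exact R.strictAntiOn_tau.antitoneOn ht R.T_mem ht.2
  · exact R.strictAntiOn_tau.antitoneOn R.zero_mem ht ht.1
  · have := intermediate_value_Icc' R.hT.le R.continuousOn_tau
    rwa [tau_T] at this

theorem tau_tInv (R : M.IsRegular) {τ : ℝ} (hτ : τ ∈ Icc 0 (M.tau 0)) : M.tau (M.tInv τ) = τ :=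
  R.bijOn_tau.surjOn.rightInvOn_invFunOn hτ

theorem tInv_tau (R : M.IsRegular) {t : ℝ} (ht : t ∈ Icc 0 M.T) : M.tInv (M.tau t) = t :=
  R.bijOn_tau.injOn.leftInvOn_invFunOn ht

theorem tInv_mem (R : M.IsRegular) {τ : ℝ} (hτ : τ ∈ Icc 0 (M.tau 0)) : M.tInv τ ∈ Icc 0 M.T :=
  R.bijOn_tau.surjOn.mapsTo_invFunOn hτ

theorem tInv_zero (R : M.IsRegular) : M.tInv 0 = M.T := by
  have := R.tInv_tau R.T_mem
  rwa [tau_T] at this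

theorem tInv_mem_Ico (R : M.IsRegular) {τ : ℝ} (hτ : τ ∈ Ioc 0 (M.tau 0)) :
    M.tInv τ ∈ Ico 0 M.T := by
  have h := R.tInv_mem (Ioc_subset_Icc_self hτ)
  refine ⟨h.1, lt_of_le_of_ne h.2 fun h' => ?_⟩
  have := R.tau_tInv (Ioc_subset_Icc_self hτ)
  rw [h', tau_T] at this
  exact hτ.1.ne this

theorem tInv_mem_Ioo (R : M.IsRegular) {τ : ℝ} (hτ : τ ∈ Ioo 0 (M.tau 0)) :
    M.tInv τ ∈ Ioo 0 M.T := by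
  have h := R.tInv_mem_Ico (Ioo_subset_Ioc_self hτ)
  refine ⟨lt_of_le_of_ne h.1 fun h' => ?_, h.2⟩
  have := R.tau_tInv (Ioo_subset_Icc_self hτ)
  rw [← h'] at this
  exact hτ.2.ne this.symm

/-- A continuous bijection from a compact set has a continuous inverse: preimages of closed sets
under `tInv` are images of compact sets under `tau`. -/
theorem continuousOn_tInv (R : M.IsRegular) : ContinuousOn M.tInv (Icc 0 (M.tau 0)) := by
  rw [continuousOn_iff_isClosed]
  intro S hS
  refine ⟨M.tau '' (S ∩ Icc 0 M.T), ?_, ?_⟩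
  · exact ((isCompact_Icc.inter_left hS).image_of_continuousOn
      (R.continuousOn_tau.mono inter_subset_right)).isClosed
  · ext τ
    constructor
    · rintro ⟨h1, h2⟩
      exact ⟨⟨M.tInv τ, ⟨h1, R.tInv_mem h2⟩, R.tau_tInv h2⟩, h2⟩
    · rintro ⟨⟨t, ⟨h1, h2⟩, rfl⟩, h3⟩
      exact ⟨by rwa [mem_preimage, R.tInv_tau h2], h3⟩

theorem hasDerivWithinAt_tInv (R : M.IsRegular) {τ : ℝ} (hτ : τ ∈ Icc 0 (M.tau 0)) :
    HasDerivWithinAt M.tInv (dtau M (M.tInv τ))⁻¹ (Icc 0 (M.tau 0)) τ := by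
  have hne := (R.dtau_neg (R.tInv_mem hτ)).ne
  have hd : HasFDerivWithinAt M.tau (ContinuousLinearEquiv.unitsEquivAut ℝ
      (Units.mk0 (dtau M (M.tInv τ)) hne) : ℝ →L[ℝ] ℝ) (Icc 0 M.T) (M.tInv τ) :=
    (R.hasDerivWithinAt_tau (R.tInv_mem hτ)).hasFDerivWithinAt.congr_fderiv (by ext; simp)
  refine (hd.of_local_left_inverse ?_ hτ ?_).hasDerivWithinAt.congr_deriv ?_
  · exact tendsto_nhdsWithin_of_tendsto_nhds_of_eventually_within _ (R.continuousOn_tInv τ hτ)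
      (eventually_mem_nhdsWithin.mono fun s hs => R.tInv_mem hs)
  · exact eventually_mem_nhdsWithin.mono fun s hs => R.tau_tInv hs
  · simp

/-! #### The coefficients `a` and `f` -/

theorem a_eq (R : M.IsRegular) {t : ℝ} (ht : t ∈ Icc 0 M.T) :
    M.a t = (M.w t + M.r t - M.q t) / (M.g t ^ 2 * M.σ t ^ 2) := by
  have := g_pos M t
  have := R.hσ_pos t ht
  rw [a, R.derivWithin_g ht]
  field_simp
  ring

/-- Under the Riccati equation `w' + r' - q'` equals `(w + r - q)(2σ'/σ + w - r + q)`. Dividing by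
`g² σ²` and subtracting the logarithmic derivative `2w + 2σ'/σ` of the denominator leaves `-a (w + r
- q)`, so no derivative of a coefficient survives. -/
theorem hasDerivWithinAt_a (R : M.IsRegular) {t : ℝ} (ht : t ∈ Icc 0 M.T) :
    HasDerivWithinAt M.a (-(M.a t ^ 2 * M.g t ^ 2 * M.σ t ^ 2)) (Icc 0 M.T) t := by
  have hg := g_pos M t
  have hσ := R.hσ_pos t ht
  have h1 := ((R.hw t ht).add (R.hr t ht).hasDerivWithinAt).sub (R.hq t ht).hasDerivWithinAt
  have h2 := ((R.hasDerivWithinAt_g ht).pow 2).mul ((R.hσ t ht).hasDerivWithinAt.pow 2)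
  have h3 := h1.div h2 (by simp only [Pi.mul_apply, Pi.pow_apply]; positivity)
  refine (h3.congr (fun s hs => R.a_eq hs) (R.a_eq ht)).congr_deriv ?_
  simp only [Pi.mul_apply, Pi.pow_apply, Pi.add_apply, Pi.sub_apply, riccatiRHS, R.a_eq ht]
  field_simp
  push_cast
  ring

theorem continuousOn_a (R : M.IsRegular) : ContinuousOn M.a (Icc 0 M.T) :=
  fun _ ht => (R.hasDerivWithinAt_a ht).continuousWithinAt

/-- The part of `f(t, x)` that does not depend on `x`. -/
def f0 (M : OUCall) (t : ℝ) : ℝ :=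
  1 / 2 * Real.log (M.g t / M.g M.T) + 1 / 2 * ∫ s in M.T..t, (3 * M.r s - M.q s)

theorem hasDerivWithinAt_f0 (R : M.IsRegular) {t : ℝ} (ht : t ∈ Icc 0 M.T) :
    HasDerivWithinAt (f0 M) (1 / 2 * (M.w t + 3 * M.r t - M.q t)) (Icc 0 M.T) t := by
  have hg := g_pos M t
  have hgT := g_pos M M.T
  have hc : ContinuousOn (fun s => 3 * M.r s - M.q s) (Icc 0 M.T) := by
    have := R.hr.continuousOn
    have := R.hq.continuousOn
    fun_prop
  have h1 := ((R.hasDerivWithinAt_g ht).div_const (M.g M.T)).log (by positivity)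
  have h2 := hasDerivWithinAt_primitive hc R.T_mem ht
  refine ((h1.const_mul (1 / 2)).add (h2.const_mul (1 / 2))).congr_deriv ?_
  field_simp
  ring

theorem continuousOn_f0 (R : M.IsRegular) : ContinuousOn (f0 M) (Icc 0 M.T) :=
  fun _ ht => (R.hasDerivWithinAt_f0 ht).continuousWithinAt

end IsRegular

end OUCall

/-- Functions that are continuous on `[0, T)` and integrable. -/
structure ContinuousIntegrableOn (T : ℝ) (f : ℝ → ℝ) : Prop where
  cont : ContinuousOn f (Ico 0 T)
  int : IntegrableOn f (Icc 0 T)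

namespace ContinuousIntegrableOn

variable {T : ℝ} {f k : ℝ → ℝ}

theorem of_continuousOn (h : ContinuousOn f (Icc 0 T)) : ContinuousIntegrableOn T f :=
  ⟨h.mono Ico_subset_Icc_self, h.integrableOn_compact isCompact_Icc⟩

theorem add (hf : ContinuousIntegrableOn T f) (hk : ContinuousIntegrableOn T k) :
    ContinuousIntegrableOn T fun t => f t + k t :=
  ⟨hf.cont.add hk.cont, hf.int.add hk.int⟩

theorem mul_continuousOn (hf : ContinuousIntegrableOn T f) (hk : ContinuousOn k (Icc 0 T)) :
    ContinuousIntegrableOn T fun t => f t * k t :=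
  ⟨hf.cont.mul (hk.mono Ico_subset_Icc_self), hf.int.mul_continuousOn hk isCompact_Icc⟩

end ContinuousIntegrableOn

namespace OUCall.IsRegular

variable {M : OUCall}

/-! #### The exercise boundary in the new variables -/

/-- The derivative of `S_B` on `[0, T)`. -/
def dSB (M : OUCall) (t : ℝ) : ℝ := derivWithin M.SB (Ico 0 M.T) t

theorem hasDerivWithinAt_SB (R : M.IsRegular) {t : ℝ} (ht : t ∈ Ico 0 M.T) :
    HasDerivWithinAt M.SB (dSB M t) (Icc 0 M.T) t := by
  refine ((R.hSB_diff.differentiableOn one_ne_zero) t ht).hasDerivWithinAt.mono_of_mem_nhdsWithin ?_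
  rw [mem_nhdsWithin_iff_eventually]
  filter_upwards [Iio_mem_nhds ht.2] with s hs hs'
  exact ⟨hs'.1, hs⟩

theorem dSB_tame (R : M.IsRegular) : ContinuousIntegrableOn M.T (dSB M) := by
  refine ⟨R.hSB_diff.continuousOn_derivWithin (uniqueDiffOn_Ico _ _) le_rfl, ?_⟩
  rw [integrableOn_Icc_iff_integrableOn_Ioo]
  refine R.hSB_int.congr_fun (fun t ht => ?_) measurableSet_Ioo
  exact (derivWithin_of_mem_nhds (Ico_mem_nhds ht.1 ht.2)).symm

/-- The boundary `S_B(t) g(t)` as a function of `t`. -/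
def bdry (M : OUCall) (t : ℝ) : ℝ := M.SB t * M.g t

/-- The derivative of `bdry`. -/
def dbdry (M : OUCall) (t : ℝ) : ℝ := dSB M t * M.g t + M.SB t * (M.g t * M.w t)

theorem bdry_pos (R : M.IsRegular) {t : ℝ} (ht : t ∈ Icc 0 M.T) : 0 < bdry M t :=
  mul_pos (R.hSB_pos t ht) (g_pos M t)

theorem continuousOn_bdry (R : M.IsRegular) : ContinuousOn (bdry M) (Icc 0 M.T) :=
  R.hSB_cont.mul R.continuousOn_g

theorem hasDerivWithinAt_bdry (R : M.IsRegular) {t : ℝ} (ht : t ∈ Ico 0 M.T) :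
    HasDerivWithinAt (bdry M) (dbdry M t) (Icc 0 M.T) t :=
  (R.hasDerivWithinAt_SB ht).mul (R.hasDerivWithinAt_g (Ico_subset_Icc_self ht))

theorem dbdry_tame (R : M.IsRegular) : ContinuousIntegrableOn M.T (dbdry M) :=
  (R.dSB_tame.mul_continuousOn R.continuousOn_g).add
    (.of_continuousOn (R.hSB_cont.mul (R.continuousOn_g.mul R.continuousOn_w)))

/-- `f` along the boundary. -/
def fbdry (M : OUCall) (t : ℝ) : ℝ := f0 M t - M.a t / 2 * bdry M t ^ 2

/-- The derivative of `fbdry`. -/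
def dfbdry (M : OUCall) (t : ℝ) : ℝ :=
  (1 / 2 * (M.w t + 3 * M.r t - M.q t)
      + M.a t ^ 2 * M.g t ^ 2 * M.σ t ^ 2 / 2 * bdry M t ^ 2)
    + dbdry M t * (-(M.a t * bdry M t))

theorem continuousOn_fbdry (R : M.IsRegular) : ContinuousOn (fbdry M) (Icc 0 M.T) := by
  have := R.continuousOn_f0
  have := R.continuousOn_a
  have := R.continuousOn_bdry
  unfold fbdry
  fun_prop

theorem hasDerivWithinAt_fbdry (R : M.IsRegular) {t : ℝ} (ht : t ∈ Ico 0 M.T) :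
    HasDerivWithinAt (fbdry M) (dfbdry M t) (Icc 0 M.T) t := by
  have ht' := Ico_subset_Icc_self ht
  refine ((R.hasDerivWithinAt_f0 ht').sub (((R.hasDerivWithinAt_a ht').div_const 2).mul
    ((R.hasDerivWithinAt_bdry ht).pow 2))).congr_deriv ?_
  simp only [dfbdry, Pi.pow_apply]
  push_cast
  ring

theorem dfbdry_tame (R : M.IsRegular) : ContinuousIntegrableOn M.T (dfbdry M) := by
  have := R.continuousOn_a
  have := R.continuousOn_bdry
  have := R.continuousOn_g
  have := R.continuousOn_w
  have := R.hr.continuousOn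
  have := R.hq.continuousOn
  have := R.hσ.continuousOn
  exact (ContinuousIntegrableOn.of_continuousOn (by fun_prop)).add
    (R.dbdry_tame.mul_continuousOn (by fun_prop))

/-- `f⁺/y` as a function of `t`. -/
def ratio (M : OUCall) (t : ℝ) : ℝ :=
  (M.SB t - M.K) * Real.exp (-fbdry M t) / bdry M t

/-- The derivative of `ratio`. -/
def dratio (M : OUCall) (t : ℝ) : ℝ :=
  dSB M t * (Real.exp (-fbdry M t) / bdry M t)
    + (dfbdry M t * (-((M.SB t - M.K) * Real.exp (-fbdry M t) / bdry M t))
      + dbdry M t * (-((M.SB t - M.K) * Real.exp (-fbdry M t) / bdry M t ^ 2)))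

theorem continuousOn_ratio (R : M.IsRegular) : ContinuousOn (ratio M) (Icc 0 M.T) := by
  have := R.continuousOn_fbdry
  have := R.hSB_cont
  exact ContinuousOn.div (by fun_prop) R.continuousOn_bdry fun t ht => (R.bdry_pos ht).ne'

theorem hasDerivWithinAt_ratio (R : M.IsRegular) {t : ℝ} (ht : t ∈ Ico 0 M.T) :
    HasDerivWithinAt (ratio M) (dratio M t) (Icc 0 M.T) t := by
  have hb := R.bdry_pos (Ico_subset_Icc_self ht)
  refine ((((R.hasDerivWithinAt_SB ht).sub_const M.K).mul
    (R.hasDerivWithinAt_fbdry ht).neg.exp).div (R.hasDerivWithinAt_bdry ht) hb.ne').congr_deriv ?_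
  simp only [dratio, Pi.mul_apply, Pi.neg_apply]
  field_simp
  ring

/-- Each summand is a derivative that may be singular at `T` times a factor continuous on `[0, T]`,
and such products stay integrable. -/
theorem dratio_tame (R : M.IsRegular) : ContinuousIntegrableOn M.T (dratio M) := by
  have h1 := R.continuousOn_fbdry
  have h2 := R.hSB_cont
  have h3 := R.continuousOn_bdry
  have h4 : ∀ t ∈ Icc 0 M.T, bdry M t ≠ 0 := fun t ht => (R.bdry_pos ht).ne'
  have h5 : ∀ t ∈ Icc 0 M.T, bdry M t ^ 2 ≠ 0 := fun t ht => pow_ne_zero 2 (h4 t ht)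
  refine (R.dSB_tame.mul_continuousOn ?_).add ((R.dfbdry_tame.mul_continuousOn ?_).add
    (R.dbdry_tame.mul_continuousOn ?_))
  · exact ContinuousOn.div (by fun_prop) h3 h4
  · exact (ContinuousOn.div (by fun_prop) h3 h4).neg
  · exact (ContinuousOn.div (by fun_prop) (by fun_prop) h5).neg

/-! #### Passage to the new time -/

/-- The derivative of `tInv`. -/
def dtInv (M : OUCall) (τ : ℝ) : ℝ := (dtau M (M.tInv τ))⁻¹

theorem mapsTo_tInv (R : M.IsRegular) : MapsTo M.tInv (Icc 0 (M.tau 0)) (Icc 0 M.T) :=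
  fun _ hτ => R.tInv_mem hτ

theorem mapsTo_tInv_Ico (R : M.IsRegular) : MapsTo M.tInv (Ioc 0 (M.tau 0)) (Ico 0 M.T) :=
  fun _ hτ => R.tInv_mem_Ico hτ

theorem continuousOn_comp_tInv (R : M.IsRegular) {f : ℝ → ℝ} (hf : ContinuousOn f (Icc 0 M.T)) :
    ContinuousOn (fun τ => f (M.tInv τ)) (Icc 0 (M.tau 0)) :=
  hf.comp R.continuousOn_tInv R.mapsTo_tInv

theorem continuousOn_comp_tInv_Ioc (R : M.IsRegular) {f : ℝ → ℝ}
    (hf : ContinuousOn f (Ico 0 M.T)) :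
    ContinuousOn (fun τ => f (M.tInv τ)) (Ioc 0 (M.tau 0)) :=
  hf.comp (R.continuousOn_tInv.mono Ioc_subset_Icc_self) R.mapsTo_tInv_Ico

theorem continuousOn_dtInv (R : M.IsRegular) : ContinuousOn (dtInv M) (Icc 0 (M.tau 0)) :=
  (R.continuousOn_comp_tInv R.continuousOn_dtau).inv₀ fun _ hτ =>
    (R.dtau_neg (R.tInv_mem hτ)).ne

theorem hasDerivWithinAt_comp_tInv (R : M.IsRegular) {f : ℝ → ℝ} {f' τ : ℝ}
    (hτ : τ ∈ Icc 0 (M.tau 0)) (hf : HasDerivWithinAt f f' (Icc 0 M.T) (M.tInv τ)) :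
    HasDerivWithinAt (fun τ => f (M.tInv τ)) (f' * dtInv M τ) (Icc 0 (M.tau 0)) τ :=
  hf.comp τ (R.hasDerivWithinAt_tInv hτ) R.mapsTo_tInv

/-- Change of variables for an injective map; `tInv` decreases, so the Jacobian is `-dtInv`. -/
theorem integrableOn_comp_tInv (R : M.IsRegular) {f : ℝ → ℝ} (hf : IntegrableOn f (Icc 0 M.T)) :
    IntegrableOn (fun τ => f (M.tInv τ) * dtInv M τ) (Ioc 0 (M.tau 0)) := by
  have hinj : InjOn M.tInv (Ioc 0 (M.tau 0)) := fun a ha b hb h => by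
    rw [← R.tau_tInv (Ioc_subset_Icc_self ha), h, R.tau_tInv (Ioc_subset_Icc_self hb)]
  have h := (integrableOn_image_iff_integrableOn_abs_deriv_smul measurableSet_Ioc
    (fun τ hτ => (R.hasDerivWithinAt_tInv (Ioc_subset_Icc_self hτ)).mono Ioc_subset_Icc_self)
    hinj f).1 (hf.mono_set ((R.mapsTo_tInv_Ico.mono_right Ico_subset_Icc_self).image_subset))
  refine h.neg.congr_fun (fun τ hτ => ?_) measurableSet_Ioc
  have := inv_lt_zero.2 (R.dtau_neg (R.tInv_mem (Ioc_subset_Icc_self hτ)))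
  simp only [Pi.neg_apply, abs_of_neg this, smul_eq_mul, dtInv]
  ring

theorem y_div_g (M : OUCall) (τ : ℝ) : M.y τ / M.g (M.tInv τ) = M.SB (M.tInv τ) :=
  mul_div_cancel_right₀ _ (g_pos M _).ne'

theorem fPlus_div_y (M : OUCall) (τ : ℝ) : M.fPlus τ / M.y τ = ratio M (M.tInv τ) := by
  rw [fPlus, y_div_g]
  rfl

theorem y_pos (R : M.IsRegular) {τ : ℝ} (hτ : τ ∈ Icc 0 (M.tau 0)) : 0 < M.y τ :=
  R.bdry_pos (R.tInv_mem hτ)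

theorem y_zero (R : M.IsRegular) : M.y 0 = M.K := by
  rw [y, R.tInv_zero, R.hSB_T]
  simp [g]

theorem fPlus_zero (R : M.IsRegular) : M.fPlus 0 = 0 := by
  rw [fPlus, y_div_g, R.tInv_zero, R.hSB_T]
  simp

end OUCall.IsRegular

namespace OUCall.IsRegular

variable {M : OUCall} {C : ℝ → ℝ → ℝ}

/-! #### The price in the new variables -/

theorem holding_mem_nhds (R : M.IsRegular) {t S : ℝ} (ht : t ∈ Ioo 0 M.T)
    (hS : S ∈ Ioo 0 (M.SB t)) :
    {p : ℝ × ℝ | p.1 ∈ Ioo 0 M.T ∧ p.2 ∈ Ioo 0 (M.SB p.1)} ∈ 𝓝 (t, S) := by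
  have hc : ContinuousAt M.SB t := R.hSB_cont.continuousAt (Icc_mem_nhds ht.1 ht.2)
  have h1 : ∀ᶠ p : ℝ × ℝ in 𝓝 (t, S), p.1 ∈ Ioo 0 M.T :=
    continuous_fst.continuousAt.eventually (Ioo_mem_nhds ht.1 ht.2)
  have h2 : ∀ᶠ p : ℝ × ℝ in 𝓝 (t, S), 0 < p.2 :=
    continuous_snd.continuousAt.eventually (Ioi_mem_nhds hS.1)
  have hc' : ContinuousAt (fun p : ℝ × ℝ => M.SB p.1 - p.2) (t, S) :=
    (hc.comp (x := (t, S)) (f := Prod.fst) continuousAt_fst).sub continuousAt_snd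
  have h3 : ∀ᶠ p : ℝ × ℝ in 𝓝 (t, S), 0 < M.SB p.1 - p.2 :=
    hc'.eventually (Ioi_mem_nhds (sub_pos.2 hS.2))
  filter_upwards [h1, h2, h3] with p p1 p2 p3 using ⟨p1, p2, sub_pos.1 p3⟩

theorem delta_eq_deriv {t S : ℝ} (hS : S ∈ Ioo 0 (M.SB t)) : M.delta C t S = deriv (C t) S :=
  derivWithin_of_mem_nhds (Icc_mem_nhds hS.1 hS.2)

theorem hasDerivWithinAt_price (hC : M.IsPrice C) {t S : ℝ} (ht : t ∈ Ico 0 M.T)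
    (hS : S ∈ Icc 0 (M.SB t)) :
    HasDerivWithinAt (C t) (M.delta C t S) (Icc 0 (M.SB t)) S :=
  (hC.differentiable_space t ht S hS).hasDerivWithinAt

theorem hasDerivAt_price (hC : M.IsPrice C) {t S : ℝ} (ht : t ∈ Ico 0 M.T)
    (hS : S ∈ Ioo 0 (M.SB t)) : HasDerivAt (C t) (M.delta C t S) S :=
  (hasDerivWithinAt_price hC ht (Ioo_subset_Icc_self hS)).hasDerivAt (Icc_mem_nhds hS.1 hS.2)

/-- The price along a differentiable curve in the interior of the holding region. -/
theorem hasDerivAt_price_curve (R : M.IsRegular) (hC : M.IsPrice C) {s : ℝ} {α β : ℝ → ℝ}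
    {α' β' : ℝ} (hα : HasDerivAt α α' s) (hβ : HasDerivAt β β' s) (ht : α s ∈ Ioo 0 M.T)
    (hS : β s ∈ Ioo 0 (M.SB (α s))) :
    HasDerivAt (fun s => C (α s) (β s))
      (deriv (fun t => C t (β s)) (α s) * α' + M.delta C (α s) (β s) * β') s := by
  have hU := R.holding_mem_nhds ht hS
  set U := {p : ℝ × ℝ | p.1 ∈ Ioo 0 M.T ∧ p.2 ∈ Ioo 0 (M.SB p.1)}
  let Ct : ℝ → ℝ → ℝ →L[ℝ] ℝ := fun t S =>
    ContinuousLinearMap.toSpanSingletonCLE (deriv (fun t' => C t' S) t)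
  let CS : ℝ → ℝ → ℝ →L[ℝ] ℝ := fun t S =>
    ContinuousLinearMap.toSpanSingletonCLE (M.delta C t S)
  -- Continuous partial derivatives in the open holding region give joint differentiability of `C`,
  -- hence the chain rule.
  have key := hasStrictFDerivAt_uncurry_coprod (𝕜 := ℝ) (u := (α s, β s)) (f := C) (f₁ := Ct)
    (f₂ := CS) ?_ ?_ ?_ ?_
  · have h := key.hasFDerivAt.comp_hasDerivAt s (hα.prodMk hβ)
    refine h.congr_deriv ?_
    simp [Ct, CS, Function.HasUncurry.uncurry, mul_comm]
  · filter_upwards [hU] with p hp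
    exact (hC.differentiable_time p.1 hp.1 p.2 hp.2).hasDerivAt.hasFDerivAt
  · filter_upwards [hU] with p hp
    exact (hasDerivAt_price hC (Ioo_subset_Ico_self hp.1) hp.2).hasFDerivAt
  · exact (ContinuousLinearEquiv.continuous _).continuousAt.comp
      (hC.continuousOn_time.continuousAt hU)
  · have h1 : ContinuousOn (fun p : ℝ × ℝ => M.delta C p.1 p.2) U :=
      hC.continuousOn_delta.mono fun p hp =>
        ⟨Ioo_subset_Ico_self hp.1, Ioo_subset_Icc_self hp.2⟩
    exact (ContinuousLinearEquiv.continuous _).continuousAt.comp (h1.continuousAt hU)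

/-- The spatial derivative of `u`. -/
def ux (M : OUCall) (C : ℝ → ℝ → ℝ) (τ x : ℝ) : ℝ :=
  (M.delta C (M.tInv τ) (x / M.g (M.tInv τ)) / M.g (M.tInv τ)
      + M.a (M.tInv τ) * x * C (M.tInv τ) (x / M.g (M.tInv τ)))
    * Real.exp (-M.f (M.tInv τ) x)

/-- The second spatial derivative of `u`. -/
def uxx (M : OUCall) (C : ℝ → ℝ → ℝ) (τ x : ℝ) : ℝ :=
  (deriv (deriv (C (M.tInv τ))) (x / M.g (M.tInv τ)) / M.g (M.tInv τ) ^ 2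
      + 2 * M.a (M.tInv τ) * x
        * (M.delta C (M.tInv τ) (x / M.g (M.tInv τ)) / M.g (M.tInv τ))
      + (M.a (M.tInv τ) + M.a (M.tInv τ) ^ 2 * x ^ 2) * C (M.tInv τ) (x / M.g (M.tInv τ)))
    * Real.exp (-M.f (M.tInv τ) x)

theorem div_g_mem_Icc {τ x : ℝ} (hx : x ∈ Icc 0 (M.y τ)) :
    x / M.g (M.tInv τ) ∈ Icc 0 (M.SB (M.tInv τ)) := by
  have hg := g_pos M (M.tInv τ)
  exact ⟨div_nonneg hx.1 hg.le, (div_le_iff₀ hg).2 hx.2⟩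

theorem div_g_mem_Ioo {τ x : ℝ} (hx : x ∈ Ioo 0 (M.y τ)) :
    x / M.g (M.tInv τ) ∈ Ioo 0 (M.SB (M.tInv τ)) := by
  have hg := g_pos M (M.tInv τ)
  exact ⟨div_pos hx.1 hg, (div_lt_iff₀ hg).2 hx.2⟩

theorem hasDerivAt_exp_neg_f (M : OUCall) (t x : ℝ) :
    HasDerivAt (fun x => Real.exp (-M.f t x)) (M.a t * x * Real.exp (-M.f t x)) x := by
  have h : HasDerivAt (fun x => M.f t x) (-(M.a t * x)) x := by
    have := (((hasDerivAt_id x).pow 2).const_mul (M.a t / 2)).const_sub (f0 M t)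
    refine this.congr_deriv ?_
    simp
    ring
  exact h.neg.exp.congr_deriv (by simp only [Pi.neg_apply]; ring)

theorem hasDerivWithinAt_u (R : M.IsRegular) (hC : M.IsPrice C) {τ x : ℝ}
    (hτ : τ ∈ Ioc 0 (M.tau 0)) (hx : x ∈ Icc 0 (M.y τ)) :
    HasDerivWithinAt (M.u C τ) (ux M C τ x) (Icc 0 (M.y τ)) x := by
  have hd : HasDerivWithinAt (fun x => x / M.g (M.tInv τ)) (1 / M.g (M.tInv τ))
      (Icc 0 (M.y τ)) x := ((hasDerivAt_id x).div_const _).hasDerivWithinAt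
  have h1 := (hasDerivWithinAt_price hC (R.tInv_mem_Ico hτ) (div_g_mem_Icc hx)).comp x hd
    (fun x' hx' => div_g_mem_Icc hx')
  refine (h1.mul (hasDerivAt_exp_neg_f M (M.tInv τ) x).hasDerivWithinAt).congr_deriv ?_
  simp only [ux, Function.comp]
  ring

theorem hasDerivAt_ux (R : M.IsRegular) (hC : M.IsPrice C) {τ x : ℝ}
    (hτ : τ ∈ Ioo 0 (M.tau 0)) (hx : x ∈ Ioo 0 (M.y τ)) :
    HasDerivAt (ux M C τ) (uxx M C τ x) x := by
  have ht := R.tInv_mem_Ioo hτ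
  have hS := div_g_mem_Ioo hx
  have hd : HasDerivAt (fun x => x / M.g (M.tInv τ)) (1 / M.g (M.tInv τ)) x :=
    (hasDerivAt_id x).div_const _
  have h1 : HasDerivAt (fun x => C (M.tInv τ) (x / M.g (M.tInv τ))) _ x :=
    (hasDerivAt_price hC (Ioo_subset_Ico_self ht) hS).comp x hd
  have h2 : HasDerivAt (M.delta C (M.tInv τ))
      (deriv (deriv (C (M.tInv τ))) (x / M.g (M.tInv τ))) (x / M.g (M.tInv τ)) := by
    refine (hC.differentiable_space_two _ ht _ hS).hasDerivAt.congr_of_eventuallyEq ?_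
    filter_upwards [Ioo_mem_nhds hS.1 hS.2] with S hS' using delta_eq_deriv hS'
  have h3 : HasDerivAt (fun x => M.delta C (M.tInv τ) (x / M.g (M.tInv τ))) _ x := h2.comp x hd
  have h4 := (h3.div_const (M.g (M.tInv τ))).add
    (((hasDerivAt_id x).const_mul (M.a (M.tInv τ))).mul h1)
  refine (h4.mul (hasDerivAt_exp_neg_f M (M.tInv τ) x)).congr_deriv ?_
  simp only [uxx, Pi.add_apply, Pi.mul_apply, id]
  ring

theorem hasDerivAt_comp_tInv (R : M.IsRegular) {f : ℝ → ℝ} {f' τ : ℝ}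
    (hτ : τ ∈ Ioo 0 (M.tau 0)) (hf : HasDerivWithinAt f f' (Icc 0 M.T) (M.tInv τ)) :
    HasDerivAt (fun τ => f (M.tInv τ)) (f' * dtInv M τ) τ :=
  (R.hasDerivWithinAt_comp_tInv (Ioo_subset_Icc_self hτ) hf).hasDerivAt
    (Icc_mem_nhds hτ.1 hτ.2)

/-- `u` along a differentiable curve; for constant curves this is the heat equation. -/
theorem hasDerivAt_u_curve (R : M.IsRegular) (hC : M.IsPrice C) {τ : ℝ}
    (hτ : τ ∈ Ioo 0 (M.tau 0)) {X : ℝ → ℝ} {X' : ℝ} (hX : HasDerivAt X X' τ)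
    (hx : X τ ∈ Ioo 0 (M.y τ)) :
    HasDerivAt (fun s => M.u C s (X s)) (uxx M C τ (X τ) + ux M C τ (X τ) * X') τ := by
  have ht := R.tInv_mem_Ioo hτ
  have htI := Ioo_subset_Icc_self ht
  have hS := div_g_mem_Ioo hx
  have hg := g_pos M (M.tInv τ)
  have hσ := R.hσ_pos _ htI
  have d0 : HasDerivAt M.tInv (dtInv M τ) τ :=
    (R.hasDerivWithinAt_tInv (Ioo_subset_Icc_self hτ)).hasDerivAt (Icc_mem_nhds hτ.1 hτ.2)
  have dg := R.hasDerivAt_comp_tInv hτ (R.hasDerivWithinAt_g htI)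
  have da := R.hasDerivAt_comp_tInv hτ (R.hasDerivWithinAt_a htI)
  have df0 := R.hasDerivAt_comp_tInv hτ (R.hasDerivWithinAt_f0 htI)
  have dS := hX.div dg hg.ne'
  have dC := R.hasDerivAt_price_curve hC d0 dS ht hS
  have df : HasDerivAt (fun s => M.f (M.tInv s) (X s)) _ τ :=
    df0.sub ((da.div_const 2).mul (hX.pow 2))
  refine (dC.mul df.neg.exp).congr_deriv ?_
  have hpde := hC.pde _ ht _ hS
  rw [← delta_eq_deriv (C := C) hS] at hpde
  -- Eliminating `C_t` by the pricing equation and `w` by `a` leaves an algebraic identity. The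
  -- derivative of `a` inside `f` supplies exactly the term `a² x² C` of `uxx`.
  have hCt : deriv (fun t' => C t' (X τ / M.g (M.tInv τ))) (M.tInv τ)
      = M.r (M.tInv τ) * C (M.tInv τ) (X τ / M.g (M.tInv τ))
        - 1 / 2 * M.σ (M.tInv τ) ^ 2 * deriv (deriv (C (M.tInv τ))) (X τ / M.g (M.tInv τ))
        - (M.r (M.tInv τ) - M.q (M.tInv τ)) * (X τ / M.g (M.tInv τ))
          * M.delta C (M.tInv τ) (X τ / M.g (M.tInv τ)) := by
    linarith
  have hw : M.w (M.tInv τ) = M.a (M.tInv τ) * (M.g (M.tInv τ) ^ 2 * M.σ (M.tInv τ) ^ 2)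
      - M.r (M.tInv τ) + M.q (M.tInv τ) := by
    rw [R.a_eq htI]
    field_simp
    ring
  have hdt : dtInv M τ = -2 / (M.σ (M.tInv τ) ^ 2 * M.g (M.tInv τ) ^ 2) := by
    rw [dtInv, dtau]
    field_simp
  simp only [uxx, ux, Pi.div_apply, Pi.neg_apply, hCt, hw, hdt]
  generalize M.delta C (M.tInv τ) (X τ / M.g (M.tInv τ)) = c1
  generalize deriv (deriv (C (M.tInv τ))) (X τ / M.g (M.tInv τ)) = c2
  generalize C (M.tInv τ) (X τ / M.g (M.tInv τ)) = c0
  generalize Real.exp (-M.f (M.tInv τ) (X τ)) = e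
  field_simp
  push_cast
  ring

theorem continuousOn_fst_tInv (R : M.IsRegular) {f : ℝ → ℝ} (hf : ContinuousOn f (Icc 0 M.T))
    {U : Set (ℝ × ℝ)} (hU : ∀ p ∈ U, p.1 ∈ Icc 0 (M.tau 0)) :
    ContinuousOn (fun p : ℝ × ℝ => f (M.tInv p.1)) U :=
  (R.continuousOn_comp_tInv hf).comp continuousOn_fst hU

theorem continuousOn_exp_neg_f (R : M.IsRegular) {U : Set (ℝ × ℝ)}
    (hU : ∀ p ∈ U, p.1 ∈ Icc 0 (M.tau 0)) :
    ContinuousOn (fun p : ℝ × ℝ => Real.exp (-M.f (M.tInv p.1) p.2)) U := by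
  have h1 := R.continuousOn_fst_tInv R.continuousOn_f0 hU
  have h2 := R.continuousOn_fst_tInv R.continuousOn_a hU
  exact ((h1.sub ((h2.div_const 2).mul (continuousOn_snd.pow 2))).neg).rexp

theorem continuousOn_div_g (R : M.IsRegular) {U : Set (ℝ × ℝ)}
    (hU : ∀ p ∈ U, p.1 ∈ Icc 0 (M.tau 0)) :
    ContinuousOn (fun p : ℝ × ℝ => (M.tInv p.1, p.2 / M.g (M.tInv p.1))) U :=
  (R.continuousOn_tInv.comp continuousOn_fst hU).prodMk
    (continuousOn_snd.div (R.continuousOn_fst_tInv R.continuousOn_g hU)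
      fun _ _ => (g_pos M _).ne')

theorem continuousOn_u (R : M.IsRegular) (hC : M.IsPrice C) :
    ContinuousOn (fun p : ℝ × ℝ => M.u C p.1 p.2)
      {p : ℝ × ℝ | p.1 ∈ Icc 0 (M.tau 0) ∧ p.2 ∈ Icc 0 (M.y p.1)} :=
  (hC.continuousOn.comp (R.continuousOn_div_g fun _ hp => hp.1)
    fun _ hp => ⟨R.tInv_mem hp.1, div_g_mem_Icc hp.2⟩).mul
    (R.continuousOn_exp_neg_f fun _ hp => hp.1)

theorem continuousOn_ux (R : M.IsRegular) (hC : M.IsPrice C) :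
    ContinuousOn (fun p : ℝ × ℝ => ux M C p.1 p.2)
      {p : ℝ × ℝ | p.1 ∈ Ioc 0 (M.tau 0) ∧ p.2 ∈ Icc 0 (M.y p.1)} := by
  set U := {p : ℝ × ℝ | p.1 ∈ Ioc 0 (M.tau 0) ∧ p.2 ∈ Icc 0 (M.y p.1)}
  have hU : ∀ p ∈ U, p.1 ∈ Icc 0 (M.tau 0) := fun p hp => Ioc_subset_Icc_self hp.1
  have h0 := hC.continuousOn.comp (R.continuousOn_div_g hU)
    fun p hp => ⟨R.tInv_mem (hU p hp), div_g_mem_Icc hp.2⟩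
  have h1 := hC.continuousOn_delta.comp (R.continuousOn_div_g hU)
    fun p hp => ⟨R.tInv_mem_Ico hp.1, div_g_mem_Icc hp.2⟩
  have ha := R.continuousOn_fst_tInv R.continuousOn_a hU
  have hg := R.continuousOn_fst_tInv R.continuousOn_g hU
  exact ((h1.div hg fun _ _ => (g_pos M _).ne').add ((ha.mul continuousOn_snd).mul h0)).mul
    (R.continuousOn_exp_neg_f hU)

theorem continuousOn_uxx (R : M.IsRegular) (hC : M.IsPrice C) :
    ContinuousOn (fun p : ℝ × ℝ => uxx M C p.1 p.2)
      {p : ℝ × ℝ | p.1 ∈ Ioo 0 (M.tau 0) ∧ p.2 ∈ Ioo 0 (M.y p.1)} := by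
  set U := {p : ℝ × ℝ | p.1 ∈ Ioo 0 (M.tau 0) ∧ p.2 ∈ Ioo 0 (M.y p.1)}
  have hU : ∀ p ∈ U, p.1 ∈ Icc 0 (M.tau 0) := fun p hp => Ioo_subset_Icc_self hp.1
  have h0 := hC.continuousOn.comp (R.continuousOn_div_g hU)
    fun p hp => ⟨R.tInv_mem (hU p hp), div_g_mem_Icc (Ioo_subset_Icc_self hp.2)⟩
  have h1 := hC.continuousOn_delta.comp (R.continuousOn_div_g hU)
    fun p hp => ⟨R.tInv_mem_Ico (Ioo_subset_Ioc_self hp.1),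
      div_g_mem_Icc (Ioo_subset_Icc_self hp.2)⟩
  have h2 := hC.continuousOn_space_two.comp (R.continuousOn_div_g hU)
    fun p hp => ⟨R.tInv_mem_Ioo hp.1, div_g_mem_Ioo hp.2⟩
  have ha := R.continuousOn_fst_tInv R.continuousOn_a hU
  have hg := R.continuousOn_fst_tInv R.continuousOn_g hU
  exact (((h2.div (hg.pow 2) fun _ _ => pow_ne_zero 2 (g_pos M _).ne').add
    (((continuousOn_const.mul ha).mul continuousOn_snd).mul
      (h1.div hg fun _ _ => (g_pos M _).ne'))).add
    ((ha.add ((ha.pow 2).mul (continuousOn_snd.pow 2))).mul h0)).mul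
    (R.continuousOn_exp_neg_f hU)

/-- At maturity the holding region is `S ≤ S_B(T) = K`, where the payoff is zero. -/
theorem u_zero_time (R : M.IsRegular) (hC : M.IsPrice C) {x : ℝ} (hx : x ∈ Icc 0 (M.y 0)) :
    M.u C 0 x = 0 := by
  have hS := div_g_mem_Icc hx
  rw [u]
  rw [R.tInv_zero] at hS ⊢
  rw [hC.terminal _ hS, max_eq_right (by linarith [hS.2, R.hSB_T]), zero_mul]

theorem u_left (R : M.IsRegular) (hC : M.IsPrice C) {τ : ℝ} (hτ : τ ∈ Icc 0 (M.tau 0)) :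
    M.u C τ 0 = 0 := by
  rw [u, zero_div, hC.left_boundary _ (R.tInv_mem hτ), zero_mul]

theorem u_right (R : M.IsRegular) (hC : M.IsPrice C) {τ : ℝ} (hτ : τ ∈ Icc 0 (M.tau 0)) :
    M.u C τ (M.y τ) = M.fPlus τ := by
  rw [u, fPlus, y_div_g, hC.value_matching _ (R.tInv_mem hτ)]

theorem ux_right (R : M.IsRegular) (hC : M.IsPrice C) {τ : ℝ} (hτ : τ ∈ Ioc 0 (M.tau 0)) :
    ux M C τ (M.y τ) = M.gradU τ := by
  have ht := R.tInv_mem_Ico hτ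
  have hg := g_pos M (M.tInv τ)
  rw [ux, y_div_g, hC.smooth_fit _ ht, hC.value_matching _ (Ico_subset_Icc_self ht), gradU, y]
  field_simp

theorem continuousOn_gradU (R : M.IsRegular) : ContinuousOn M.gradU (Icc 0 (M.tau 0)) := by
  have h1 := R.continuousOn_comp_tInv R.continuousOn_fbdry
  have h2 := R.continuousOn_comp_tInv R.continuousOn_g
  have h3 := R.continuousOn_comp_tInv R.continuousOn_a
  have h4 := R.continuousOn_comp_tInv R.continuousOn_bdry
  exact (h1.neg.rexp.div h2 fun _ _ => (g_pos M _).ne').mul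
    (continuousOn_const.add ((h4.mul (h4.sub (continuousOn_const.mul h2))).mul h3))

/-- The transformed price solves the heat equation below the transformed boundary. -/
theorem isHeatBelow (R : M.IsRegular) (hC : M.IsPrice C) :
    IsHeatBelow (M.tau 0) M.y (fun τ => dbdry M (M.tInv τ) * dtInv M τ)
      (fun τ => M.fPlus τ / M.y τ) (fun τ => dratio M (M.tInv τ) * dtInv M τ) M.gradU
      (M.u C) (ux M C) (uxx M C) where
  y_cont := R.continuousOn_comp_tInv R.continuousOn_bdry
  y_pos _ hs := R.y_pos hs
  y'_cont := (R.continuousOn_comp_tInv_Ioc R.dbdry_tame.cont).mul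
    (R.continuousOn_dtInv.mono Ioc_subset_Icc_self)
  y_deriv s hs := R.hasDerivWithinAt_comp_tInv (Ioc_subset_Icc_self hs)
    (R.hasDerivWithinAt_bdry (R.tInv_mem_Ico hs))
  h_cont := by
    simp_rw [fPlus_div_y]
    exact R.continuousOn_comp_tInv R.continuousOn_ratio
  h'_cont := (R.continuousOn_comp_tInv_Ioc R.dratio_tame.cont).mul
    (R.continuousOn_dtInv.mono Ioc_subset_Icc_self)
  h_deriv s hs := by
    simp_rw [fPlus_div_y]
    exact R.hasDerivWithinAt_comp_tInv (Ioc_subset_Icc_self hs)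
      (R.hasDerivWithinAt_ratio (R.tInv_mem_Ico hs))
  h'_int := R.integrableOn_comp_tInv R.dratio_tame.int
  D_cont := R.continuousOn_gradU
  u_cont := R.continuousOn_u hC
  ux_cont := R.continuousOn_ux hC
  uxx_cont := R.continuousOn_uxx hC
  ux_deriv _ hs _ hx := R.hasDerivWithinAt_u hC hs hx
  uxx_deriv _ hs _ hx := R.hasDerivAt_ux hC hs hx
  curve _ hs _ _ hX hx := R.hasDerivAt_u_curve hC hs hX hx
  initial _ hx := R.u_zero_time hC hx
  left _ hs := R.u_left hC hs
  right s hs := by rw [R.u_right hC hs, div_mul_cancel₀ _ (R.y_pos hs).ne']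
  flux _ hs := R.ux_right hC hs

end OUCall.IsRegular

/-! ### The Volterra equation and the price formula -/

theorem intervalIntegral_congr_Ioo {f k : ℝ → ℝ} {a b : ℝ} (hab : a ≤ b)
    (h : ∀ s ∈ Ioo a b, f s = k s) : ∫ s in a..b, f s = ∫ s in a..b, k s := by
  rw [intervalIntegral.integral_of_le hab, intervalIntegral.integral_of_le hab,
    integral_Ioc_eq_integral_Ioo, integral_Ioc_eq_integral_Ioo]
  exact setIntegral_congr_fun measurableSet_Ioo h

theorem IntervalIntegrable.congr_Ioo {f k : ℝ → ℝ} {a b : ℝ} (hab : a ≤ b)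
    (hf : IntervalIntegrable f volume a b) (h : ∀ s ∈ Ioo a b, f s = k s) :
    IntervalIntegrable k volume a b := by
  rw [intervalIntegrable_iff_integrableOn_Ioo_of_le hab] at hf ⊢
  exact hf.congr_fun h measurableSet_Ioo

namespace OUCall.IsRegular

open IsHeatBelow

variable {M : OUCall} {C : ℝ → ℝ → ℝ}

theorem lam_eq (R : M.IsRegular) (hC : M.IsPrice C) {s : ℝ} (hs : s ∈ Ioo 0 (M.tau 0)) (ξ : ℝ) :
    M.lam s ξ = -ξ * (dratio M (M.tInv s) * dtInv M s) := by
  rw [lam, ((R.isHeatBelow hC).hasDerivAt_h hs).deriv]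

/-- The crude factor `|n|` matches the weight bound of `kernel_representation`; it is harmless at `n
= 0`, where the sine vanishes. -/
theorem abs_sin_wave_le {L : ℝ} (n : ℤ) (x : ℝ) :
    |Real.sin (wave L n * x)| ≤ 1 * |(n : ℝ)| := by
  rcases eq_or_ne n 0 with rfl | hn
  · simp [wave_zero]
  · have hn' : 1 ≤ |(n : ℝ)| := by exact_mod_cast Int.one_le_abs hn
    rw [one_mul]
    exact (Real.abs_sin_le_one _).trans hn'

/-- The weights `sin (k x)` produce `B₀(x, τ | ·, ·)`. Both sides sum the sine series of `v`, and
adding back `x h` gives `u`. -/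
theorem price_representation (R : M.IsRegular) (hC : M.IsPrice C) {τ x : ℝ}
    (hτ : τ ∈ Ioc 0 (M.tau 0)) (hx : x ∈ Icc 0 (M.y τ)) :
    IntervalIntegrable (fun s => M.Psi s * M.B0 x τ (M.y s) s) volume 0 τ ∧
    (∀ s ∈ Ioo 0 τ, IntervalIntegrable (fun ξ => M.lam s ξ * M.B0 x τ ξ s) volume 0 (M.y s)) ∧
    IntervalIntegrable (fun s => ∫ ξ in (0 : ℝ)..M.y s, M.lam s ξ * M.B0 x τ ξ s) volume 0 τ ∧
    M.u C τ x = M.uRep τ x := by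
  have H := R.isHeatBelow hC
  have hy := R.y_pos (Ioc_subset_Icc_self hτ)
  have hPsi : ∀ s, M.gradU s - M.fPlus s / M.y s = M.Psi s := fun s => by rw [Psi]; ring
  obtain ⟨h1, h2, h3, h4⟩ := H.kernel_representation hτ
    (κ := fun n => Real.sin (wave (M.y τ) n * x)) (fun n => abs_sin_wave_le n x)
    (Kr := fun ξ s => M.B0 x τ ξ s)
    (fun s hs ξ => by
      rw [B0_eq_B0Theta hy hs.2]
      exact hasSum_B0Theta hy hs.2 x ξ)
    (lam := M.lam) (fun s hs ξ => R.lam_eq hC ⟨hs.1, hs.2.trans_le hτ.2⟩ ξ)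
  simp only [hPsi] at h1 h4
  refine ⟨h1, h2, h3, ?_⟩
  have := (H.hasSum_sineCoeff hτ hx).unique h4
  rw [uRep, ← this]
  ring

/-- The weights `k cos (k y(τ))` produce `∂B₀/∂x` at the boundary, and the differentiated sine
series has sum `D - h`. -/
theorem gradient_representation (R : M.IsRegular) (hC : M.IsPrice C) {τ : ℝ}
    (hτ : τ ∈ Ioc 0 (M.tau 0)) :
    IntervalIntegrable (fun s => M.Psi s * M.B1 (M.y τ) τ (M.y s) s) volume 0 τ ∧
    (∀ s ∈ Ioo 0 τ,
      IntervalIntegrable (fun ξ => M.lam s ξ * M.B1 (M.y τ) τ ξ s) volume 0 (M.y s)) ∧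
    IntervalIntegrable (fun s => ∫ ξ in (0 : ℝ)..M.y s, M.lam s ξ * M.B1 (M.y τ) τ ξ s)
      volume 0 τ ∧
    M.gradU τ - M.fPlus τ / M.y τ = (∫ s in (0 : ℝ)..τ, M.Psi s * M.B1 (M.y τ) τ (M.y s) s)
      + ∫ s in (0 : ℝ)..τ, ∫ ξ in (0 : ℝ)..M.y s, M.lam s ξ * M.B1 (M.y τ) τ ξ s := by
  have H := R.isHeatBelow hC
  have hy := R.y_pos (Ioc_subset_Icc_self hτ)
  have hPsi : ∀ s, M.gradU s - M.fPlus s / M.y s = M.Psi s := fun s => by rw [Psi]; ring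
  obtain ⟨h1, h2, h3, h4⟩ := H.kernel_representation hτ
    (κ := fun n => wave (M.y τ) n * Real.cos (wave (M.y τ) n * M.y τ)) (C₀ := Real.pi / M.y τ)
    (fun n => by
      rw [abs_mul, ← abs_wave hy]
      exact mul_le_of_le_one_right (abs_nonneg _) (Real.abs_cos_le_one _))
    (Kr := fun ξ s => M.B1 (M.y τ) τ ξ s)
    (fun s hs ξ => hasSum_B1 hy hs.2 (M.y τ) ξ)
    (lam := M.lam) (fun s hs ξ => R.lam_eq hC ⟨hs.1, hs.2.trans_le hτ.2⟩ ξ)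
  have h5 := (H.hasSum_sineCoeff_deriv hτ).unique h4
  simp only [hPsi] at h1 h5
  exact ⟨h1, h2, h3, by rw [hPsi, h5]⟩

/-- Both forms rewrite the boundary kernel of `gradient_representation` pointwise for `s < τ`:
through `θ₃'`, or by splitting the direct Gaussian from the other images. The end point `s = τ` is
negligible. -/
theorem volterra (R : M.IsRegular) (hC : M.IsPrice C) {τ : ℝ} (hτ : τ ∈ Ioc 0 (M.tau 0)) :
    IntervalIntegrable
      (fun s => M.Psi s * theta3' (M.phiMinus (M.y τ) (M.y s) τ) (M.omega2 s τ)) volume 0 τ ∧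
    (∀ s ∈ Ioo 0 τ,
      IntervalIntegrable (fun ξ => M.lam s ξ * M.B1 (M.y τ) τ ξ s) volume 0 (M.y s)) ∧
    IntervalIntegrable (fun s => ∫ ξ in (0 : ℝ)..M.y s, M.lam s ξ * M.B1 (M.y τ) τ ξ s)
      volume 0 τ ∧
    M.gradU τ = M.fPlus τ / M.y τ
      + Real.pi / (2 * M.y τ ^ 2) * (∫ s in (0 : ℝ)..τ,
          M.Psi s * theta3' (M.phiMinus (M.y τ) (M.y s) τ) (M.omega2 s τ))
      + (∫ s in (0 : ℝ)..τ, ∫ ξ in (0 : ℝ)..M.y s, M.lam s ξ * M.B1 (M.y τ) τ ξ s) ∧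
    M.gradU τ = -(∫ s in (0 : ℝ)..τ,
          M.Psi s * (M.gaussKernel τ s (M.y s) - M.upsilonPlus τ s (M.y s)))
      + (∫ s in (0 : ℝ)..τ, ∫ ξ in (0 : ℝ)..M.y s, M.lam s ξ * M.B1 (M.y τ) τ ξ s)
      + M.fPlus τ / M.y τ := by
  have hy := R.y_pos (Ioc_subset_Icc_self hτ)
  have hpi := Real.pi_pos
  obtain ⟨h1, h2, h3, h4⟩ := R.gradient_representation hC hτ
  have e1 : ∀ s ∈ Ioo 0 τ, Real.pi / (2 * M.y τ ^ 2) *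
      (M.Psi s * theta3' (M.phiMinus (M.y τ) (M.y s) τ) (M.omega2 s τ))
      = M.Psi s * M.B1 (M.y τ) τ (M.y s) s := fun s hs => by
    rw [← theta3'_eq_B1 hy hs.2]; ring
  have e2 : ∀ s ∈ Ioo 0 τ, -(M.Psi s * (M.gaussKernel τ s (M.y s) - M.upsilonPlus τ s (M.y s)))
      = M.Psi s * M.B1 (M.y τ) τ (M.y s) s := fun s hs => by
    rw [upsilonPlus, (hasSum_upsilonTerm hy hs.2 (M.y s)).tsum_eq, ← theta3'_eq_B1 hy hs.2]
    ring
  refine ⟨?_, h2, h3, ?_, ?_⟩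
  · refine (h1.const_mul (Real.pi / (2 * M.y τ ^ 2))⁻¹).congr_Ioo hτ.1.le fun s hs => ?_
    rw [← e1 s hs, inv_mul_cancel_left₀ (by positivity)]
  · rw [← intervalIntegral.integral_const_mul, intervalIntegral_congr_Ioo hτ.1.le e1]
    linarith
  · rw [← intervalIntegral.integral_neg, intervalIntegral_congr_Ioo hτ.1.le e2]
    linarith

theorem heat_equation (R : M.IsRegular) (hC : M.IsPrice C) {τ x : ℝ} (hτ : τ ∈ Ioo 0 (M.tau 0))
    (hx : x ∈ Ioo 0 (M.y τ)) : DifferentiableAt ℝ (M.u C τ) x ∧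
      ∃ D : ℝ, HasDerivAt (fun s => M.u C s x) D τ ∧ HasDerivAt (deriv (M.u C τ)) D x := by
  have hd : ∀ x ∈ Ioo 0 (M.y τ), HasDerivAt (M.u C τ) (ux M C τ x) x := fun x hx =>
    (R.hasDerivWithinAt_u hC (Ioo_subset_Ioc_self hτ) (Ioo_subset_Icc_self hx)).hasDerivAt
      (Icc_mem_nhds hx.1 hx.2)
  refine ⟨(hd x hx).differentiableAt, uxx M C τ x, ?_, ?_⟩
  · simpa using R.hasDerivAt_u_curve hC hτ (hasDerivAt_const τ x) hx
  · refine (R.hasDerivAt_ux hC hτ hx).congr_of_eventuallyEq ?_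
    filter_upwards [Ioo_mem_nhds hx.1 hx.2] with x' hx' using (hd x' hx').deriv

theorem price_eq (R : M.IsRegular) (hC : M.IsPrice C) {t S : ℝ} (ht : t ∈ Ico 0 M.T)
    (hS : S ∈ Icc 0 (M.SB t)) :
    C t S = Real.exp (M.f t (S * M.g t)) * M.uRep (M.tau t) (S * M.g t) := by
  have ht' := Ico_subset_Icc_self ht
  have hg := g_pos M t
  have hτ : M.tau t ∈ Ioc 0 (M.tau 0) := by
    refine ⟨?_, (R.bijOn_tau.mapsTo ht').2⟩
    have := R.strictAntiOn_tau ht' R.T_mem ht.2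
    rwa [tau_T] at this
  have hinv := R.tInv_tau ht'
  have hx : S * M.g t ∈ Icc 0 (M.y (M.tau t)) := by
    rw [y, hinv]
    exact ⟨mul_nonneg hS.1 hg.le, mul_le_mul_of_nonneg_right hS.2 hg.le⟩
  rw [← (R.price_representation hC hτ hx).2.2.2, u, hinv, mul_div_cancel_right₀ _ hg.ne',
    mul_left_comm, ← Real.exp_add, add_neg_cancel, Real.exp_zero, mul_one]

end OUCall.IsRegular

end

theorem mainTheorem3 (M : OUCall) (C : ℝ → ℝ → ℝ)
    (hT : 0 < M.T)
    (hr : DifferentiableOn ℝ M.r (Icc 0 M.T))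
    (hq : DifferentiableOn ℝ M.q (Icc 0 M.T))
    (hσ : DifferentiableOn ℝ M.σ (Icc 0 M.T))
    (hσ_pos : ∀ t ∈ Icc 0 M.T, 0 < M.σ t)
    (hw : ∀ t ∈ Icc 0 M.T, HasDerivWithinAt M.w (M.riccatiRHS t) (Icc 0 M.T) t)
    (hSB_pos : ∀ t ∈ Icc 0 M.T, 0 < M.SB t)
    (hSB_cont : ContinuousOn M.SB (Icc 0 M.T))
    (hSB_diff : ContDiffOn ℝ 1 M.SB (Ico 0 M.T))
    (hSB_int : IntegrableOn (deriv M.SB) (Ioo 0 M.T))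
    (hSB_T : M.SB M.T = M.K)
    (hC : M.IsPrice C) :
    -- the change of time is a bijection from `[0, T]` onto `[0, τ(0)]`
    (BijOn M.tau (Icc 0 M.T) (Icc 0 (M.tau 0))) ∧
    -- reduction to the heat equation on `[0, y(τ)]`
    (∀ τ ∈ Ioo 0 (M.tau 0), ∀ x ∈ Ioo 0 (M.y τ), DifferentiableAt ℝ (M.u C τ) x ∧
      ∃ D : ℝ, HasDerivAt (fun s => M.u C s x) D τ ∧ HasDerivAt (deriv (M.u C τ)) D x) ∧
    (∀ x ∈ Icc 0 (M.y 0), M.u C 0 x = 0) ∧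
    (∀ τ ∈ Icc 0 (M.tau 0), M.u C τ 0 = 0 ∧ M.u C τ (M.y τ) = M.fPlus τ) ∧
    (M.y 0 = M.K ∧ M.fPlus 0 = 0) ∧
    -- the gradient at the moving boundary, explicit in terms of `y`
    (∀ τ ∈ Ioc 0 (M.tau 0),
      HasDerivWithinAt (M.u C τ) (M.gradU τ) (Icc 0 (M.y τ)) (M.y τ)) ∧
    -- image series and theta forms of the kernels
    (∀ τ ∈ Ioc 0 (M.tau 0), ∀ s ∈ Ico 0 τ, ∀ x ξ : ℝ,
      HasSum (fun n : ℤ => M.Upsilon n x τ ξ s) (M.B0Theta x τ ξ s) ∧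
      HasDerivAt (fun x' => M.B0 x' τ ξ s) (M.B1 x τ ξ s) x ∧
      HasSum (fun n : {n : ℤ // n ≠ 0} => M.upsilonTerm n τ s ξ)
        (Real.pi / (2 * M.y τ ^ 2) * theta3' (M.phiMinus (M.y τ) ξ τ) (M.omega2 s τ)
          + M.gaussKernel τ s ξ)) ∧
    -- the nonlinear Volterra equation for `y`, in its two forms
    (∀ τ ∈ Ioc 0 (M.tau 0),
      IntervalIntegrable
        (fun s => M.Psi s * theta3' (M.phiMinus (M.y τ) (M.y s) τ) (M.omega2 s τ)) volume 0 τ ∧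
      (∀ s ∈ Ioo 0 τ, IntervalIntegrable
        (fun ξ => M.lam s ξ * M.B1 (M.y τ) τ ξ s) volume 0 (M.y s)) ∧
      IntervalIntegrable
        (fun s => ∫ ξ in (0 : ℝ)..M.y s, M.lam s ξ * M.B1 (M.y τ) τ ξ s) volume 0 τ ∧
      M.gradU τ = M.fPlus τ / M.y τ
        + Real.pi / (2 * M.y τ ^ 2) * (∫ s in (0 : ℝ)..τ,
            M.Psi s * theta3' (M.phiMinus (M.y τ) (M.y s) τ) (M.omega2 s τ))
        + (∫ s in (0 : ℝ)..τ, ∫ ξ in (0 : ℝ)..M.y s, M.lam s ξ * M.B1 (M.y τ) τ ξ s) ∧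
      M.gradU τ = -(∫ s in (0 : ℝ)..τ,
            M.Psi s * (M.gaussKernel τ s (M.y s) - M.upsilonPlus τ s (M.y s)))
        + (∫ s in (0 : ℝ)..τ, ∫ ξ in (0 : ℝ)..M.y s, M.lam s ξ * M.B1 (M.y τ) τ ξ s)
        + M.fPlus τ / M.y τ) ∧
    -- the semi-analytic representation of the transformed price and of the price
    (∀ τ ∈ Ioc 0 (M.tau 0), ∀ x ∈ Icc 0 (M.y τ),
      IntervalIntegrable (fun s => M.Psi s * M.B0 x τ (M.y s) s) volume 0 τ ∧
      (∀ s ∈ Ioo 0 τ, IntervalIntegrable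
        (fun ξ => M.lam s ξ * M.B0 x τ ξ s) volume 0 (M.y s)) ∧
      IntervalIntegrable
        (fun s => ∫ ξ in (0 : ℝ)..M.y s, M.lam s ξ * M.B0 x τ ξ s) volume 0 τ ∧
      M.u C τ x = M.uRep τ x) ∧
    (∀ t ∈ Ico 0 M.T, ∀ S ∈ Icc 0 (M.SB t),
      C t S = Real.exp (M.f t (S * M.g t)) * M.uRep (M.tau t) (S * M.g t)) := by
  have R : M.IsRegular :=
    ⟨hT, hr, hq, hσ, hσ_pos, hw, hSB_pos, hSB_cont, hSB_diff, hSB_int, hSB_T⟩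
  refine ⟨R.bijOn_tau, fun τ hτ x hx => R.heat_equation hC hτ hx, fun x hx => R.u_zero_time hC hx,
    fun τ hτ => ⟨R.u_left hC hτ, R.u_right hC hτ⟩, ⟨R.y_zero, R.fPlus_zero⟩, fun τ hτ => ?_,
    fun τ hτ s hs x ξ => ?_, fun τ hτ => R.volterra hC hτ,
    fun τ hτ x hx => R.price_representation hC hτ hx, fun t ht S hS => R.price_eq hC ht hS⟩
  · have hy := R.y_pos (Ioc_subset_Icc_self hτ)
    have := R.hasDerivWithinAt_u hC hτ (right_mem_Icc.2 hy.le)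
    rwa [R.ux_right hC hτ] at this
  · have hy := R.y_pos (Ioc_subset_Icc_self hτ)
    exact ⟨OUCall.hasSum_Upsilon hy hs.2 x ξ, OUCall.hasDerivAt_B0 hy hs.2 x ξ,
      OUCall.hasSum_upsilonTerm hy hs.2 ξ⟩
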